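/- **Setting.** Let $\mathcal X=[0,1]$ and let $\bar\mu$ be Lebesgue measure on it. Fix a discount factor $\gamma\in(0,1)$, eigenvalues $\lambda_1\ge\lambda_2\ge\dots\ge 0$ with $\lambda_2>0$ and $\sum_j\lambda_j\le b^2/4$ for some $b>0$, a sample size $n$, and parameters $(\bar R,\bar\sigma,\bar\varrho_\perp,\bar\tau_*)$ with $\bar\sigma>0$. Put $\bar\zeta=(1-\gamma)^{-1}\bar\sigma+\sqrt{\bar\tau_*}\,\bar\varrho_\perp$, let $\delta_n$ be the smallest positive solution of the critical inequality $$\sqrt{\textstyle\sum_{j\ge1}\min\{\lambda_j/\delta^2,1\}}\ \le\ \frac{\sqrt n\,\bar R}{2\bar\zeta}\,\delta ,$$ and let $d_n=\max\{j:\lambda_j\ge\delta_n^2\}$. For a reproducing kernel Hilbert space (RKHS) $\mathbb H$ of functions on $[0,1]$ and a reward function $r\in\mathbb H$, let $\mathfrak C$ be the family of all Markov reward processes $\mathscr I=(r,\mathcal P,\gamma)$ on $[0,1]$ with a unique stationary distribution $\mu$ such that, with value function $V^*=(\mathcal I-\gamma\mathcal P)^{-1}r$ and $V^*_{\mathbb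 H}$ the $L^2(\mu)$-projection of $V^*$ onto the closure of $\mathbb H$: * $V^*_{\mathbb H}\in\mathbb H$ and $\max\{\|V^*_{\mathbb H}\|_{\mathbb H},\ \|r\|_\infty/b\}\le\bar R$; * $\mathbb E_{X\sim\mu}\operatorname{Var}[V^*(X')\mid X]\le\bar\sigma^2$, where $X'\sim\mathcal P(\cdot\mid X)$; * $\|V^*-V^*_{\mathbb H}\|_\mu\le\bar\varrho_\perp$; * there is a probability measure $\nu$ with $\|d\nu/d\mu\|_\infty<\infty$ and $\mathcal P(B\mid x)\ge\nu(B)/\bar\tau_*$ for all $x$ and all Borel sets $B$; * $\chi^2(\mu\,\|\,\bar\mu)\le\bar\tau_*\bar R^2\delta_n^2/(400\,\bar\zeta^2)$. **Theorem (minimax lower bound).** There are universal constants $c,c_2>0$ and, for every $c_{\mathrm{reg}}>0$ and $\gamma_0>0$, a constant $c_1>0$ depending only on $c_{\mathrm{reg}}$ and $\gamma_0$, such that the following holds whenever $\gamma_0\le\gamma<1$. Suppose that the eigenvalues are regular, $\frac{2\bar\zeta^2}{\bar R^2}\,d_n\ge c_{\mathrm{reg}}\,n\,\delta_n^2$; that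 the sample size is large enough that $\bar R^2\delta_n^2\le c\,\bar\zeta^2/\bar\tau_*$ and $\delta_n\le c\,b$; and that $$\bar R\ge\max\Big\{\tfrac{2}{\sqrt{\lambda_2}}(\bar\sigma+\bar\varrho_\perp),\ \tfrac1{4b}\bar\sigma\Big\},\qquad \tfrac1{50}\,\bar\sigma(1-\gamma)^{-1}\sqrt{d_n/n}\ \le\ \bar\varrho_\perp\ \le\ \tfrac1{108}\,\bar\sigma\min\{(1-\gamma)^{-1},\sqrt{\bar\tau_*}\},\qquad \bar\tau_*\ge(1-\gamma)^{-1}.$$ Then there is an RKHS $\mathbb H$ on $[0,1]$, containing the constant functions, whose kernel integral operator on $L^2(\bar\mu)$ has eigenvalues $\{\lambda_j\}$ with associated orthonormal eigenfunctions bounded by $2$ in sup-norm, and a reward function $r\in\mathbb H$, such that $$\inf_{\hat\theta}\ \sup_{\mathscr I\in\mathfrak C}\ \mathbb P\Big(\|\hat\theta-V^*_{\mathbb H}(\mathscr I)\|_\mu^2\ \ge\ c_1\,\bar R^2\,\delta_n^2\Big)\ \ge\ c_2 .$$ Here the infimum is over all estimators, i.e. maps from trajectories $(x_1,\dots,x_n)$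 to $\mathbb H$, and the probability is over a trajectory of the chain $\mathcal P$ with $x_1\sim\mu$. -/

import Mathlib

open MeasureTheory ProbabilityTheory
open scoped ENNReal

noncomputable section

namespace PolicyEval

/-! ## Markov chains and Markov reward processes -/

/-- The law of the first `n` states `(x₁, …, xₙ)` of the Markov chain with transition kernel `P`
and initial distribution `μ`. -/
def trajLaw {X : Type*} [MeasurableSpace X] (P : Kernel X X) (μ : Measure X) :
    (n : ℕ) → Measure (Fin n → X)
  | 0 => Measure.dirac (fun i => i.elim0)
  | 1 => μ.map (fun x _ => x)
  | n + 2 =>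
      ((trajLaw P μ (n + 1)) ⊗ₘ
        (P.comap (fun ω : Fin (n + 1) → X => ω (Fin.last n)) (measurable_pi_apply _))).map
          (fun p => Fin.snoc (α := fun _ => X) p.1 p.2)

/-- The value function `V* = (I - γ P)⁻¹ r = ∑ₜ γᵗ Pᵗ r`, that is,
`V*(x) = ∑ₜ γᵗ E[r(Xₜ) | X₀ = x]`: the power `P ^ t` (for the composition of kernels) is the
`t`-step transition kernel, so `(P ^ t) x` is the law of `Xₜ` given `X₀ = x`. -/
def valueFunction {X : Type*} [MeasurableSpace X] (r : X → ℝ) (P : Kernel X X) (γ : ℝ) (x : X) :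
    ℝ :=
  ∑' t : ℕ, γ ^ t * ∫ y, r y ∂((P ^ t) x)

/-- The transition law of a Markov reward process on the state space `[0, 1]`, together with
its unique stationary distribution. The reward function and the discount factor are shared by
all processes and are kept as separate parameters. -/
structure Chain where
  /-- the transition kernel -/
  trans : Kernel unitInterval unitInterval
  /-- the stationary distribution -/
  stat : Measure unitInterval
  isMarkovKernel_trans : IsMarkovKernel trans
  isProbabilityMeasure_stat : IsProbabilityMeasure stat
  invariant : Kernel.Invariant trans stat
  unique : ∀ ν : Measure unitInterval, IsProbabilityMeasure ν → Kernel.Invariant trans ν → ν = stat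

/-- The mixing condition with mixing time `τ`: there is a probability measure `ν` with
`‖dν/dμ‖_∞ ≤ 1 + C < ∞` such that `P(B | x) ≥ ν(B) / τ` for all states `x` and measurable `B`. -/
def MixingCondition {X : Type*} [MeasurableSpace X] (P : Kernel X X) (μ : Measure X) (τ : ℝ) :
    Prop :=
  ∃ (ν : Measure X) (C : ℝ), IsProbabilityMeasure ν ∧ 0 ≤ C ∧ ν ≪ μ ∧
    (∀ᵐ x ∂μ, ν.rnDeriv μ x ≤ ENNReal.ofReal (1 + C)) ∧
    ∀ x, ∀ B, MeasurableSet B → ν B / ENNReal.ofReal τ ≤ P x B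

open Classical in
/-- The Pearson `χ²`-divergence `χ²(p ‖ q) = E_q[(dp/dq - 1)²]`, infinite unless `p ≪ q`. -/
def chiSqDiv {X : Type*} [MeasurableSpace X] (p q : Measure X) : ℝ≥0∞ :=
  if p ≪ q then ∫⁻ x, ENNReal.ofReal (((p.rnDeriv q x).toReal - 1) ^ 2) ∂q else ⊤

/-! ## Reproducing kernel Hilbert spaces on `[0, 1]` -/

section RKHS

variable (H : Type) [NormedAddCommGroup H] [InnerProductSpace ℝ H] [RKHS ℝ H unitInterval ℝ]

/-- The scalar reproducing kernel `K(x, y)` of a real RKHS on `[0, 1]`. -/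
def scalarKernel [CompleteSpace H] (x y : unitInterval) : ℝ := RKHS.kernel H x y 1

/-- `λ₁, λ₂, …` (with `lam j = λ_{j+1}`) are the eigenvalues of the kernel integral operator of
`H` with respect to Lebesgue measure on `[0, 1]`, and `φ` is an associated `L²`-orthonormal
sequence of eigenfunctions: the eigenvalue equations hold, and the pairs `(lam j, φ j)` exhaust
the kernel, `K(x, y) = ∑ⱼ λⱼ φⱼ(x) φⱼ(y)`. -/
structure HasEigensystem [CompleteSpace H] (lam : ℕ → ℝ) (φ : ℕ → unitInterval → ℝ) : Prop where
  measurable : ∀ j, Measurable (φ j)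
  orthonormal : ∀ i j, ∫ x, φ i x * φ j x = if i = j then 1 else 0
  eigen : ∀ j x, ∫ y, scalarKernel H x y * φ j y = lam j * φ j x
  expansion : ∀ x y, HasSum (fun j => lam j * φ j x * φ j y) (scalarKernel H x y)

/-- The classes in `L²(μ)` of the elements of the RKHS `H`. -/
def rkhsL2 (μ : Measure unitInterval) : Submodule ℝ (Lp ℝ 2 μ) where
  carrier := {g | ∃ h : H, ⇑g =ᵐ[μ] ⇑h}
  zero_mem' := ⟨0, by
    rw [RKHS.coe_zero]
    exact Lp.coeFn_zero ℝ 2 μ⟩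
  add_mem' := by
    rintro f g ⟨h, hf⟩ ⟨k, hg⟩
    refine ⟨h + k, ?_⟩
    rw [RKHS.coe_add]
    exact (Lp.coeFn_add f g).trans (hf.add hg)
  smul_mem' := by
    rintro a f ⟨h, hf⟩
    refine ⟨a • h, ?_⟩
    rw [RKHS.coe_smul]
    exact (Lp.coeFn_smul a f).trans (hf.const_smul a)

open Classical in
/-- The orthogonal projection in `L²(μ)` of a (square-integrable) function onto the closure of
the RKHS `H`. -/
def projL2 (μ : Measure unitInterval) (f : unitInterval → ℝ) : Lp ℝ 2 μ :=
  if hf : MemLp f 2 μ then (rkhsL2 H μ).topologicalClosure.starProjection (hf.toLp f) else 0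

/-- The projection `V*_H` of the value function onto the closure of `H` in `L²(μ)`, where `μ` is
the stationary distribution of the process. -/
def Chain.projValue (M : Chain) (r : unitInterval → ℝ) (γ : ℝ) : Lp ℝ 2 M.stat :=
  projL2 H M.stat (valueFunction r M.trans γ)

/-- Membership in the family of Markov reward processes with reward `r`, discount factor `γ` and
parameters `(R, σ, ρ, τ)`; `b` is the bound on the kernel and `ν` is the `χ²`-radius. -/
structure Chain.IsValid (M : Chain) (r : unitInterval → ℝ) (γ b R σ ρ τ ν : ℝ) : Prop where
  /-- `V*_H` belongs to `H`, with `‖V*_H‖_H ≤ R` -/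
  norm_proj : ∃ h : H, ⇑(M.projValue H r γ) =ᵐ[M.stat] ⇑h ∧ ‖h‖ ≤ R
  /-- `‖r‖_∞ / b ≤ R` -/
  reward : ∀ x, |r x| / b ≤ R
  /-- `E_{X ∼ μ} Var[V*(X') | X] ≤ σ²` -/
  variance : ∫⁻ x, evariance (valueFunction r M.trans γ) (M.trans x) ∂M.stat ≤
    ENNReal.ofReal (σ ^ 2)
  /-- `‖V* - V*_H‖_μ ≤ ρ` -/
  misspec : eLpNorm (fun x => valueFunction r M.trans γ x - M.projValue H r γ x) 2 M.stat ≤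
    ENNReal.ofReal ρ
  mixing : MixingCondition M.trans M.stat τ
  chiSq : chiSqDiv M.stat volume ≤ ENNReal.ofReal ν

end RKHS

/-! ## Noise level, critical inequality, statistical dimension -/

/-- The noise level `(1 - γ)⁻¹ σ + √τ ρ`. -/
def noiseLevel (γ σ ρ τ : ℝ) : ℝ := (1 - γ)⁻¹ * σ + √τ * ρ

/-- The critical inequality `√(∑ⱼ min(λⱼ / δ², 1)) ≤ (√n R / (2 ζ)) δ`. -/
def CriticalInequality (lam : ℕ → ℝ) (n : ℕ) (R ζ δ : ℝ) : Prop :=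
  √(∑' j, min (lam j / δ ^ 2) 1) ≤ √n * R / (2 * ζ) * δ

/-- The statistical dimension `max {j ≥ 1 | λⱼ ≥ δ²}`, where `lam j = λ_{j+1}`. -/
def statDim (lam : ℕ → ℝ) (δ : ℝ) : ℕ := sSup {d : ℕ | ∃ j, d = j + 1 ∧ δ ^ 2 ≤ lam j}

end PolicyEval

end

open PolicyEval

/-! The bound is Assouad's argument on a hypercube of hypotheses, run with two constructions, one
for each summand of ζ = (1-γ)⁻¹σ + √τ ρ. The larger summand is at least ζ/2, and its construction is
the one used.

Under Lebesgue measure the binary digits are independent fair bits, so Walsh functions are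
orthonormal with values ±1. The eigenfunctions are the constant, the sign s of the leading digit,
and the Walsh functions of the digits from the third on. The sign u of the second digit is left out
on purpose: it is orthogonal to the RKHS and supplies the misspecification. The m digits after the
first two cut [0,1] into D = 2^m cells, with D comparable to d_n. A hypothesis v puts a sign on
every cell; let f be the resulting ±1 function. It is spanned by eigenfunctions with eigenvalue at
least δ², so ‖E f‖² ≤ E²/δ². The target is always α s + E f + κ ∫f (`exists_signFunction`), and
targets whose signs differ on a fraction h of the cells are at squared Lebesgue distance at least
4hE² (`sq_mul_hamming_le`).

Both chains jump to their stationary law with probability p = 1/τ, which gives mixing and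
uniqueness.

In `biasedChain` a step without a jump keeps the block and redraws the leading digit with bias ηf.
With a reward proportional to s, the bias acts as a gain ηf accumulated over the horizon, so E ≍
ση/(1-γ) for γ bounded away from 0, and the value function lies in the RKHS. Every transition is
informative, so indistinguishability requires η² ≍ D/n.

In `swapChain` a step without a jump exchanges the two leading digits; the stationary density is 1 +
(s+u)ηf. The value function is A s + B u + constant, and projecting u onto the RKHS in the
stationary L² leaks a term of order ηf, so E ≍ ρη. The swap reveals nothing about v; only the
initial state and about n/τ jumps do, so η² may be as large as τD/n up to a constant.

In both cases E² ≍ ζ²D/n up to powers of γ, and regularity of the eigenvalues makes this at least a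
constant times R²δ². The critical inequality gives D ≤ nR²δ²/(4ζ²), which keeps the RKHS norm and
the χ²-divergence within their limits.

Neighbouring hypotheses are compared by the Hellinger affinity of their trajectory laws, whose
deficit grows at most linearly with the length (`one_le_affinity_add`). `one_le_test_error` turns
large affinity into a lower bound on test errors, and `exists_le_measure_of_test_error` into a
hypothesis under which the estimation error is large with probability at least 1/16. -/

noncomputable section

namespace PolicyEval

/-! ## Binary digits on the unit interval -/

/-- The two inverse branches of the doubling map. -/
def half (b : Bool) (y : unitInterval) : unitInterval :=
  ⟨((y : ℝ) + if b then 1 else 0) / 2, by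
    have := y.2.1; have := y.2.2
    constructor <;> split_ifs <;> linarith⟩

/-- The doubling map `x ↦ 2x mod 1`. -/
def dbl (x : unitInterval) : unitInterval :=
  ⟨Int.fract (2 * (x : ℝ)), Int.fract_nonneg _, (Int.fract_lt_one _).le⟩

/-- The leading binary digit. -/
def lead (x : unitInterval) : Bool := decide (1 / 2 ≤ (x : ℝ))

/-- The binary digits. -/
def digit : ℕ → unitInterval → Bool
  | 0, x => lead x
  | i + 1, x => digit i (dbl x)

/-- Replacing the `i`-th binary digit by its opposite. -/
def flipDigit : ℕ → unitInterval → unitInterval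
  | 0, x => half (!lead x) (dbl x)
  | i + 1, x => half (lead x) (flipDigit i (dbl x))

theorem dbl_lt_one (x : unitInterval) : (dbl x : ℝ) < 1 := Int.fract_lt_one _

/-- The endpoint has to be excluded: the left branch sends 1 to 1/2, whose leading digit is 1. -/
theorem lead_half (b : Bool) {y : unitInterval} (hy : (y : ℝ) < 1) : lead (half b y) = b := by
  have := y.2.1
  cases b
  · simp [lead, half]; linarith
  · simp [lead, half]; linarith

theorem dbl_half (b : Bool) {y : unitInterval} (hy : (y : ℝ) < 1) : dbl (half b y) = y := by
  have h0 := y.2.1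
  apply Subtype.ext
  cases b
  · have : (2 : ℝ) * (y / 2) = y := by ring
    simp [dbl, half, this, Int.fract_eq_self, h0, hy]
  · have : (2 : ℝ) * ((y + 1) / 2) = y + 1 := by ring
    simp [dbl, half, this, Int.fract_add_one, Int.fract_eq_self, h0, hy]

theorem half_lt_one (b : Bool) {y : unitInterval} (hy : (y : ℝ) < 1) : (half b y : ℝ) < 1 := by
  cases b <;> simp [half] <;> linarith

theorem flipDigit_lt_one (i : ℕ) (x : unitInterval) : (flipDigit i x : ℝ) < 1 := by
  induction i generalizing x with
  | zero => exact half_lt_one _ (dbl_lt_one x)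
  | succ i ih => exact half_lt_one _ (ih _)

/-- Valid at every point, dyadic ones included, because `dbl` takes values below 1. Sign identities
derived from it are therefore pointwise, as the Bellman equations below require. -/
theorem digit_flipDigit (i j : ℕ) (x : unitInterval) :
    digit j (flipDigit i x) = if j = i then !digit j x else digit j x := by
  induction i generalizing j x with
  | zero =>
    cases j with
    | zero => simp [digit, flipDigit, lead_half _ (dbl_lt_one x)]
    | succ j => simp [digit, flipDigit, dbl_half _ (dbl_lt_one x)]
  | succ i ih =>
    cases j with
    | zero => simp [digit, flipDigit, lead_half _ (flipDigit_lt_one i _)]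
    | succ j => simp [digit, flipDigit, dbl_half _ (flipDigit_lt_one i _), ih]

@[fun_prop]
theorem measurable_half (b : Bool) : Measurable (half b) := by
  unfold half; fun_prop

@[fun_prop]
theorem measurable_dbl : Measurable dbl := by
  unfold dbl
  exact Measurable.subtype_mk (measurable_fract.comp (by fun_prop))

@[fun_prop]
theorem measurable_lead : Measurable lead := by
  unfold lead
  apply measurable_to_bool
  have : (fun x : unitInterval => decide (1 / 2 ≤ (x : ℝ))) ⁻¹' {true} =
      {x : unitInterval | 1 / 2 ≤ (x : ℝ)} := by ext; simp
  rw [this]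
  exact measurableSet_le (by fun_prop) (by fun_prop)

@[fun_prop]
theorem measurable_digit (i : ℕ) : Measurable (digit i) := by
  induction i with
  | zero => exact measurable_lead
  | succ i ih => exact ih.comp measurable_dbl

theorem measurable_half_comp {f : unitInterval → Bool} {g : unitInterval → unitInterval}
    (hf : Measurable f) (hg : Measurable g) : Measurable fun x => half (f x) (g x) := by
  have h : Measurable fun p : Bool × unitInterval => half p.1 p.2 :=
    measurable_from_prod_countable_right fun b => measurable_half b
  exact h.comp (hf.prodMk hg)

@[fun_prop]
theorem measurable_flipDigit (i : ℕ) : Measurable (flipDigit i) := by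
  induction i with
  | zero =>
    exact measurable_half_comp ((measurable_of_countable (fun b : Bool => !b)).comp
      measurable_lead) measurable_dbl
  | succ i ih => exact measurable_half_comp measurable_lead (ih.comp measurable_dbl)

/-- Self-similarity of Lebesgue measure: the leading digit is a fair bit independent of the
remaining ones. Invariance under digit flips follows from it by induction. -/
theorem volume_eq_half :
    (volume : Measure unitInterval) =
      (2⁻¹ : ℝ≥0∞) • volume.map (half false) + (2⁻¹ : ℝ≥0∞) • volume.map (half true) := by
  refine Measure.ext_of_Iic _ _ fun x => ?_
  have h0 := x.2.1
  have h1 := x.2.2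
  have two : (2⁻¹ : ℝ≥0∞) = ENNReal.ofReal (1 / 2) := by
    rw [ENNReal.ofReal_div_of_pos two_pos]; simp
  simp only [Measure.add_apply, Measure.smul_apply, smul_eq_mul]
  rw [Measure.map_apply (measurable_half _) measurableSet_Iic,
    Measure.map_apply (measurable_half _) measurableSet_Iic, unitInterval.volume_Iic, two]
  by_cases h : (x : ℝ) < 1 / 2
  · have e1 : half false ⁻¹' Set.Iic x = Set.Iic ⟨2 * x, by constructor <;> linarith⟩ := by
      ext y; simp [half, ← Subtype.coe_le_coe]; constructor <;> intro _ <;> linarith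
    have e2 : half true ⁻¹' Set.Iic x = ∅ := by
      ext y; have := y.2.1; simp [half, ← Subtype.coe_le_coe]; linarith
    rw [e1, e2, unitInterval.volume_Iic, measure_empty, mul_zero, add_zero,
      ← ENNReal.ofReal_mul (by norm_num)]
    congr 1; ring
  · have e1 : half false ⁻¹' Set.Iic x = Set.univ := by
      ext y; have := y.2.2; simp [half, ← Subtype.coe_le_coe]; linarith
    have e2 : half true ⁻¹' Set.Iic x = Set.Iic ⟨2 * x - 1, by constructor <;> linarith⟩ := by
      ext y; simp [half, ← Subtype.coe_le_coe]; constructor <;> intro _ <;> linarith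
    rw [e1, e2, unitInterval.volume_Iic, measure_univ, mul_one,
      ← ENNReal.ofReal_mul (by norm_num), ← ENNReal.ofReal_add (by norm_num)]
    · congr 1; ring
    · simp only; linarith

theorem lintegral_eq_half {F : unitInterval → ℝ≥0∞} (hF : Measurable F) :
    ∫⁻ x, F x = 2⁻¹ * (∫⁻ y, F (half false y)) + 2⁻¹ * ∫⁻ y, F (half true y) := by
  conv_lhs => rw [volume_eq_half]
  rw [lintegral_add_measure, lintegral_smul_measure, lintegral_smul_measure,
    lintegral_map hF (measurable_half _), lintegral_map hF (measurable_half _), smul_eq_mul,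
    smul_eq_mul]

theorem ae_lt_one : ∀ᵐ x : unitInterval, (x : ℝ) < 1 := by
  have : ∀ᵐ x : unitInterval, x ≠ 1 := by
    simp [ae_iff]
  filter_upwards [this] with x hx
  exact lt_of_le_of_ne x.2.2 fun h => hx (Subtype.ext h)

theorem lintegral_flipDigit (i : ℕ) {F : unitInterval → ℝ≥0∞} (hF : Measurable F) :
    ∫⁻ x, F (flipDigit i x) = ∫⁻ x, F x := by
  induction i generalizing F with
  | zero =>
    rw [lintegral_eq_half (F := fun x => F (flipDigit 0 x)) (by fun_prop), lintegral_eq_half hF, add_comm]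
    congr 2 <;>
    · refine lintegral_congr_ae ?_
      filter_upwards [ae_lt_one] with y hy
      simp [flipDigit, lead_half _ hy, dbl_half _ hy]
  | succ i ih =>
    rw [lintegral_eq_half (F := fun x => F (flipDigit (i + 1) x)) (by fun_prop), lintegral_eq_half hF]
    congr 2
    · rw [← ih (F := fun y => F (half false y)) (by fun_prop)]
      refine lintegral_congr_ae ?_
      filter_upwards [ae_lt_one] with y hy
      simp [flipDigit, lead_half _ hy, dbl_half _ hy]
    · rw [← ih (F := fun y => F (half true y)) (by fun_prop)]
      refine lintegral_congr_ae ?_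
      filter_upwards [ae_lt_one] with y hy
      simp [flipDigit, lead_half _ hy, dbl_half _ hy]

theorem measurePreserving_flipDigit (i : ℕ) :
    MeasurePreserving (flipDigit i) (volume : Measure unitInterval) volume := by
  refine ⟨measurable_flipDigit i, Measure.ext_of_lintegral _ fun F hF => ?_⟩
  rw [lintegral_map hF (measurable_flipDigit i), lintegral_flipDigit i hF]

theorem integral_flipDigit (i : ℕ) {F : unitInterval → ℝ} (hF : Measurable F) :
    ∫ x, F (flipDigit i x) = ∫ x, F x := by
  rw [← integral_map (measurable_flipDigit i).aemeasurable
    (by rw [(measurePreserving_flipDigit i).map_eq]; exact hF.aestronglyMeasurable),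
    (measurePreserving_flipDigit i).map_eq]

/-- The flip preserves the measure and negates the integrand. This is the source of all
orthogonality relations. -/
theorem integral_eq_zero_of_flipDigit (i : ℕ) {F : unitInterval → ℝ} (hF : Measurable F)
    (h : ∀ x, F (flipDigit i x) = -F x) : ∫ x, F x = 0 := by
  have := integral_flipDigit i hF
  simp only [h, integral_neg] at this
  linarith

/-! ## Exchanging the two leading digits -/

/-- Exchanging the two leading binary digits. -/
def swapDigits (x : unitInterval) : unitInterval :=
  if digit 0 x = digit 1 x then x else flipDigit 0 (flipDigit 1 x)

theorem digit_swapDigits_zero (x : unitInterval) : digit 0 (swapDigits x) = digit 1 x := by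
  unfold swapDigits
  split_ifs with h
  · exact h
  · simp only [digit_flipDigit]; revert h; cases digit 0 x <;> cases digit 1 x <;> simp

theorem digit_swapDigits_one (x : unitInterval) : digit 1 (swapDigits x) = digit 0 x := by
  unfold swapDigits
  split_ifs with h
  · exact h.symm
  · simp only [digit_flipDigit]; revert h; cases digit 0 x <;> cases digit 1 x <;> simp

theorem digit_swapDigits {i : ℕ} (hi : 2 ≤ i) (x : unitInterval) :
    digit i (swapDigits x) = digit i x := by
  unfold swapDigits
  split_ifs
  · rfl
  · simp only [digit_flipDigit]; rw [if_neg (by omega), if_neg (by omega)]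

theorem measurableSet_digit_eq : MeasurableSet {x | digit 0 x = digit 1 x} :=
  measurableSet_eq_fun (measurable_digit 0) (measurable_digit 1)

@[fun_prop]
theorem measurable_swapDigits : Measurable swapDigits :=
  Measurable.ite measurableSet_digit_eq measurable_id
    ((measurable_flipDigit 0).comp (measurable_flipDigit 1))

/-- Where the two digits agree the swap is the identity; elsewhere it is a composition of two flips,
and this composition preserves the set of points with distinct leading digits. -/
theorem lintegral_swapDigits {F : unitInterval → ℝ≥0∞} (hF : Measurable F) :
    ∫⁻ x, F (swapDigits x) = ∫⁻ x, F x := by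
  rw [← lintegral_add_compl _ measurableSet_digit_eq,
    ← lintegral_add_compl F measurableSet_digit_eq]
  congr 1
  · refine setLIntegral_congr_fun measurableSet_digit_eq fun x hx => ?_
    have hx' : digit 0 x = digit 1 x := hx
    simp only [swapDigits, if_pos hx']
  · rw [← lintegral_indicator measurableSet_digit_eq.compl,
      ← lintegral_indicator measurableSet_digit_eq.compl,
      ← lintegral_flipDigit 0 (hF.indicator measurableSet_digit_eq.compl),
      ← lintegral_flipDigit 1 (F := fun x => Set.indicator _ F (flipDigit 0 x))
        ((hF.indicator measurableSet_digit_eq.compl).comp (measurable_flipDigit 0))]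
    refine lintegral_congr fun x => ?_
    by_cases h : digit 0 x = digit 1 x
    · rw [Set.indicator_of_notMem (by simpa using h),
        Set.indicator_of_notMem (by simp [digit_flipDigit, h])]
    · rw [Set.indicator_of_mem (by simpa using h),
        Set.indicator_of_mem (by simpa [digit_flipDigit] using h), swapDigits, if_neg h]

/-! ## Walsh functions -/

/-- The sign attached to a binary digit. -/
def sgn (b : Bool) : ℝ := if b then -1 else 1

@[simp] theorem sgn_not (b : Bool) : sgn (!b) = -sgn b := by cases b <;> simp [sgn]

@[simp] theorem sgn_mul_self (b : Bool) : sgn b * sgn b = 1 := by cases b <;> simp [sgn]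

@[simp] theorem abs_sgn (b : Bool) : |sgn b| = 1 := by cases b <;> simp [sgn]

@[fun_prop] theorem measurable_sgn : Measurable sgn := measurable_of_countable _

/-- The Walsh function attached to a finite set of digits. -/
def walsh (A : Finset ℕ) (x : unitInterval) : ℝ := ∏ i ∈ A, sgn (digit i x)

@[fun_prop]
theorem measurable_walsh (A : Finset ℕ) : Measurable (walsh A) := by
  unfold walsh; fun_prop

theorem abs_walsh (A : Finset ℕ) (x : unitInterval) : |walsh A x| = 1 := by
  simp [walsh, Finset.abs_prod]

theorem walsh_flipDigit_of_notMem {A : Finset ℕ} {i : ℕ} (h : i ∉ A) (x : unitInterval) :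
    walsh A (flipDigit i x) = walsh A x := by
  refine Finset.prod_congr rfl fun j hj => ?_
  rw [digit_flipDigit, if_neg (ne_of_mem_of_not_mem hj h)]

theorem walsh_flipDigit_of_mem {A : Finset ℕ} {i : ℕ} (h : i ∈ A) (x : unitInterval) :
    walsh A (flipDigit i x) = -walsh A x := by
  rw [walsh, walsh, ← Finset.mul_prod_erase _ _ h, ← Finset.mul_prod_erase _ _ h,
    digit_flipDigit, if_pos rfl, sgn_not, neg_mul]
  congr 2
  refine Finset.prod_congr rfl fun j hj => ?_
  rw [digit_flipDigit, if_neg (Finset.ne_of_mem_erase hj)]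

theorem walsh_mul_self (A : Finset ℕ) (x : unitInterval) : walsh A x * walsh A x = 1 := by
  rw [← abs_mul_abs_self, abs_walsh, one_mul]

theorem integral_walsh_mul (A B : Finset ℕ) :
    ∫ x, walsh A x * walsh B x = if A = B then 1 else 0 := by
  split_ifs with h
  · subst h; simp [walsh_mul_self]
  · obtain ⟨i, hi⟩ : ∃ i, ¬(i ∈ A ↔ i ∈ B) := by
      by_contra hc; push Not at hc; exact h (Finset.ext hc)
    refine integral_eq_zero_of_flipDigit i (by fun_prop) fun x => ?_
    by_cases hA : i ∈ A
    · have hB : i ∉ B := by tauto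
      rw [walsh_flipDigit_of_mem hA, walsh_flipDigit_of_notMem hB]; ring
    · have hB : i ∈ B := by tauto
      rw [walsh_flipDigit_of_notMem hA, walsh_flipDigit_of_mem hB]; ring

/-! ## The orthonormal system -/

/-- The sets of digits that define the orthonormal system: the constant function, the sign of the
leading digit, and all Walsh functions of the digits from the third on. -/
def digitSet (j : ℕ) : Finset ℕ :=
  if j = 1 then {0} else (Finset.equivBitIndices (j - 1)).map (addRightEmbedding 2)

/-- The orthonormal system of eigenfunctions. -/
def eigenfun (j : ℕ) : unitInterval → ℝ := walsh (digitSet j)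

/-- Truncated subtraction sends 0 and 1 to the same code, but index 1 is diverted to the leading
digit, so only index 0 yields the empty set. -/
theorem digitSet_injective : Function.Injective digitSet := by
  have key : ∀ k, ∀ i, i ∈ (Finset.equivBitIndices k).map (addRightEmbedding 2) → 2 ≤ i := by
    intro k i hi
    obtain ⟨a, -, rfl⟩ := Finset.mem_map.1 hi
    simp
  have key0 : ∀ k, ({0} : Finset ℕ) ≠ (Finset.equivBitIndices k).map (addRightEmbedding 2) := by
    intro k h
    have := key k 0 (h ▸ Finset.mem_singleton_self 0)
    omega
  intro i j h
  unfold digitSet at h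
  split_ifs at h with h1 h2 h2
  · omega
  · exact absurd h (key0 _)
  · exact absurd h.symm (key0 _)
  · have h3 := Finset.equivBitIndices.injective (Finset.map_injective _ h)
    by_cases hi : i = 0
    · by_cases hj : j = 0
      · omega
      · -- bits of `0` against bits of a positive number
        omega
    · omega

@[fun_prop]
theorem measurable_eigenfun (j : ℕ) : Measurable (eigenfun j) := measurable_walsh _

theorem abs_eigenfun (j : ℕ) (x : unitInterval) : |eigenfun j x| = 1 := abs_walsh _ _

theorem eigenfun_zero (x : unitInterval) : eigenfun 0 x = 1 := by
  simp [eigenfun, digitSet, walsh]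

theorem eigenfun_one (x : unitInterval) : eigenfun 1 x = sgn (digit 0 x) := by
  simp [eigenfun, digitSet, walsh]

theorem integral_eigenfun_mul (i j : ℕ) :
    ∫ x, eigenfun i x * eigenfun j x = if i = j then 1 else 0 := by
  simp only [eigenfun, integral_walsh_mul, digitSet_injective.eq_iff]

/-- Apart from the sign of the leading digit no eigenfunction sees the first two digits, which makes
the second digit invisible to the space. -/
theorem eigenfun_flipDigit {j i : ℕ} (hj : j ≠ 1) (hi : i < 2) (x : unitInterval) :
    eigenfun j (flipDigit i x) = eigenfun j x := by
  refine walsh_flipDigit_of_notMem ?_ x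
  simp only [digitSet, if_neg hj, Finset.mem_map, addRightEmbedding_apply, not_exists, not_and]
  intro a _
  omega

theorem integrable_of_abs_le {α : Type*} [MeasurableSpace α] {μ : Measure α} [IsFiniteMeasure μ]
    {f : α → ℝ} (hf : Measurable f) (C : ℝ) (h : ∀ x, |f x| ≤ C) : Integrable f μ :=
  Integrable.of_bound hf.aestronglyMeasurable C (ae_of_all _ h)

/-- The Fourier coefficients of an absolutely convergent series. -/
theorem integral_mul_eigenfun_of_hasSum {ι : Type*} [Countable ι] {e : ι → ℕ} {a : ι → ℝ}
    (ha : Summable fun i => |a i|) {F : unitInterval → ℝ}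
    (hF : ∀ x, HasSum (fun i => a i * eigenfun (e i) x) (F x)) (j : ℕ) :
    HasSum (fun i => if e i = j then a i else 0) (∫ x, F x * eigenfun j x) := by
  have hb : ∀ i x, |a i * eigenfun (e i) x * eigenfun j x| ≤ |a i| := by
    intro i x; simp [abs_mul, abs_eigenfun]
  have hint : ∀ i, Integrable fun x => a i * eigenfun (e i) x * eigenfun j x :=
    fun i => integrable_of_abs_le (by fun_prop) _ (hb i)
  have h := hasSum_integral_of_summable_integral_norm (F := fun i x =>
    a i * eigenfun (e i) x * eigenfun j x) hint ?_
  · have e1 : (fun i => ∫ x, a i * eigenfun (e i) x * eigenfun j x) =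
        fun i => if e i = j then a i else 0 := by
      funext i
      simp only [mul_assoc, integral_const_mul, integral_eigenfun_mul]
      simp
    have e2 : ∀ x, ∑' i, a i * eigenfun (e i) x * eigenfun j x = F x * eigenfun j x := fun x =>
      ((hF x).mul_right _).tsum_eq
    simp only [e1, e2] at h
    exact h
  · refine ha.of_nonneg_of_le (fun i => integral_nonneg fun x => norm_nonneg _) fun i => ?_
    refine (integral_mono_of_nonneg (ae_of_all _ fun x => norm_nonneg _)
      (integrable_const |a i|) (ae_of_all _ (hb i))).trans ?_
    simp

/-! ## The Hilbert space -/

/-- The Hilbert space of square-summable coefficients with respect to the scaled eigenfunctions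
`√λⱼ φⱼ`, where `j` ranges over the indices with `λⱼ > 0`. -/
def WalshSpace (lam : ℕ → ℝ) (_ : Summable lam) : Type :=
  lp (fun _ : {j : ℕ // 0 < lam j} => ℝ) 2

namespace WalshSpace

variable {lam : ℕ → ℝ} {hs : Summable lam}

instance : NormedAddCommGroup (WalshSpace lam hs) :=
  inferInstanceAs (NormedAddCommGroup (lp (fun _ : {j : ℕ // 0 < lam j} => ℝ) 2))

instance : InnerProductSpace ℝ (WalshSpace lam hs) :=
  inferInstanceAs (InnerProductSpace ℝ (lp (fun _ : {j : ℕ // 0 < lam j} => ℝ) 2))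

instance : CompleteSpace (WalshSpace lam hs) :=
  inferInstanceAs (CompleteSpace (lp (fun _ : {j : ℕ // 0 < lam j} => ℝ) 2))

/-- The coefficients of an element. -/
def coef (f : WalshSpace lam hs) (j : {j : ℕ // 0 < lam j}) : ℝ :=
  (show lp (fun _ : {j : ℕ // 0 < lam j} => ℝ) 2 from f) j

theorem summable_subtype (hs : Summable lam) : Summable fun j : {j : ℕ // 0 < lam j} => lam j :=
  hs.subtype _

variable (hs) in
/-- The representer of the evaluation at `x`. -/
def feature (x : unitInterval) : WalshSpace lam hs :=
  (⟨fun j => √(lam j) * eigenfun j x, by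
    refine memℓp_gen ?_
    refine (summable_subtype hs).congr fun j => ?_
    simp [abs_eigenfun, Real.sq_sqrt j.2.le]⟩ :
    lp (fun _ : {j : ℕ // 0 < lam j} => ℝ) 2)

theorem coef_feature (x : unitInterval) (j : {j : ℕ // 0 < lam j}) :
    coef (feature hs x) j = √(lam j) * eigenfun j x := rfl

theorem hasSum_coef_mul (f g : WalshSpace lam hs) :
    HasSum (fun j => coef f j * coef g j) (inner ℝ f g) := by
  have := lp.hasSum_inner (𝕜 := ℝ) (show lp (fun _ : {j : ℕ // 0 < lam j} => ℝ) 2 from f)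
    (show lp (fun _ : {j : ℕ // 0 < lam j} => ℝ) 2 from g)
  exact this.congr_fun fun j => mul_comm _ _

theorem summable_coef (f : WalshSpace lam hs) :
    Summable fun j : {j : ℕ // 0 < lam j} => |√(lam j) * coef f j| := by
  have h1 := (hasSum_coef_mul f f).summable
  refine ((summable_subtype hs).add h1).of_nonneg_of_le (fun _ => abs_nonneg _) fun j => ?_
  have h2 := Real.sq_sqrt j.2.le
  rw [abs_le]
  constructor <;> nlinarith [sq_nonneg (√(lam j) + coef f j), sq_nonneg (√(lam j) - coef f j)]

theorem hasSum_inner_feature (f : WalshSpace lam hs) (x : unitInterval) :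
    HasSum (fun j : {j : ℕ // 0 < lam j} => √(lam j) * coef f j * eigenfun j x)
      (inner ℝ (feature hs x) f) := by
  refine (hasSum_coef_mul (feature hs x) f).congr_fun fun j => ?_
  rw [coef_feature]; ring

theorem ext_coef {f g : WalshSpace lam hs} (h : ∀ j, coef f j = coef g j) : f = g :=
  lp.ext (funext h)

/-- Evaluation is injective because the j-th Fourier coefficient of the function is √λⱼ times the
j-th coordinate, and only indices with λⱼ > 0 are kept. -/
instance : RKHS ℝ (WalshSpace lam hs) unitInterval ℝ where
  coeCLM := ContinuousLinearMap.pi fun x => innerSL ℝ (feature hs x)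
  coeCLM_injective := by
    intro f g h
    refine ext_coef fun j => ?_
    have hx : ∀ x, inner ℝ (feature hs x) f = (inner ℝ (feature hs x) g : ℝ) := fun x =>
      congrFun h x
    have key : ∀ f : WalshSpace lam hs,
        ∫ x, (inner ℝ (feature hs x) f : ℝ) * eigenfun j x = √(lam j) * coef f j := by
      intro f
      refine (integral_mul_eigenfun_of_hasSum (summable_coef f)
        (hasSum_inner_feature f) j).unique ?_
      convert hasSum_ite_eq j (√(lam j) * coef f j) using 2 with i
      by_cases hij : i = j
      · subst hij; simp
      · rw [if_neg hij, if_neg fun e => hij (Subtype.ext e)]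
    have := key f
    simp only [hx, key g] at this
    exact (mul_left_cancel₀ (Real.sqrt_ne_zero'.2 j.2) this).symm

theorem apply_eq (f : WalshSpace lam hs) (x : unitInterval) : f x = inner ℝ (feature hs x) f := rfl

theorem hasSum_apply (f : WalshSpace lam hs) (x : unitInterval) :
    HasSum (fun j : {j : ℕ // 0 < lam j} => √(lam j) * coef f j * eigenfun j x) (f x) :=
  hasSum_inner_feature f x

theorem kerFun_one (x : unitInterval) : RKHS.kerFun (WalshSpace lam hs) x 1 = feature hs x := by
  refine ext_inner_right ℝ fun f => ?_
  rw [RKHS.kerFun_inner, apply_eq]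
  simp

theorem scalarKernel_eq (x y : unitInterval) :
    scalarKernel (WalshSpace lam hs) x y = feature hs y x := by
  rw [scalarKernel, ← RKHS.kerFun_apply, kerFun_one]

theorem hasSum_scalarKernel (h0 : ∀ j, 0 ≤ lam j) (x y : unitInterval) :
    HasSum (fun j => lam j * eigenfun j x * eigenfun j y)
      (scalarKernel (WalshSpace lam hs) x y) := by
  have h := hasSum_apply (feature hs y) x
  rw [← scalarKernel_eq] at h
  rw [← hasSum_subtype_iff_of_support_subset (s := {j | 0 < lam j})]
  · refine h.congr_fun fun j => ?_
    have := Real.mul_self_sqrt j.2.le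
    simp only [Function.comp_apply, coef_feature]
    rw [← mul_assoc, this]
    ring
  · intro j hj
    refine lt_of_le_of_ne (h0 j) fun e => hj ?_
    simp [← e]

theorem hasEigensystem (h0 : ∀ j, 0 ≤ lam j) :
    HasEigensystem (WalshSpace lam hs) lam eigenfun where
  measurable := measurable_eigenfun
  orthonormal := integral_eigenfun_mul
  eigen j x := by
    refine (integral_mul_eigenfun_of_hasSum (e := id) (a := fun i => lam i * eigenfun i x) ?_
      (hasSum_scalarKernel h0 x) j).unique ?_
    · refine hs.congr fun i => ?_
      rw [abs_mul, abs_eigenfun, mul_one, abs_of_nonneg (h0 i)]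
    · convert hasSum_ite_eq j (lam j * eigenfun j x) using 2 with i
      by_cases hij : i = j
      · subst hij; simp
      · simp [hij]
  expansion := hasSum_scalarKernel h0

@[fun_prop]
theorem measurable_apply (f : WalshSpace lam hs) : Measurable f := by
  refine measurable_of_tendsto_metrizable' (f := fun (s : Finset {j : ℕ // 0 < lam j}) x =>
    ∑ j ∈ s, √(lam j) * coef f j * eigenfun j x) Filter.atTop (fun s => by fun_prop) ?_
  rw [tendsto_pi_nhds]
  exact fun x => hasSum_apply f x

theorem abs_apply_le (f : WalshSpace lam hs) : ∃ C, ∀ x, |f x| ≤ C := by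
  refine ⟨∑' j : {j : ℕ // 0 < lam j}, |√(lam j) * coef f j|, fun x => ?_⟩
  have h1 : ∀ j : {j : ℕ // 0 < lam j},
      ‖√(lam j) * coef f j * eigenfun j x‖ = |√(lam j) * coef f j| := fun j => by
    rw [Real.norm_eq_abs, abs_mul, abs_eigenfun, mul_one]
  rw [← (hasSum_apply f x).tsum_eq]
  refine (norm_tsum_le_tsum_norm ?_).trans_eq (tsum_congr h1)
  exact (summable_coef f).congr fun j => (h1 j).symm

/-- Finite combinations of eigenfunctions belong to the space. -/
theorem exists_sum (T : Finset ℕ) (hT : ∀ j ∈ T, 0 < lam j) (a : ℕ → ℝ) :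
    ∃ h : WalshSpace lam hs, (∀ x, h x = ∑ j ∈ T, a j * eigenfun j x) ∧
      ‖h‖ ^ 2 = ∑ j ∈ T, a j ^ 2 / lam j := by
  classical
  let c : {j : ℕ // 0 < lam j} → ℝ := fun j => if (j : ℕ) ∈ T then a j / √(lam j) else 0
  have hsupp : ∀ j : {j : ℕ // 0 < lam j}, j ∉ T.subtype (fun j => 0 < lam j) → c j = 0 := by
    intro j hj
    simp only [c]
    rw [if_neg]
    simpa using hj
  have hc : Memℓp c 2 := by
    refine memℓp_gen (summable_of_ne_finset_zero (s := T.subtype fun j => 0 < lam j) ?_)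
    intro j hj
    rw [hsupp j hj]; simp
  let h : WalshSpace lam hs := (⟨c, hc⟩ : lp (fun _ : {j : ℕ // 0 < lam j} => ℝ) 2)
  have hco : ∀ j, coef h j = c j := fun _ => rfl
  have sum_eq : ∀ F : ℕ → ℝ, ∑ j ∈ T.subtype (fun j => 0 < lam j), F j = ∑ j ∈ T, F j := by
    intro F
    rw [Finset.sum_subtype_of_mem F hT]
  refine ⟨h, fun x => ?_, ?_⟩
  · refine (hasSum_apply h x).unique ?_
    rw [← sum_eq]
    convert hasSum_sum_of_ne_finset_zero (s := T.subtype fun j => 0 < lam j)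
      (f := fun j : {j : ℕ // 0 < lam j} => √(lam j) * coef h j * eigenfun j x) ?_ using 1
    · refine Finset.sum_congr rfl fun j hj => ?_
      rw [hco]
      simp only [c]
      rw [if_pos (by simpa using hj), mul_div_cancel₀ _ (Real.sqrt_ne_zero'.2 j.2)]
    · intro j hj
      rw [hco, hsupp j hj]; simp
    · infer_instance
  · rw [← real_inner_self_eq_norm_sq]
    refine (hasSum_coef_mul h h).unique ?_
    rw [← sum_eq (fun j => a j ^ 2 / lam j)]
    convert hasSum_sum_of_ne_finset_zero (s := T.subtype fun j => 0 < lam j)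
      (f := fun j : {j : ℕ // 0 < lam j} => coef h j * coef h j) ?_ using 1
    · refine Finset.sum_congr rfl fun j hj => ?_
      rw [hco]
      simp only [c]
      rw [if_pos (by simpa using hj), div_mul_div_comm, Real.mul_self_sqrt j.2.le, sq]
    · intro j hj
      rw [hco, hsupp j hj]; simp
    · infer_instance

/-- Up to a multiple of the sign of the leading digit, the elements of the space do not depend on
the two leading digits. -/
theorem exists_decomposition (f : WalshSpace lam hs) :
    ∃ (a : ℝ) (k : unitInterval → ℝ), Measurable k ∧ (∃ C, ∀ x, |k x| ≤ C) ∧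
      (∀ i < 2, ∀ x, k (flipDigit i x) = k x) ∧ ∀ x, f x = a * sgn (digit 0 x) + k x := by
  classical
  let a : ℝ := if h : 0 < lam 1 then √(lam 1) * coef f ⟨1, h⟩ else 0
  obtain ⟨C, hC⟩ := abs_apply_le f
  refine ⟨a, fun x => f x - a * sgn (digit 0 x), by fun_prop, ⟨C + |a|, fun x => ?_⟩, ?_,
    fun x => by ring⟩
  · refine (abs_sub _ _).trans ?_
    rw [abs_mul, abs_sgn, mul_one]
    gcongr
    exact hC x
  · intro i hi x
    have key : ∀ x, HasSum (fun j : {j : ℕ // 0 < lam j} =>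
        if (j : ℕ) = 1 then 0 else √(lam j) * coef f j * eigenfun j x)
        (f x - a * sgn (digit 0 x)) := by
      intro x
      have h1 : HasSum (fun j : {j : ℕ // 0 < lam j} =>
          if (j : ℕ) = 1 then √(lam j) * coef f j * eigenfun j x else 0)
          (a * sgn (digit 0 x)) := by
        by_cases h : 0 < lam 1
        · convert hasSum_ite_eq (⟨1, h⟩ : {j : ℕ // 0 < lam j}) (a * sgn (digit 0 x)) using 2 with j
          by_cases hj : (j : ℕ) = 1
          · have : j = ⟨1, h⟩ := Subtype.ext hj
            subst this
            simp [a, h, eigenfun_one]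
          · rw [if_neg hj, if_neg fun e => hj (by rw [e])]
        · simp only [a, dif_neg h, zero_mul]
          convert hasSum_zero with j
          rw [if_neg]
          intro hj
          exact h (hj ▸ j.2)
      refine ((hasSum_apply f x).sub h1).congr_fun fun j => ?_
      split_ifs <;> simp
    refine (key (flipDigit i x)).unique ?_
    refine (key x).congr_fun fun j => ?_
    split_ifs with hj
    · rfl
    · rw [eigenfun_flipDigit hj hi]

end WalshSpace

/-! ## Functions of a block of digits -/

/-- The digits `2, …, m + 1`. -/
def block (m : ℕ) (x : unitInterval) : Fin m → Bool := fun i => digit (i + 2) x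

@[fun_prop]
theorem measurable_block (m : ℕ) : Measurable (block m) := by
  unfold block; fun_prop

theorem measurable_comp_block {m : ℕ} {β : Type*} [MeasurableSpace β] (G : (Fin m → Bool) → β) :
    Measurable fun x => G (block m x) :=
  (measurable_of_countable G).comp (measurable_block m)

theorem block_flipDigit {m i : ℕ} (hi : i < 2) (x : unitInterval) :
    block m (flipDigit i x) = block m x := by
  funext j
  simp only [block, digit_flipDigit]
  rw [if_neg (by omega)]

theorem block_swapDigits (m : ℕ) (x : unitInterval) : block m (swapDigits x) = block m x := by
  funext j
  exact digit_swapDigits (by omega) x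

/-- The positions of the digits of a block. -/
def blockEmbedding (m : ℕ) : Fin m ↪ ℕ := Fin.valEmbedding.trans (addRightEmbedding 2)

theorem walsh_map_blockEmbedding {m : ℕ} (t : Finset (Fin m)) (x : unitInterval) :
    walsh (t.map (blockEmbedding m)) x = ∏ i ∈ t, sgn (block m x i) := by
  simp [walsh, blockEmbedding, block]

/-- The indicator of a cell is a product of factors (1 ± sgn)/2, one for each digit; expanding the
product gives Walsh functions. -/
theorem indicator_block {m : ℕ} (ε : Fin m → Bool) (x : unitInterval) :
    (if block m x = ε then (1 : ℝ) else 0) =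
      ∑ t : Finset (Fin m), (2 ^ m)⁻¹ * (∏ i ∈ t, sgn (ε i)) *
        walsh (t.map (blockEmbedding m)) x := by
  have h1 : (if block m x = ε then (1 : ℝ) else 0) =
      ∏ i : Fin m, (2⁻¹ * (sgn (ε i) * sgn (block m x i)) + 2⁻¹) := by
    split_ifs with h
    · subst h
      symm
      refine Finset.prod_eq_one fun i _ => ?_
      rw [sgn_mul_self]; norm_num
    · obtain ⟨i, hi⟩ := Function.ne_iff.1 h
      symm
      refine Finset.prod_eq_zero (Finset.mem_univ i) ?_
      revert hi
      cases block m x i <;> cases ε i <;> simp [sgn]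
  rw [h1, Finset.prod_add]
  simp only [Finset.powerset_univ]
  refine Finset.sum_congr rfl fun t _ => ?_
  rw [walsh_map_blockEmbedding, Finset.prod_mul_distrib, Finset.prod_mul_distrib,
    Finset.prod_const, Finset.prod_const, mul_right_comm, ← pow_add,
    Finset.card_sdiff_of_subset (Finset.subset_univ t), Finset.card_univ, Fintype.card_fin,
    Nat.add_sub_cancel' (by simpa using Finset.card_le_univ t), inv_pow, mul_assoc]

theorem integral_comp_block {m : ℕ} (G : (Fin m → Bool) → ℝ) :
    ∫ x, G (block m x) = (2 ^ m)⁻¹ * ∑ ε, G ε := by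
  have h1 : ∀ ε : Fin m → Bool, ∫ x, (if block m x = ε then (1 : ℝ) else 0) = (2 ^ m)⁻¹ := by
    intro ε
    have h2 : ∀ A : Finset ℕ, ∫ x, walsh A x = if A = ∅ then 1 else 0 := by
      intro A
      simpa [walsh] using integral_walsh_mul A ∅
    simp only [indicator_block]
    rw [integral_finsetSum _ fun t _ => (integrable_of_abs_le (measurable_walsh _) 1 fun x =>
      (abs_walsh _ x).le).const_mul _]
    simp only [integral_const_mul, h2, Finset.map_eq_empty]
    simp
  have h3 : ∀ x, G (block m x) = ∑ ε, G ε * (if block m x = ε then (1 : ℝ) else 0) := by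
    intro x; simp
  simp only [h3]
  rw [integral_finsetSum _ fun ε _ => (integrable_of_abs_le
    (measurable_comp_block fun e => if e = ε then (1 : ℝ) else 0) 1 fun x => by
      split_ifs <;> simp).const_mul _]
  simp only [integral_const_mul, h1, ← Finset.sum_mul]
  ring

/-- The indices of the eigenfunctions that span the functions of a block of `m` digits. -/
def blockIndices (m : ℕ) : Finset ℕ := insert 0 (Finset.Icc 2 (2 ^ m))

/-- The number k codes the subset in binary. Codes k ≥ 1 sit at index k + 1, since index 1 is taken
by the leading digit, and k = 0 sits at index 0. -/
theorem exists_eigenfun_eq {m : ℕ} (t : Finset (Fin m)) :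
    ∃ j ∈ blockIndices m, eigenfun j = walsh (t.map (blockEmbedding m)) := by
  set k := Finset.equivBitIndices.symm (t.map Fin.valEmbedding) with hk
  have hb : (Finset.equivBitIndices k).map (addRightEmbedding 2) = t.map (blockEmbedding m) := by
    rw [hk, Equiv.apply_symm_apply, Finset.map_map]; rfl
  have hlt : k < 2 ^ m := by
    rw [hk, Finset.equivBitIndices_symm_apply]
    exact Nat.geomSum_lt le_rfl fun i hi => by
      obtain ⟨a, -, rfl⟩ := Finset.mem_map.1 hi
      exact a.2
  by_cases h0 : k = 0
  · refine ⟨0, Finset.mem_insert_self _ _, ?_⟩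
    rw [eigenfun, digitSet, if_neg (by norm_num), ← hb, h0]
  · refine ⟨k + 1, Finset.mem_insert_of_mem (Finset.mem_Icc.2 ⟨by omega, by omega⟩), ?_⟩
    rw [eigenfun, digitSet, if_neg (by omega), ← hb, Nat.add_sub_cancel]

theorem exists_block_expansion {m : ℕ} (G : (Fin m → Bool) → ℝ) :
    ∃ c : ℕ → ℝ, ∀ x, G (block m x) = ∑ j ∈ blockIndices m, c j * eigenfun j x := by
  have hmem : (fun x => G (block m x)) ∈
      Submodule.span ℝ (eigenfun '' (blockIndices m : Set ℕ)) := by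
    have h3 : (fun x => G (block m x)) = ∑ ε, G ε • ∑ t : Finset (Fin m),
        ((2 ^ m)⁻¹ * (∏ i ∈ t, sgn (ε i))) • walsh (t.map (blockEmbedding m)) := by
      funext x
      have := fun ε : Fin m → Bool => indicator_block ε x
      simp only [Finset.sum_apply, Pi.smul_apply, smul_eq_mul, ← this]
      simp
    rw [h3]
    refine Submodule.sum_mem _ fun ε _ => Submodule.smul_mem _ _ <|
      Submodule.sum_mem _ fun t _ => Submodule.smul_mem _ _ ?_
    obtain ⟨j, hj, he⟩ := exists_eigenfun_eq t
    exact Submodule.subset_span ⟨j, hj, he⟩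
  rw [Submodule.mem_span_image_finset_iff_exists_fun'] at hmem
  obtain ⟨c, hc⟩ := hmem
  refine ⟨c, fun x => ?_⟩
  have := congrFun hc x
  simpa using this.symm

theorem integral_sum_eigenfun_mul (T : Finset ℕ) (c : ℕ → ℝ) (i : ℕ) :
    ∫ x, (∑ j ∈ T, c j * eigenfun j x) * eigenfun i x = if i ∈ T then c i else 0 := by
  have hI : ∀ j, Integrable fun x => c j * (eigenfun j x * eigenfun i x) := fun j =>
    (integrable_of_abs_le (by fun_prop) 1 fun x => by
      rw [abs_mul, abs_eigenfun, abs_eigenfun, one_mul]).const_mul _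
  simp only [Finset.sum_mul, mul_assoc]
  rw [integral_finsetSum _ fun j _ => hI j]
  simp only [integral_const_mul, integral_eigenfun_mul]
  simp

theorem integral_sq_sum_eigenfun (T : Finset ℕ) (c : ℕ → ℝ) :
    ∫ x, (∑ j ∈ T, c j * eigenfun j x) ^ 2 = ∑ j ∈ T, c j ^ 2 := by
  have hI : ∀ i, Integrable fun x =>
      c i * ((∑ j ∈ T, c j * eigenfun j x) * eigenfun i x) := fun i =>
    (integrable_of_abs_le (by fun_prop) (∑ j ∈ T, |c j|) fun x => by
      rw [abs_mul, abs_eigenfun, mul_one]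
      refine (Finset.abs_sum_le_sum_abs _ _).trans (Finset.sum_le_sum fun j _ => ?_)
      rw [abs_mul, abs_eigenfun, mul_one]).const_mul _
  have h : ∀ x, (∑ j ∈ T, c j * eigenfun j x) ^ 2 =
      ∑ i ∈ T, c i * ((∑ j ∈ T, c j * eigenfun j x) * eigenfun i x) := by
    intro x
    rw [sq, Finset.mul_sum]
    exact Finset.sum_congr rfl fun i _ => by ring
  simp only [h]
  rw [integral_finsetSum _ fun j _ => hI j]
  simp only [integral_const_mul, integral_sum_eigenfun_mul]
  refine Finset.sum_congr rfl fun i hi => ?_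
  rw [if_pos hi, sq]

/-- A sign function of a block of digits, plus a multiple of its mean, plus a multiple of the sign
of the leading digit, as an element of the space, with a bound on its norm. -/
theorem WalshSpace.exists_signFunction {lam : ℕ → ℝ} {hs : Summable lam} {m : ℕ} {Λ : ℝ}
    (hΛ : 0 < Λ) (hlam : ∀ j ∈ blockIndices m, Λ ≤ lam j) (h1 : 0 < lam 1)
    (v : (Fin m → Bool) → Bool) (α E κ : ℝ) (hE : 0 ≤ E) (hκ : 0 ≤ κ) :
    ∃ h : WalshSpace lam hs,
      (∀ x, h x = α * sgn (digit 0 x) + E * sgn (v (block m x)) +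
        κ * ∫ y, sgn (v (block m y))) ∧
      ‖h‖ ^ 2 ≤ α ^ 2 / lam 1 + (E + κ) ^ 2 / Λ := by
  obtain ⟨c, hc⟩ := exists_block_expansion fun ε => sgn (v ε)
  have hmean : ∫ y, sgn (v (block m y)) = c 0 := by
    have := integral_sum_eigenfun_mul (blockIndices m) c 0
    simp only [← hc, eigenfun_zero, mul_one] at this
    rw [this, if_pos (by simp [blockIndices])]
  -- Parseval for a function with values ±1.
  have hsq : ∑ j ∈ blockIndices m, c j ^ 2 = 1 := by
    rw [← integral_sq_sum_eigenfun]
    simp only [← hc, sq, sgn_mul_self]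
    simp
  have h1T : 1 ∉ blockIndices m := by simp [blockIndices]
  -- The mean of the sign function is its coefficient at the constant, so the added multiple of the
  -- mean changes only that coefficient, from E c₀ to (E + κ) c₀.
  let a : ℕ → ℝ := fun j => if j = 1 then α else if j = 0 then (E + κ) * c 0 else E * c j
  have h0T : 0 ∉ Finset.Icc 2 (2 ^ m) := by simp
  obtain ⟨h, hx, hn⟩ := WalshSpace.exists_sum (hs := hs) (insert 1 (blockIndices m))
    (fun j hj => by
      rcases Finset.mem_insert.1 hj with rfl | hj
      · exact h1
      · exact hΛ.trans_le (hlam j hj)) a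
  refine ⟨h, fun x => ?_, ?_⟩
  · have hcx := hc x
    simp only [blockIndices, Finset.sum_insert h0T] at hcx
    rw [hx, Finset.sum_insert h1T, hmean, hcx, blockIndices, Finset.sum_insert h0T]
    have h2 : ∑ j ∈ Finset.Icc 2 (2 ^ m), a j * eigenfun j x =
        E * ∑ j ∈ Finset.Icc 2 (2 ^ m), c j * eigenfun j x := by
      rw [Finset.mul_sum]
      refine Finset.sum_congr rfl fun j hj => ?_
      have := (Finset.mem_Icc.1 hj).1
      simp only [a]
      rw [if_neg (by omega), if_neg (by omega)]; ring
    rw [h2]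
    simp [a, eigenfun_one, eigenfun_zero]
    ring
  · rw [hn, Finset.sum_insert h1T]
    have h3 : ∑ j ∈ blockIndices m, a j ^ 2 / lam j ≤
        ∑ j ∈ blockIndices m, (E + κ) ^ 2 / Λ * c j ^ 2 := by
      refine Finset.sum_le_sum fun j hj => ?_
      have hj1 : j ≠ 1 := fun e => h1T (e ▸ hj)
      have h4 : a j ^ 2 ≤ (E + κ) ^ 2 * c j ^ 2 := by
        simp only [a]
        rw [if_neg hj1]
        split_ifs with h0
        · rw [h0, mul_pow]
        · rw [mul_pow]; gcongr; linarith
      calc a j ^ 2 / lam j ≤ (E + κ) ^ 2 * c j ^ 2 / Λ := by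
            gcongr; exact hlam j hj
        _ = _ := by ring
    rw [← Finset.mul_sum, hsq, mul_one] at h3
    simpa [a] using h3

/-! ## Trajectory laws and their densities -/

section Trajectory

variable {X : Type*} [MeasurableSpace X]

theorem measurable_snoc (n : ℕ) :
    Measurable fun p : (Fin n → X) × X => (Fin.snoc (α := fun _ => X) p.1 p.2 : Fin (n + 1) → X) := by
  refine measurable_pi_iff.2 fun i => ?_
  refine Fin.lastCases ?_ (fun j => ?_) i
  · simp only [Fin.snoc_last]; exact measurable_snd
  · simp only [Fin.snoc_castSucc]; fun_prop

instance isProbabilityMeasure_trajLaw (P : Kernel X X) [IsMarkovKernel P] (μ : Measure X)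
    [IsProbabilityMeasure μ] (n : ℕ) : IsProbabilityMeasure (trajLaw P μ n) := by
  match n with
  | 0 => unfold trajLaw; infer_instance
  | 1 => unfold trajLaw; exact Measure.isProbabilityMeasure_map (by fun_prop)
  | n + 2 =>
    have := isProbabilityMeasure_trajLaw P μ (n + 1)
    unfold trajLaw
    exact Measure.isProbabilityMeasure_map (measurable_snoc (n + 1)).aemeasurable

theorem lintegral_trajLaw_one (P : Kernel X X) (μ : Measure X) {F : (Fin 1 → X) → ℝ≥0∞}
    (hF : Measurable F) : ∫⁻ ω, F ω ∂trajLaw P μ 1 = ∫⁻ x, F (fun _ => x) ∂μ := by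
  unfold trajLaw
  rw [lintegral_map hF (by fun_prop)]

theorem lintegral_trajLaw_add_two (P : Kernel X X) [IsMarkovKernel P] (μ : Measure X)
    [IsProbabilityMeasure μ] (n : ℕ) {F : (Fin (n + 2) → X) → ℝ≥0∞} (hF : Measurable F) :
    ∫⁻ ω, F ω ∂trajLaw P μ (n + 2) = ∫⁻ ω, ∫⁻ y, F (Fin.snoc (α := fun _ => X) ω y)
      ∂P (ω (Fin.last n)) ∂trajLaw P μ (n + 1) := by
  rw [trajLaw, lintegral_map hF (measurable_snoc _),
    Measure.lintegral_compProd (f := fun p => F (Fin.snoc (α := fun _ => X) p.1 p.2))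
      (hF.comp (measurable_snoc _))]
  rfl

theorem lintegral_trajLaw_last {P : Kernel X X} [IsMarkovKernel P] {μ : Measure X}
    [IsProbabilityMeasure μ] (h : Kernel.Invariant P μ) (n : ℕ) {f : X → ℝ≥0∞}
    (hf : Measurable f) :
    ∫⁻ ω, f (ω (Fin.last n)) ∂trajLaw P μ (n + 1) = ∫⁻ x, f x ∂μ := by
  induction n generalizing f with
  | zero => rw [lintegral_trajLaw_one P μ (by fun_prop)]
  | succ n ih =>
    rw [lintegral_trajLaw_add_two P μ n (by fun_prop)]
    simp only [Fin.snoc_last]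
    rw [ih (f := fun x => ∫⁻ y, f y ∂P x) hf.lintegral_kernel,
      ← Measure.lintegral_bind P.aemeasurable hf.aemeasurable, h.def]

/-- The square root of the density of the law of a trajectory, given the square roots `ψ` and `Ψ`
of the densities of the initial distribution and of the transition kernel. -/
def rootDensity (ψ : X → ℝ≥0∞) (Ψ : X → X → ℝ≥0∞) : (n : ℕ) → (Fin (n + 1) → X) → ℝ≥0∞
  | 0, ω => ψ (ω 0)
  | n + 1, ω => rootDensity ψ Ψ n (fun i => ω i.castSucc) *
      Ψ (ω (Fin.last n).castSucc) (ω (Fin.last (n + 1)))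

variable {ψ ψ' : X → ℝ≥0∞} {Ψ Ψ' : X → X → ℝ≥0∞}

theorem measurable_rootDensity (hψ : Measurable ψ) (hΨ : Measurable (Function.uncurry Ψ)) (n : ℕ) :
    Measurable (rootDensity ψ Ψ n) := by
  induction n with
  | zero => exact hψ.comp (measurable_pi_apply 0)
  | succ n ih =>
    refine Measurable.fun_mul (ih.comp (g := rootDensity ψ Ψ n)
      (f := fun (ω : Fin (n + 2) → X) (i : Fin (n + 1)) => ω i.castSucc) (by fun_prop)) (hΨ.comp (g := Function.uncurry Ψ)
      (f := fun ω : Fin (n + 2) → X => (ω (Fin.last n).castSucc, ω (Fin.last (n + 1)))) ?_)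
    fun_prop

omit [MeasurableSpace X] in
theorem rootDensity_snoc (n : ℕ) (ω : Fin (n + 1) → X) (y : X) :
    rootDensity ψ Ψ (n + 1) (Fin.snoc (α := fun _ => X) ω y) =
      rootDensity ψ Ψ n ω * Ψ (ω (Fin.last n)) y := by
  simp [rootDensity]

variable {B P P' : Kernel X X} [IsMarkovKernel B] [IsMarkovKernel P] [IsMarkovKernel P']
  {μ₀ μ μ' : Measure X} [IsProbabilityMeasure μ₀] [IsProbabilityMeasure μ] [IsProbabilityMeasure μ']

theorem trajLaw_eq_withDensity (hψ : Measurable ψ) (hΨ : Measurable (Function.uncurry Ψ))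
    (hμ : μ = μ₀.withDensity fun x => ψ x ^ 2)
    (hP : ∀ x, P x = (B x).withDensity fun y => Ψ x y ^ 2) (n : ℕ) :
    trajLaw P μ (n + 1) =
      (trajLaw B μ₀ (n + 1)).withDensity fun ω => rootDensity ψ Ψ n ω ^ 2 := by
  have hm := measurable_rootDensity hψ hΨ
  have hΨx : ∀ x, Measurable (Ψ x) := fun x => hΨ.comp measurable_prodMk_left
  induction n with
  | zero =>
    refine Measure.ext_of_lintegral _ fun F hF => ?_
    rw [lintegral_withDensity_eq_lintegral_mul _ ((hm 0).pow_const 2) hF, lintegral_trajLaw_one _ _ hF,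
      lintegral_trajLaw_one _ _ (((hm 0).pow_const 2).mul hF), hμ,
      lintegral_withDensity_eq_lintegral_mul _ (hψ.pow_const 2) (by fun_prop)]
    rfl
  | succ n ih =>
    refine Measure.ext_of_lintegral _ fun F hF => ?_
    have hG : Measurable fun ω : Fin (n + 1) → X =>
        ∫⁻ y, F (Fin.snoc (α := fun _ => X) ω y) ∂P (ω (Fin.last n)) := by
      exact (hF.comp (measurable_snoc (n + 1))).lintegral_kernel_prod_right'
        (κ := P.comap (fun ω : Fin (n + 1) → X => ω (Fin.last n)) (measurable_pi_apply _))
    rw [lintegral_withDensity_eq_lintegral_mul _ ((hm _).pow_const 2) hF,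
      lintegral_trajLaw_add_two _ _ _ hF,
      lintegral_trajLaw_add_two _ _ _ (((hm _).pow_const 2).mul hF), ih,
      lintegral_withDensity_eq_lintegral_mul _ ((hm _).pow_const 2) hG]
    refine lintegral_congr fun ω => ?_
    have hsn : Measurable fun y => F (Fin.snoc (α := fun _ => X) ω y) :=
      hF.comp ((measurable_snoc (n + 1)).comp measurable_prodMk_left)
    simp only [Pi.mul_apply, rootDensity_snoc]
    rw [hP, lintegral_withDensity_eq_lintegral_mul _ ((hΨx _).pow_const 2) hsn,
      ← lintegral_const_mul _ (((hΨx _).pow_const 2).mul hsn)]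
    refine lintegral_congr fun y => ?_
    simp only [Pi.mul_apply, mul_pow, mul_assoc]

theorem two_mul_le_sq_add_sq (a b : ℝ≥0∞) : 2 * (a * b) ≤ a ^ 2 + b ^ 2 := by
  induction a with
  | top => simp
  | coe a =>
    induction b with
    | top => simp
    | coe b =>
      norm_cast
      have := two_mul_le_add_sq (a : ℝ) b
      rw [mul_assoc] at this
      exact_mod_cast this

/-- The Hellinger affinity of two stationary trajectory laws decreases at most linearly in the
length of the trajectory. -/
theorem one_le_affinity_add (hψ : Measurable ψ) (hΨ : Measurable (Function.uncurry Ψ))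
    (hψ' : Measurable ψ') (hΨ' : Measurable (Function.uncurry Ψ'))
    (hμ : μ = μ₀.withDensity fun x => ψ x ^ 2)
    (hP : ∀ x, P x = (B x).withDensity fun y => Ψ x y ^ 2)
    (hμ' : μ' = μ₀.withDensity fun x => ψ' x ^ 2)
    (hP' : ∀ x, P' x = (B x).withDensity fun y => Ψ' x y ^ 2)
    (hi : Kernel.Invariant P μ) (hi' : Kernel.Invariant P' μ')
    {h₀ h₁ : ℝ≥0∞} {e : X → ℝ≥0∞} (he : Measurable e)
    (h0 : 1 ≤ ∫⁻ x, ψ x * ψ' x ∂μ₀ + h₀)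
    (h1 : ∀ x, 1 ≤ ∫⁻ y, Ψ x y * Ψ' x y ∂B x + e x)
    (h2 : ∫⁻ x, e x ∂μ ≤ h₁) (h2' : ∫⁻ x, e x ∂μ' ≤ h₁) (n : ℕ) :
    1 ≤ ∫⁻ ω, rootDensity ψ Ψ n ω * rootDensity ψ' Ψ' n ω ∂trajLaw B μ₀ (n + 1) +
      (h₀ + n * h₁) := by
  have hm := measurable_rootDensity hψ hΨ
  have hm' := measurable_rootDensity hψ' hΨ'
  have hΨx : ∀ x, Measurable (Ψ x) := fun x => hΨ.comp measurable_prodMk_left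
  have hΨx' : ∀ x, Measurable (Ψ' x) := fun x => hΨ'.comp measurable_prodMk_left
  induction n with
  | zero =>
    rw [lintegral_trajLaw_one _ _ ((hm 0).fun_mul (hm' 0))]
    simpa [rootDensity] using h0
  | succ n ih =>
    refine ih.trans ?_
    have hel : Measurable fun ω : Fin (n + 1) → X => e (ω (Fin.last n)) := by fun_prop
    -- The affinity lost in one more step is the deficit `e` at the last state, weighted by the
    -- product of the two root densities. By 2LL' ≤ L² + L'² this is at most the average of ∫ e dμ
    -- and ∫ e dμ', because the last state is stationary under either law.
    have key : ∫⁻ ω, rootDensity ψ Ψ n ω * rootDensity ψ' Ψ' n ω * e (ω (Fin.last n))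
        ∂trajLaw B μ₀ (n + 1) ≤ h₁ := by
      have hsq : ∀ ω, 2 * (rootDensity ψ Ψ n ω * rootDensity ψ' Ψ' n ω * e (ω (Fin.last n))) ≤
          rootDensity ψ Ψ n ω ^ 2 * e (ω (Fin.last n)) +
            rootDensity ψ' Ψ' n ω ^ 2 * e (ω (Fin.last n)) := by
        intro ω
        rw [← mul_assoc, ← add_mul]
        gcongr
        exact two_mul_le_sq_add_sq _ _
      have h3 := lintegral_mono (μ := trajLaw B μ₀ (n + 1)) hsq
      rw [lintegral_const_mul _ (((hm n).fun_mul (hm' n)).fun_mul hel),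
        lintegral_add_left (((hm n).pow_const 2).fun_mul hel)] at h3
      have h4 : ∫⁻ ω, rootDensity ψ Ψ n ω ^ 2 * e (ω (Fin.last n)) ∂trajLaw B μ₀ (n + 1) =
          ∫⁻ x, e x ∂μ := by
        rw [← lintegral_trajLaw_last hi n he, trajLaw_eq_withDensity hψ hΨ hμ hP n,
          lintegral_withDensity_eq_lintegral_mul _ ((hm n).pow_const 2) hel]
        rfl
      have h4' : ∫⁻ ω, rootDensity ψ' Ψ' n ω ^ 2 * e (ω (Fin.last n)) ∂trajLaw B μ₀ (n + 1) =
          ∫⁻ x, e x ∂μ' := by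
        rw [← lintegral_trajLaw_last hi' n he, trajLaw_eq_withDensity hψ' hΨ' hμ' hP' n,
          lintegral_withDensity_eq_lintegral_mul _ ((hm' n).pow_const 2) hel]
        rfl
      rw [h4, h4'] at h3
      have h5 := h3.trans (add_le_add h2 h2')
      rw [← two_mul] at h5
      exact (ENNReal.mul_le_mul_iff_right two_ne_zero ENNReal.ofNat_ne_top).1 h5
    have hstep : ∫⁻ ω, rootDensity ψ Ψ n ω * rootDensity ψ' Ψ' n ω ∂trajLaw B μ₀ (n + 1) ≤
        ∫⁻ ω, rootDensity ψ Ψ (n + 1) ω * rootDensity ψ' Ψ' (n + 1) ω ∂trajLaw B μ₀ (n + 2) +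
        h₁ := by
      refine le_trans ?_ (add_le_add le_rfl key)
      rw [lintegral_trajLaw_add_two _ _ _ ((hm _).fun_mul (hm' _)), ← lintegral_add_right _
        (((hm n).fun_mul (hm' n)).fun_mul hel)]
      refine lintegral_mono fun ω => ?_
      have : ∫⁻ y, rootDensity ψ Ψ (n + 1) (Fin.snoc (α := fun _ => X) ω y) *
          rootDensity ψ' Ψ' (n + 1) (Fin.snoc (α := fun _ => X) ω y) ∂B (ω (Fin.last n)) =
          rootDensity ψ Ψ n ω * rootDensity ψ' Ψ' n ω *
            ∫⁻ y, Ψ (ω (Fin.last n)) y * Ψ' (ω (Fin.last n)) y ∂B (ω (Fin.last n)) := by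
        rw [← lintegral_const_mul _ ((hΨx _).fun_mul (hΨx' _))]
        refine lintegral_congr fun y => ?_
        rw [rootDensity_snoc, rootDensity_snoc]
        ring
      rw [this, ← mul_add]
      exact le_mul_of_one_le_right' (h1 _)
    refine (add_le_add hstep le_rfl).trans_eq ?_
    push_cast
    ring

end Trajectory

/-! ## Testing -/

theorem mul_le_weighted (a b : ℝ≥0∞) : 8 * (a * b) ≤ a ^ 2 + 16 * b ^ 2 := by
  have := two_mul_le_sq_add_sq a (4 * b)
  calc 8 * (a * b) = 2 * (a * (4 * b)) := by ring
    _ ≤ _ := this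
    _ = _ := by ring

/-- Two laws with large Hellinger affinity cannot be separated by a test. -/
theorem one_le_test_error {Ω : Type*} [MeasurableSpace Ω] {Q P P' : Measure Ω}
    [IsProbabilityMeasure P] [IsProbabilityMeasure P'] {L L' : Ω → ℝ≥0∞} (hL : Measurable L)
    (hL' : Measurable L') (hP : P = Q.withDensity fun ω => L ω ^ 2)
    (hP' : P' = Q.withDensity fun ω => L' ω ^ 2) (hA : 3 / 4 ≤ ∫⁻ ω, L ω * L' ω ∂Q) {E : Set Ω}
    (hE : MeasurableSet E) : 1 / 4 ≤ P.real Eᶜ + P'.real E := by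
  have hon : ∀ {S : Set Ω} (_ : MeasurableSet S) {K K' : Ω → ℝ≥0∞} (_ : Measurable K)
      (_ : Measurable K'), 8 * ∫⁻ ω in S, K ω * K' ω ∂Q ≤
        (Q.withDensity fun ω => K ω ^ 2) S + 16 * (Q.withDensity fun ω => K' ω ^ 2) S := by
    intro S hS K K' hK hK'
    rw [withDensity_apply _ hS, withDensity_apply _ hS, ← lintegral_const_mul _ (hK.fun_mul hK'),
      ← lintegral_const_mul _ (hK'.pow_const 2), ← lintegral_add_left (hK.pow_const 2)]
    exact lintegral_mono fun ω => mul_le_weighted _ _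
  have h1 := hon hE hL hL'
  have h2 := hon hE.compl hL' hL
  rw [← hP, ← hP'] at h1 h2
  -- On each set the weight 16 falls on the law whose mass there is a test error. The right-hand
  -- side equals 2 + 15 (P Eᶜ + P' E), so the total error is at least 4/15.
  have h3 : 8 * (3 / 4 : ℝ≥0∞) ≤ (P E + 16 * P' E) + (P' Eᶜ + 16 * P Eᶜ) := by
    refine le_trans ?_ (add_le_add h1 h2)
    rw [← mul_add]
    gcongr
    simp only [mul_comm (L' _)]
    rwa [lintegral_add_compl _ hE]
  have h4 := ENNReal.toReal_mono (by finiteness) h3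
  rw [ENNReal.toReal_add (by finiteness) (by finiteness),
    ENNReal.toReal_add (by finiteness) (by finiteness),
    ENNReal.toReal_add (by finiteness) (by finiteness)] at h4
  simp only [ENNReal.toReal_mul, ENNReal.toReal_ofNat, ENNReal.toReal_div] at h4
  change 8 * (3 / 4) ≤ P.real E + 16 * P'.real E + (P'.real Eᶜ + 16 * P.real Eᶜ) at h4
  have h5 := probReal_add_probReal_compl (μ := P) hE
  have h6 := probReal_add_probReal_compl (μ := P') hE
  linarith

open Classical in
/-- Assouad's lemma in probability, for sets `A v` (the events of a large estimation error) that
need not be measurable. -/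
theorem exists_le_measure_of_test_error {Ω J : Type*} [MeasurableSpace Ω] [Fintype J] [Nonempty J]
    (P : (J → Bool) → Measure Ω) [∀ v, IsProbabilityMeasure (P v)]
    (htest : ∀ v j E, MeasurableSet E →
      1 / 4 ≤ (P v).real Eᶜ + (P (Function.update v j (!v j))).real E)
    (A : (J → Bool) → Set Ω)
    (hA : ∀ ω v w, ω ∉ A v → ω ∉ A w →
      16 * (({j | v j ≠ w j} : Finset J).card : ℝ) ≤ Fintype.card J) :
    ∃ v, ENNReal.ofReal (1 / 16) ≤ P v (A v) := by
  by_contra! hlt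
  set D : ℝ := (Fintype.card J : ℝ) with hD
  have hDpos : 0 < D := by simpa [hD] using Fintype.card_pos
  -- Measurable hulls have the same measure, and a point outside the hull is outside the set.
  let A' : (J → Bool) → Set Ω := fun v => toMeasurable (P v) (A v)
  have hA'm : ∀ v, MeasurableSet (A' v) := fun v => measurableSet_toMeasurable _ _
  have hsub : ∀ v, A v ⊆ A' v := fun v => subset_toMeasurable _ _
  have hA'lt : ∀ v, (P v).real (A' v) < 1 / 16 := by
    intro v
    have := hlt v
    rw [← measure_toMeasurable (A v)] at this
    have h2 := (ENNReal.toReal_lt_toReal (by finiteness) (by finiteness)).2 this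
    rwa [ENNReal.toReal_ofReal (by norm_num)] at h2
  -- The decoder may pick any v whose error event does not occur. It depends on the observation only
  -- through one of finitely many patterns, so it is measurable whatever choice is made, even if the
  -- estimator is not.
  let pat : Ω → (J → Bool) → Bool := fun ω v => decide (ω ∈ A' v)
  have hpat : Measurable pat := by
    refine measurable_pi_iff.2 fun v => measurable_to_bool ?_
    convert hA'm v using 1
    ext ω; simp [pat]
  let dec : ((J → Bool) → Bool) → (J → Bool) := fun S =>
    if h : ∃ v, S v = false then h.choose else fun _ => false
  have hdec : Measurable fun ω => dec (pat ω) := (measurable_of_countable dec).comp hpat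
  have hdec' : ∀ ω v, ω ∉ A' v → ω ∉ A' (dec (pat ω)) := by
    intro ω v hv
    have h : ∃ v, pat ω v = false := ⟨v, by simpa [pat] using hv⟩
    have h2 := h.choose_spec
    simp only [dec, dif_pos h]
    simpa [pat] using h2
  have hE : ∀ j b, MeasurableSet {ω | dec (pat ω) j = b} := fun j b =>
    ((measurable_pi_apply j).comp hdec) (measurableSet_singleton b)
  -- the expected Hamming loss
  have hloss : ∀ v, ∑ j, (P v).real {ω | dec (pat ω) j = !v j} ≤
      D * (P v).real (A' v) + D / 16 := by
    intro v
    have h1 : ∀ j, (P v).real {ω | dec (pat ω) j = !v j} =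
        ∫ ω, Set.indicator {ω | dec (pat ω) j = !v j} (fun _ => (1 : ℝ)) ω ∂P v := by
      intro j
      rw [integral_indicator_const _ (hE j _)]; simp
    have h2 : ∀ S : Set Ω, MeasurableSet S →
        Integrable (Set.indicator S fun _ => (1 : ℝ)) (P v) := fun S hS =>
      (integrable_const 1).indicator hS
    simp only [h1]
    rw [← integral_finsetSum _ fun j _ => h2 _ (hE j _)]
    have h3 : D * (P v).real (A' v) + D / 16 =
        ∫ ω, (D * Set.indicator (A' v) (fun _ => (1 : ℝ)) ω + D / 16) ∂P v := by
      rw [integral_add ((h2 _ (hA'm v)).const_mul _) (integrable_const _), integral_const_mul,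
        integral_indicator_const _ (hA'm v)]
      simp
    rw [h3]
    refine integral_mono (integrable_finsetSum _ fun j _ => h2 _ (hE j _))
      (((h2 _ (hA'm v)).const_mul _).add (integrable_const _)) fun ω => ?_
    have h4 : ∑ j, Set.indicator {ω | dec (pat ω) j = !v j} (fun _ => (1 : ℝ)) ω =
        (({j | v j ≠ dec (pat ω) j} : Finset J).card : ℝ) := by
      rw [Finset.card_filter]
      push_cast
      refine Finset.sum_congr rfl fun j _ => ?_
      rw [Set.indicator_apply]
      refine if_congr ?_ rfl rfl
      rw [Set.mem_ofPred_eq]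
      cases v j <;> cases dec (pat ω) j <;> simp
    simp only [h4]
    by_cases hω : ω ∈ A' v
    · rw [Set.indicator_of_mem hω]
      have : (({j | v j ≠ dec (pat ω) j} : Finset J).card : ℝ) ≤ D := by
        rw [hD]; exact_mod_cast Finset.card_le_univ _
      linarith
    · rw [Set.indicator_of_notMem hω]
      have := hA ω v (dec (pat ω)) (fun h => hω (hsub v h))
        (fun h => hdec' ω v hω (hsub _ h))
      linarith
  -- Pair v with its neighbour across coordinate j: their two errors add up to at least 1/4, and
  -- summing over the cube counts every error twice.
  have hpair : ∀ j, (2 : ℝ) ^ Fintype.card J / 8 ≤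
      ∑ v, (P v).real {ω | dec (pat ω) j = !v j} := by
    intro j
    let flip : (J → Bool) → (J → Bool) := fun v => Function.update v j (!v j)
    have hflip : Function.Involutive flip := by
      intro v
      simp [flip]
    have h1 : ∑ v, (P (flip v)).real {ω | dec (pat ω) j = v j} =
        ∑ v, (P v).real {ω | dec (pat ω) j = !v j} := by
      rw [← Equiv.sum_comp hflip.toPerm]
      refine Finset.sum_congr rfl fun v _ => ?_
      simp [hflip v, Function.Involutive.coe_toPerm]
      simp [flip]
    have h2 : ∑ v : J → Bool, (1 / 4 : ℝ) ≤ ∑ v, ((P v).real {ω | dec (pat ω) j = !v j} +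
        (P (flip v)).real {ω | dec (pat ω) j = v j}) := by
      refine Finset.sum_le_sum fun v _ => ?_
      have := htest v j {ω | dec (pat ω) j = v j} (hE j _)
      have hset : {ω | dec (pat ω) j = v j}ᶜ = {ω | dec (pat ω) j = !v j} := by
        refine Set.ext fun ω => ?_
        rw [Set.mem_compl_iff, Set.mem_ofPred_eq, Set.mem_ofPred_eq]
        cases v j <;> cases dec (pat ω) j <;> simp
      rwa [hset] at this
    rw [Finset.sum_add_distrib, h1] at h2
    simp at h2
    linarith
  have hsum1 := Finset.sum_le_sum fun j (_ : j ∈ Finset.univ) => hpair j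
  rw [Finset.sum_comm] at hsum1
  -- If all error events had probability below 1/16, each expected Hamming loss would be below D/16
  -- + D/16, contradicting the average bound D/8.
  have hsum2 : ∑ v, ∑ j, (P v).real {ω | dec (pat ω) j = !v j} <
      ∑ v : J → Bool, D / 8 := by
    refine Finset.sum_lt_sum_of_nonempty Finset.univ_nonempty fun v _ => ?_
    have := mul_lt_mul_of_pos_left (hA'lt v) hDpos
    linarith [hloss v]
  have := hsum1.trans_lt hsum2
  simp [← hD] at this
  linarith

/-! ## Kernels and value functions -/

section General

variable {X : Type*} [MeasurableSpace X]

theorem integral_bind_kernel {κ : Kernel X X} [IsMarkovKernel κ] {μ : Measure X}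
    [IsProbabilityMeasure μ] {f : X → ℝ} (hf : Measurable f) (C : ℝ) (hC : ∀ x, |f x| ≤ C) :
    ∫ x, f x ∂μ.bind κ = ∫ x, ∫ y, f y ∂κ x ∂μ := by
  have h : μ.bind κ = (κ ∘ₖ Kernel.const Unit μ) () := by
    rw [Kernel.comp_const, Kernel.const_apply]
  rw [h, Kernel.integral_comp (integrable_of_abs_le hf C hC)]
  simp

theorem abs_integral_le_of_abs_le {μ : Measure X} [IsProbabilityMeasure μ] {f : X → ℝ} {C : ℝ}
    (hC : ∀ x, |f x| ≤ C) : |∫ x, f x ∂μ| ≤ C := by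
  have := norm_integral_le_of_norm_le_const (μ := μ) (f := f) (C := C) (ae_of_all _ hC)
  simpa using this

instance isMarkovKernel_pow (P : Kernel X X) [IsMarkovKernel P] (t : ℕ) :
    IsMarkovKernel (P ^ t) := by
  induction t with
  | zero => rw [pow_zero]; exact inferInstanceAs (IsMarkovKernel Kernel.id)
  | succ t ih => rw [pow_succ]; exact inferInstanceAs (IsMarkovKernel ((P ^ t) ∘ₖ P))

theorem integral_pow_succ {P : Kernel X X} [IsMarkovKernel P] (t : ℕ) (x : X) {f : X → ℝ}
    (hf : Measurable f) (C : ℝ) (hC : ∀ x, |f x| ≤ C) :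
    ∫ y, f y ∂(P ^ (t + 1)) x = ∫ y, ∫ z, f z ∂P y ∂(P ^ t) x := by
  have h : P ^ (t + 1) = P ∘ₖ (P ^ t) := pow_succ' P t
  have : IsFiniteMeasure ((P ∘ₖ (P ^ t)) x) := inferInstance
  rw [h, Kernel.integral_comp (integrable_of_abs_le hf C hC)]

/-- A bounded solution of the Bellman equation is the value function. -/
theorem valueFunction_eq {P : Kernel X X} [IsMarkovKernel P] {r V : X → ℝ} {γ : ℝ}
    (hγ0 : 0 ≤ γ) (hγ1 : γ < 1) (hV : Measurable V) {Cr C : ℝ}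
    (hCr : ∀ x, |r x| ≤ Cr) (hC : ∀ x, |V x| ≤ C) (hB : ∀ x, V x = r x + γ * ∫ y, V y ∂P x)
    (x : X) : valueFunction r P γ x = V x := by
  -- Substituting r = V - γPV makes the discounted series telescope.
  have hint : ∀ t, ∫ y, r y ∂(P ^ t) x = ∫ y, V y ∂(P ^ t) x - γ * ∫ y, V y ∂(P ^ (t + 1)) x := by
    intro t
    have hPV : Measurable fun y => ∫ z, V z ∂P y :=
      (hV.stronglyMeasurable.integral_kernel (κ := P)).measurable
    rw [integral_pow_succ t x hV C hC, ← integral_const_mul, ← integral_sub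
      (integrable_of_abs_le hV C hC) ((integrable_of_abs_le hPV C fun y =>
        abs_integral_le_of_abs_le hC).const_mul _)]
    refine integral_congr_ae (ae_of_all _ fun y => ?_)
    simp only [hB y]; ring
  have hsummable : Summable fun t : ℕ => γ ^ t * ∫ y, r y ∂(P ^ t) x := by
    refine Summable.of_norm_bounded ((summable_geometric_of_lt_one hγ0 hγ1).mul_right Cr)
      fun t => ?_
    rw [norm_mul, norm_pow, Real.norm_of_nonneg hγ0]
    gcongr
    exact abs_integral_le_of_abs_le hCr
  refine HasSum.tsum_eq ?_
  rw [hsummable.hasSum_iff_tendsto_nat]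
  have hpart : ∀ n : ℕ, ∑ t ∈ Finset.range n, γ ^ t * ∫ y, r y ∂(P ^ t) x =
      V x - γ ^ n * ∫ y, V y ∂(P ^ n) x := by
    intro n
    have h0 : ∫ y, V y ∂(P ^ 0) x = V x := by
      rw [pow_zero]
      change ∫ y, V y ∂(Kernel.id x) = V x
      rw [Kernel.id_apply, integral_dirac' _ _ hV.stronglyMeasurable]
    have := Finset.sum_range_sub' (fun t => γ ^ t * ∫ y, V y ∂(P ^ t) x) n
    rw [pow_zero γ, one_mul, h0] at this
    rw [← this]
    refine Finset.sum_congr rfl fun t _ => ?_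
    rw [hint, pow_succ]
    simp only [pow_succ]; ring
  simp only [hpart]
  have hlim : Filter.Tendsto (fun n : ℕ => γ ^ n * ∫ y, V y ∂(P ^ n) x) Filter.atTop (nhds 0) := by
    refine squeeze_zero_norm (a := fun n => γ ^ n * C) (fun n => ?_) ?_
    · rw [norm_mul, norm_pow, Real.norm_of_nonneg hγ0]
      gcongr
      exact abs_integral_le_of_abs_le hC
    · simpa using (tendsto_pow_atTop_nhds_zero_of_lt_one hγ0 hγ1).mul_const C
  simpa using tendsto_const_nhds.sub hlim

/-- The variance is at most the second moment about any point; the freedom of z avoids computing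
conditional means of the value function. -/
theorem evariance_le_of_integral_sq_le {μ : Measure X} [IsProbabilityMeasure μ] {f : X → ℝ}
    (hf : Measurable f) (C : ℝ) (hC : ∀ x, |f x| ≤ C) (z c : ℝ)
    (h : ∫ x, (f x - z) ^ 2 ∂μ ≤ c) : evariance f μ ≤ ENNReal.ofReal c := by
  rw [← ofReal_variance (MemLp.of_bound hf.aestronglyMeasurable C (ae_of_all _ hC)),
    ← variance_sub_const hf.aestronglyMeasurable z]
  exact ENNReal.ofReal_le_ofReal
    ((variance_le_expectation_sq (hf.sub_const z).aestronglyMeasurable).trans h)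

/-- The kernel that moves to `a x` or `b x` with weights `w₀ x` and `w₁ x`, and otherwise jumps
according to `ν`. -/
def stepKernel (a b : X → X) (ha : Measurable a) (hb : Measurable b) (w₀ w₁ : X → ℝ≥0∞)
    (hw₀ : Measurable w₀) (hw₁ : Measurable w₁) (c : ℝ≥0∞) (ν : Measure X) : Kernel X X where
  toFun x := w₀ x • Measure.dirac (a x) + w₁ x • Measure.dirac (b x) + c • ν
  measurable' := by
    refine Measure.measurable_of_measurable_coe _ fun s hs => ?_
    simp only [Measure.add_apply, Measure.smul_apply, smul_eq_mul, Measure.dirac_apply' _ hs]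
    have h1 : Measurable fun x => s.indicator (1 : X → ℝ≥0∞) (a x) :=
      (measurable_one.indicator hs).comp ha
    have h2 : Measurable fun x => s.indicator (1 : X → ℝ≥0∞) (b x) :=
      (measurable_one.indicator hs).comp hb
    fun_prop

variable {a b : X → X} {ha : Measurable a} {hb : Measurable b} {w₀ w₁ : X → ℝ≥0∞}
    {hw₀ : Measurable w₀} {hw₁ : Measurable w₁} {c : ℝ≥0∞} {ν : Measure X}

theorem stepKernel_apply (x : X) : stepKernel a b ha hb w₀ w₁ hw₀ hw₁ c ν x =
    w₀ x • Measure.dirac (a x) + w₁ x • Measure.dirac (b x) + c • ν := rfl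

theorem lintegral_stepKernel (x : X) {F : X → ℝ≥0∞} (hF : Measurable F) :
    ∫⁻ y, F y ∂stepKernel a b ha hb w₀ w₁ hw₀ hw₁ c ν x =
      w₀ x * F (a x) + w₁ x * F (b x) + c * ∫⁻ y, F y ∂ν := by
  rw [stepKernel_apply, lintegral_add_measure, lintegral_add_measure, lintegral_smul_measure,
    lintegral_smul_measure, lintegral_smul_measure, lintegral_dirac' _ hF, lintegral_dirac' _ hF]
  rfl

theorem isMarkovKernel_stepKernel [IsProbabilityMeasure ν] (h : ∀ x, w₀ x + w₁ x + c = 1) :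
    IsMarkovKernel (stepKernel a b ha hb w₀ w₁ hw₀ hw₁ c ν) := by
  refine ⟨fun x => ⟨?_⟩⟩
  rw [stepKernel_apply]
  simp [h]

end General

/-! ## Two-point chains -/

/-- The data of a Markov chain that with probability `1 - p` moves from `x` to one of the points
`a x` and `b x`, and with probability `p` jumps according to its stationary density `m`. -/
structure TwoPoint where
  p : ℝ
  a : unitInterval → unitInterval
  b : unitInterval → unitInterval
  k : unitInterval → ℝ
  m : unitInterval → ℝ
  p_pos : 0 < p
  p_le_one : p ≤ 1
  measurable_a : Measurable a
  measurable_b : Measurable b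
  measurable_k : Measurable k
  measurable_m : Measurable m
  half_le_k : ∀ x, 1 / 2 ≤ k x
  half_le_m : ∀ x, 1 / 2 ≤ m x
  m_le : ∀ x, m x ≤ 3 / 2
  k_add_k : ∀ x, k (a x) + k (b x) = 2
  integral_m : ∫ x, m x = 1
  stationary : ∀ F : unitInterval → ℝ, Measurable F → (∃ C, ∀ x, |F x| ≤ C) →
    ∫ x, (k (a x) * F (a x) + k (b x) * F (b x)) / 2 * m x = ∫ x, F x * m x

namespace TwoPoint

attribute [fun_prop] measurable_a measurable_b measurable_k measurable_m

variable (S : TwoPoint)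

theorem m_nonneg (x : unitInterval) : 0 ≤ S.m x := by linarith [S.half_le_m x]

theorem k_nonneg (x : unitInterval) : 0 ≤ S.k x := by linarith [S.half_le_k x]

theorem abs_m_le (x : unitInterval) : |S.m x| ≤ 3 / 2 := by
  rw [abs_of_nonneg (S.m_nonneg x)]; exact S.m_le x

theorem integrable_m : Integrable S.m :=
  integrable_of_abs_le S.measurable_m _ S.abs_m_le

/-- The stationary distribution. -/
def stat : Measure unitInterval := volume.withDensity fun x => ENNReal.ofReal (S.m x)

instance : IsProbabilityMeasure S.stat := by
  refine ⟨?_⟩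
  rw [stat, withDensity_apply _ MeasurableSet.univ, Measure.restrict_univ,
    ← ofReal_integral_eq_lintegral_ofReal S.integrable_m (ae_of_all _ S.m_nonneg), S.integral_m,
    ENNReal.ofReal_one]

theorem integral_stat (F : unitInterval → ℝ) : ∫ x, F x ∂S.stat = ∫ x, F x * S.m x := by
  rw [stat, integral_withDensity_eq_integral_toReal_smul (by fun_prop) (by simp)]
  refine integral_congr_ae (ae_of_all _ fun x => ?_)
  simp only [smul_eq_mul, ENNReal.toReal_ofReal (S.m_nonneg x), mul_comm]

/-- The transition kernel. -/
def trans : Kernel unitInterval unitInterval :=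
  stepKernel S.a S.b S.measurable_a S.measurable_b
    (fun x => ENNReal.ofReal ((1 - S.p) / 2 * S.k (S.a x)))
    (fun x => ENNReal.ofReal ((1 - S.p) / 2 * S.k (S.b x)))
    (by fun_prop) (by fun_prop) (ENNReal.ofReal S.p) S.stat

theorem stay_nonneg : 0 ≤ (1 - S.p) / 2 := by linarith [S.p_le_one]

instance : IsMarkovKernel S.trans := by
  refine isMarkovKernel_stepKernel fun x => ?_
  have h0 := S.stay_nonneg
  have h1 := S.k_nonneg (S.a x)
  have h2 := S.k_nonneg (S.b x)
  rw [← ENNReal.ofReal_add (by positivity) (by positivity),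
    ← ENNReal.ofReal_add (by positivity) S.p_pos.le, ← mul_add, S.k_add_k]
  simp

theorem integral_trans (x : unitInterval) {F : unitInterval → ℝ} (hF : Measurable F) (C : ℝ)
    (hC : ∀ x, |F x| ≤ C) :
    ∫ y, F y ∂S.trans x =
      (1 - S.p) * ((S.k (S.a x) * F (S.a x) + S.k (S.b x) * F (S.b x)) / 2) +
        S.p * ∫ y, F y ∂S.stat := by
  have h0 := S.stay_nonneg
  have h1 := S.k_nonneg (S.a x)
  have h2 := S.k_nonneg (S.b x)
  have hd : ∀ (c : ℝ) (z : unitInterval),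
      Integrable F (ENNReal.ofReal c • Measure.dirac z) := fun c z =>
    (integrable_of_abs_le hF C hC).smul_measure (by finiteness)
  have hst : Integrable F (ENNReal.ofReal S.p • S.stat) :=
    (integrable_of_abs_le hF C hC).smul_measure (by finiteness)
  rw [trans, stepKernel_apply, integral_add_measure ((hd _ _).add_measure (hd _ _)) hst,
    integral_add_measure (hd _ _) (hd _ _), integral_smul_measure, integral_smul_measure,
    integral_smul_measure, integral_dirac' _ _ hF.stronglyMeasurable,
    integral_dirac' _ _ hF.stronglyMeasurable, ENNReal.toReal_ofReal (by positivity),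
    ENNReal.toReal_ofReal (by positivity), ENNReal.toReal_ofReal S.p_pos.le]
  simp only [smul_eq_mul]
  ring

theorem integrable_mul_m {F : unitInterval → ℝ} (hF : Measurable F) (C : ℝ)
    (hC : ∀ x, |F x| ≤ C) : Integrable fun x => F x * S.m x :=
  integrable_of_abs_le (by fun_prop) (C * (3 / 2)) fun x => by
    rw [abs_mul]
    exact mul_le_mul (hC x) (S.abs_m_le x) (abs_nonneg _) ((abs_nonneg _).trans (hC x))

theorem abs_stay_le {F : unitInterval → ℝ} {C : ℝ} (hC : ∀ x, |F x| ≤ C) (x : unitInterval) :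
    |(S.k (S.a x) * F (S.a x) + S.k (S.b x) * F (S.b x)) / 2| ≤ C := by
  have h1 := S.k_nonneg (S.a x)
  have h2 := S.k_nonneg (S.b x)
  have h3 := S.k_add_k x
  have h4 := abs_le.1 (hC (S.a x))
  have h5 := abs_le.1 (hC (S.b x))
  rw [abs_le]
  constructor <;> nlinarith

theorem integral_comp_trans {F : unitInterval → ℝ} (hF : Measurable F) (C : ℝ)
    (hC : ∀ x, |F x| ≤ C) (ν : Measure unitInterval) [IsProbabilityMeasure ν] :
    ∫ x, F x ∂ν.bind S.trans =
      (1 - S.p) * ∫ x, (S.k (S.a x) * F (S.a x) + S.k (S.b x) * F (S.b x)) / 2 ∂ν +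
        S.p * ∫ y, F y ∂S.stat := by
  have hI : Integrable (fun x => (S.k (S.a x) * F (S.a x) + S.k (S.b x) * F (S.b x)) / 2) ν :=
    integrable_of_abs_le (by fun_prop) C (S.abs_stay_le hC)
  rw [integral_bind_kernel hF C hC]
  simp only [S.integral_trans _ hF C hC]
  rw [integral_add (hI.const_mul _) (integrable_const _), integral_const_mul]
  simp

theorem ext_of_integral {ν ν' : Measure unitInterval} [IsProbabilityMeasure ν]
    [IsProbabilityMeasure ν'] (h : ∀ F : unitInterval → ℝ, Measurable F → (∀ x, |F x| ≤ 1) →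
      ∫ x, F x ∂ν = ∫ x, F x ∂ν') : ν = ν' := by
  refine Measure.ext fun s hs => ?_
  have := h (s.indicator fun _ => 1) (measurable_const.indicator hs) fun x => by
    by_cases hx : x ∈ s <;> simp [hx]
  rw [integral_indicator_const _ hs, integral_indicator_const _ hs] at this
  simp only [smul_eq_mul, mul_one] at this
  exact (measureReal_eq_measureReal_iff).1 this

instance (ν : Measure unitInterval) [IsProbabilityMeasure ν] :
    IsProbabilityMeasure (ν.bind S.trans) :=
  ⟨by rw [Measure.bind_apply MeasurableSet.univ S.trans.aemeasurable]; simp⟩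

theorem invariant : Kernel.Invariant S.trans S.stat := by
  refine ext_of_integral fun F hF hC => ?_
  rw [S.integral_comp_trans hF 1 hC, S.integral_stat, S.stationary F hF ⟨1, hC⟩,
    S.integral_stat]
  ring

/-- The jump part does not depend on the starting law, so one step shrinks the difference of two
invariant laws, tested on functions bounded by 1, by the factor 1 - p. -/
theorem unique (ν : Measure unitInterval) [IsProbabilityMeasure ν]
    (h : Kernel.Invariant S.trans ν) : ν = S.stat := by
  have key : ∀ (n : ℕ) (F : unitInterval → ℝ), Measurable F → (∀ x, |F x| ≤ 1) →
      |∫ x, F x ∂ν - ∫ x, F x ∂S.stat| ≤ (1 - S.p) ^ n * 2 := by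
    intro n
    induction n with
    | zero =>
      intro F hF hC
      have h1 := abs_integral_le_of_abs_le (μ := ν) hC
      have h2 := abs_integral_le_of_abs_le (μ := S.stat) hC
      rw [pow_zero, one_mul]
      exact (abs_sub _ _).trans (by linarith)
    | succ n ih =>
      intro F hF hC
      have h1 := S.integral_comp_trans hF 1 hC ν
      have h2 := S.integral_comp_trans hF 1 hC S.stat
      rw [h.def] at h1
      rw [S.invariant.def] at h2
      have h3 := ih (fun x => (S.k (S.a x) * F (S.a x) + S.k (S.b x) * F (S.b x)) / 2)
        (by fun_prop) (S.abs_stay_le hC)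
      have h4 : ∫ x, F x ∂ν - ∫ x, F x ∂S.stat = (1 - S.p) *
          (∫ x, (S.k (S.a x) * F (S.a x) + S.k (S.b x) * F (S.b x)) / 2 ∂ν -
            ∫ x, (S.k (S.a x) * F (S.a x) + S.k (S.b x) * F (S.b x)) / 2 ∂S.stat) := by
        linarith
      have h5 : 0 ≤ 1 - S.p := by linarith [S.p_le_one]
      rw [h4, abs_mul, abs_of_nonneg h5, pow_succ', mul_assoc]
      gcongr
  refine ext_of_integral fun F hF hC => ?_
  have hlim : Filter.Tendsto (fun n : ℕ => (1 - S.p) ^ n * 2) Filter.atTop (nhds 0) := by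
    simpa using (tendsto_pow_atTop_nhds_zero_of_lt_one (r := 1 - S.p) (by linarith [S.p_le_one])
      (by linarith [S.p_pos])).mul_const 2
  have := ge_of_tendsto' hlim fun n => key n F hF hC
  exact sub_eq_zero.1 (abs_nonpos_iff.1 this)

/-- The two-point chain as a Markov chain with its unique stationary distribution. -/
def toChain : Chain where
  trans := S.trans
  stat := S.stat
  isMarkovKernel_trans := inferInstance
  isProbabilityMeasure_stat := inferInstance
  invariant := S.invariant
  unique ν _ h := S.unique ν h

/-- The jump part itself is the minorising measure, so the density of ν with respect to the
stationary law is 1. -/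
theorem mixingCondition : MixingCondition S.trans S.stat S.p⁻¹ := by
  refine ⟨S.stat, 0, inferInstance, le_rfl, Measure.AbsolutelyContinuous.rfl, ?_,
    fun x B _ => ?_⟩
  · filter_upwards [Measure.rnDeriv_self S.stat] with x hx
    simp [hx]
  · rw [ENNReal.ofReal_inv_of_pos S.p_pos, div_eq_mul_inv, inv_inv, mul_comm, trans,
      stepKernel_apply, Measure.add_apply]
    exact le_add_self

theorem chiSqDiv_stat_le {c : ℝ} (h : ∫ x, (S.m x - 1) ^ 2 ≤ c) :
    chiSqDiv S.stat volume ≤ ENNReal.ofReal c := by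
  have hac : S.stat ≪ volume := withDensity_absolutelyContinuous _ _
  have hI : Integrable fun x => (S.m x - 1) ^ 2 :=
    integrable_of_abs_le (by fun_prop) 1 fun x => by
      have := S.half_le_m x; have := S.m_le x
      rw [abs_of_nonneg (sq_nonneg _)]; nlinarith
  rw [chiSqDiv, if_pos hac]
  refine le_trans (le_of_eq ?_) (ENNReal.ofReal_le_ofReal h)
  rw [ofReal_integral_eq_lintegral_ofReal hI (ae_of_all _ fun x => sq_nonneg _)]
  refine lintegral_congr_ae ?_
  have := Measure.rnDeriv_withDensity (volume : Measure unitInterval)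
    (f := fun x => ENNReal.ofReal (S.m x)) (by fun_prop)
  filter_upwards [this] with x hx
  rw [stat, hx, ENNReal.toReal_ofReal (S.m_nonneg x)]

end TwoPoint

/-! ### Hellinger affinity of two-point chains -/

theorem le_sqrt_mul_sqrt {s t : ℝ} (hs : 1 / 2 ≤ s) (ht : 1 / 2 ≤ t) :
    (s + t) / 2 - (s - t) ^ 2 / 4 ≤ √s * √t := by
  have h1 := Real.sq_sqrt (show 0 ≤ s by linarith)
  have h2 := Real.sq_sqrt (show 0 ≤ t by linarith)
  set u := √s with hu
  set w := √t with hw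
  have hu0 : 0 ≤ u := Real.sqrt_nonneg _
  have hw0 : 0 ≤ w := Real.sqrt_nonneg _
  have h3 : 1 / 2 ≤ u * w := by
    rw [hu, hw, ← Real.sqrt_mul (by linarith)]
    exact Real.le_sqrt_of_sq_le (by nlinarith)
  -- The gap between the two means is (u - w)²/2, while (s - t)²/4 = (u - w)²(u + w)²/4, so this
  -- bound is exactly what is needed.
  have h4 : 2 ≤ (u + w) ^ 2 := by nlinarith
  rw [← h1, ← h2]
  nlinarith [mul_nonneg (sq_nonneg (u - w)) (sub_nonneg.2 h4)]

namespace TwoPoint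

variable (S T : TwoPoint)

/-- The reference kernel with respect to which the transition kernel has a density. -/
def base : Kernel unitInterval unitInterval :=
  stepKernel S.a S.b S.measurable_a S.measurable_b
    (fun _ => ENNReal.ofReal ((1 - S.p) / 2)) (fun _ => ENNReal.ofReal ((1 - S.p) / 2))
    measurable_const measurable_const (ENNReal.ofReal S.p) volume

instance : IsMarkovKernel S.base := by
  refine isMarkovKernel_stepKernel fun x => ?_
  have h0 := S.stay_nonneg
  rw [← ENNReal.ofReal_add h0 h0, ← ENNReal.ofReal_add (by linarith) S.p_pos.le]
  ring_nf
  simp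

/-- The square root of the initial density. -/
def rootStat (x : unitInterval) : ℝ≥0∞ := ENNReal.ofReal √(S.m x)

open Classical in
/-- The square root of the transition density with respect to the reference kernel. -/
def rootTrans (x y : unitInterval) : ℝ≥0∞ :=
  if y = S.a x ∨ y = S.b x then ENNReal.ofReal √(S.k y) else S.rootStat y

@[fun_prop]
theorem measurable_rootStat : Measurable S.rootStat := by
  unfold rootStat; fun_prop

theorem measurable_rootTrans : Measurable (Function.uncurry S.rootTrans) := by
  have h1 : MeasurableSet {q : unitInterval × unitInterval | q.2 = S.a q.1 ∨ q.2 = S.b q.1} :=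
    (measurableSet_eq_fun (by fun_prop) (by fun_prop)).union
      (measurableSet_eq_fun (by fun_prop) (by fun_prop))
  exact Measurable.ite h1 (by fun_prop) (by fun_prop)

theorem stat_eq : S.stat = volume.withDensity fun x => S.rootStat x ^ 2 := by
  rw [stat]
  congr 1
  funext x
  rw [rootStat, ← ENNReal.ofReal_pow (Real.sqrt_nonneg _), Real.sq_sqrt (S.m_nonneg x)]

/-- Lebesgue measure does not charge the two atoms; hence the atomic and the diffuse part of the
kernel can carry separate densities. -/
theorem rootTrans_ae (x : unitInterval) : ∀ᵐ y : unitInterval, S.rootTrans x y = S.rootStat y := by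
  have h1 : ∀ z : unitInterval, ∀ᵐ y : unitInterval, y ≠ z := fun z => by simp [ae_iff]
  filter_upwards [h1 (S.a x), h1 (S.b x)] with y hy1 hy2
  rw [rootTrans, if_neg (by tauto)]

theorem trans_eq (x : unitInterval) :
    S.trans x = (S.base x).withDensity fun y => S.rootTrans x y ^ 2 := by
  have hm : Measurable fun y => S.rootTrans x y ^ 2 :=
    (S.measurable_rootTrans.comp measurable_prodMk_left).pow_const 2
  have hsq : ∀ {t : ℝ}, 0 ≤ t → ENNReal.ofReal √t ^ 2 = ENNReal.ofReal t := fun ht => by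
    rw [← ENNReal.ofReal_pow (Real.sqrt_nonneg _), Real.sq_sqrt ht]
  refine Measure.ext_of_lintegral _ fun F hF => ?_
  rw [lintegral_withDensity_eq_lintegral_mul _ hm hF, trans, base, lintegral_stepKernel x hF,
    lintegral_stepKernel x (hm.mul hF)]
  simp only [Pi.mul_apply]
  have h1 : S.rootTrans x (S.a x) ^ 2 = ENNReal.ofReal (S.k (S.a x)) := by
    rw [rootTrans, if_pos (Or.inl rfl), hsq (S.k_nonneg _)]
  have h2 : S.rootTrans x (S.b x) ^ 2 = ENNReal.ofReal (S.k (S.b x)) := by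
    rw [rootTrans, if_pos (Or.inr rfl), hsq (S.k_nonneg _)]
  have h3 : ∫⁻ y, S.rootTrans x y ^ 2 * F y = ∫⁻ y, F y ∂S.stat := by
    rw [stat_eq, lintegral_withDensity_eq_lintegral_mul _ (by fun_prop) hF]
    refine lintegral_congr_ae ?_
    filter_upwards [S.rootTrans_ae x] with y hy
    rw [hy]; rfl
  rw [h1, h2, h3, ENNReal.ofReal_mul S.stay_nonneg, ENNReal.ofReal_mul S.stay_nonneg, mul_assoc,
    mul_assoc]

variable {S T}

theorem base_congr (hp : T.p = S.p) (ha : T.a = S.a) (hb : T.b = S.b) : T.base = S.base := by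
  cases S; cases T
  simp only at hp ha hb
  subst hp ha hb
  rfl

theorem integrable_sqrt_mul : Integrable fun x => √(S.m x) * √(T.m x) :=
  integrable_of_abs_le (by fun_prop) (3 / 2) fun x => by
    rw [abs_of_nonneg (by positivity), ← Real.sqrt_mul (S.m_nonneg x)]
    refine Real.sqrt_le_iff.2 ⟨by norm_num, ?_⟩
    nlinarith [S.half_le_m x, T.half_le_m x, S.m_le x, T.m_le x]

theorem integral_sqrt_ge {A : ℝ} (hA : ∫ x, (S.m x - T.m x) ^ 2 ≤ 4 * A) :
    1 - A ≤ ∫ x, √(S.m x) * √(T.m x) := by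
  have hsq : ∀ x, |(S.m x - T.m x) ^ 2| ≤ 1 := fun x => by
    rw [abs_of_nonneg (sq_nonneg _)]
    nlinarith [S.half_le_m x, T.half_le_m x, S.m_le x, T.m_le x]
  have hI : Integrable fun x => (S.m x - T.m x) ^ 2 :=
    integrable_of_abs_le (by fun_prop) 1 hsq
  have hM : Integrable fun x => (S.m x + T.m x) / 2 :=
    (S.integrable_m.add T.integrable_m).div_const 2
  have h1 : ∫ x, ((S.m x + T.m x) / 2 - (S.m x - T.m x) ^ 2 / 4) ≤
      ∫ x, √(S.m x) * √(T.m x) :=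
    integral_mono (hM.sub (hI.div_const 4)) integrable_sqrt_mul
      fun x => le_sqrt_mul_sqrt (S.half_le_m x) (T.half_le_m x)
  rw [integral_sub hM (hI.div_const 4),
    integral_div, integral_div, integral_add S.integrable_m T.integrable_m, S.integral_m,
    T.integral_m] at h1
  linarith

theorem lintegral_rootStat_mul :
    ∫⁻ x, S.rootStat x * T.rootStat x = ENNReal.ofReal (∫ x, √(S.m x) * √(T.m x)) := by
  rw [ofReal_integral_eq_lintegral_ofReal integrable_sqrt_mul (ae_of_all _ fun x => by positivity)]
  refine lintegral_congr fun x => ?_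
  rw [rootStat, rootStat, ENNReal.ofReal_mul (Real.sqrt_nonneg _)]

/-- Trajectories of two nearby two-point chains cannot be told apart. -/
theorem test_error (hp : T.p = S.p) (ha : T.a = S.a) (hb : T.b = S.b) {A K : ℝ} (hA0 : 0 ≤ A)
    (hA : ∫ x, (S.m x - T.m x) ^ 2 ≤ 4 * A)
    (hK : ∫ x, ((S.k (S.a x) - T.k (S.a x)) ^ 2 + (S.k (S.b x) - T.k (S.b x)) ^ 2) ≤ 8 * K)
    (n : ℕ) (hn : A + n * (3 / 2 * K + S.p * A) ≤ 1 / 4) {E : Set (Fin (n + 1) → unitInterval)}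
    (hE : MeasurableSet E) :
    1 / 4 ≤ (trajLaw S.trans S.stat (n + 1)).real Eᶜ + (trajLaw T.trans T.stat (n + 1)).real E := by
  have hstay := S.stay_nonneg
  have hp0 := S.p_pos
  have hkS : ∀ y, S.k (S.a y) ≤ 3 / 2 ∧ S.k (S.b y) ≤ 3 / 2 := fun y => by
    constructor <;> linarith [S.k_add_k y, S.half_le_k (S.a y), S.half_le_k (S.b y)]
  have hkT : ∀ y, T.k (S.a y) + T.k (S.b y) = 2 ∧ T.k (S.a y) ≤ 3 / 2 ∧ T.k (S.b y) ≤ 3 / 2 :=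
    fun y => by
      have h := T.k_add_k y
      rw [ha, hb] at h
      refine ⟨h, ?_, ?_⟩ <;> linarith [T.half_le_k (S.a y), T.half_le_k (S.b y)]
  set g : unitInterval → ℝ := fun x =>
    (S.k (S.a x) - T.k (S.a x)) ^ 2 + (S.k (S.b x) - T.k (S.b x)) ^ 2 with hg
  have hg0 : ∀ x, 0 ≤ g x := fun x => by positivity
  have hgm : Measurable g := by fun_prop
  have hg2 : ∀ x, |g x| ≤ 2 := fun x => by
    rw [abs_of_nonneg (hg0 x)]
    simp only [hg]
    nlinarith [hkS x, hkT x, S.half_le_k (S.a x), S.half_le_k (S.b x), T.half_le_k (S.a x),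
      T.half_le_k (S.b x)]
  have hK0 : 0 ≤ K := by
    have := integral_nonneg (μ := volume) (f := g) hg0
    linarith
  set I := ∫ x, √(S.m x) * √(T.m x) with hI
  have hIA : 1 - A ≤ I := integral_sqrt_ge hA
  have hI0 : 0 ≤ I := integral_nonneg fun x => by positivity
  have hlI : ∫⁻ x, S.rootStat x * T.rootStat x = ENNReal.ofReal I := lintegral_rootStat_mul
  -- One-step deficit: the atoms contribute g/8 with weight 1 - p, the jump contributes A with
  -- weight p. Stationary densities are at most 3/2 and g has integral at most 8K, whence the term
  -- 3K/2 in the bound for its mean.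
  let e : unitInterval → ℝ≥0∞ := fun x => ENNReal.ofReal ((1 - S.p) / 8 * g x + S.p * A)
  have he : Measurable e := by fun_prop
  have hstat : ∀ U : TwoPoint, ∫⁻ x, e x ∂U.stat ≤ ENNReal.ofReal (3 / 2 * K + S.p * A) := by
    intro U
    have hb1 : ∀ x, 0 ≤ (1 - S.p) / 8 * g x + S.p * A := fun x => by
      have := hg0 x; have : 0 ≤ (1 - S.p) / 8 := by linarith
      positivity
    have hgi : ∀ μ : Measure unitInterval, [IsFiniteMeasure μ] → Integrable g μ := fun μ _ =>
      integrable_of_abs_le hgm 2 hg2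
    have hei : Integrable (fun x => (1 - S.p) / 8 * g x + S.p * A) U.stat :=
      ((hgi _).const_mul _).add (integrable_const _)
    rw [← ofReal_integral_eq_lintegral_ofReal hei (ae_of_all _ hb1)]
    refine ENNReal.ofReal_le_ofReal ?_
    rw [integral_add ((hgi _).const_mul _) (integrable_const _), integral_const_mul,
      U.integral_stat]
    have h1 : ∫ x, g x * U.m x ≤ ∫ x, 3 / 2 * g x :=
      integral_mono (U.integrable_mul_m hgm 2 hg2) ((hgi _).const_mul _) fun x => by
        simp only
        nlinarith [hg0 x, U.m_le x]
    rw [integral_const_mul] at h1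
    have h2 : ∫ x, g x * U.m x ≤ 12 * K := by linarith
    have h3 : 0 ≤ ∫ x, g x * U.m x := integral_nonneg fun x => mul_nonneg (hg0 x) (U.m_nonneg x)
    simp only [integral_const, probReal_univ, smul_eq_mul, one_mul]
    nlinarith [S.p_le_one]
  have hstep : ∀ x, 1 ≤ ∫⁻ y, S.rootTrans x y * T.rootTrans x y ∂S.base x + e x := by
    intro x
    have hm1 : Measurable (S.rootTrans x) := S.measurable_rootTrans.comp measurable_prodMk_left
    have hm2 : Measurable (T.rootTrans x) := T.measurable_rootTrans.comp measurable_prodMk_left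
    have h1 : ∀ z, z = S.a x ∨ z = S.b x →
        S.rootTrans x z * T.rootTrans x z = ENNReal.ofReal (√(S.k z) * √(T.k z)) := by
      intro z hz
      rw [rootTrans, rootTrans, if_pos hz, if_pos (by rwa [ha, hb]),
        ENNReal.ofReal_mul (Real.sqrt_nonneg _)]
    have h2 : ∫⁻ y, S.rootTrans x y * T.rootTrans x y = ENNReal.ofReal I := by
      rw [← hlI]
      refine lintegral_congr_ae ?_
      filter_upwards [S.rootTrans_ae x, T.rootTrans_ae x] with y hy1 hy2
      rw [hy1, hy2]
    rw [base, lintegral_stepKernel x (hm1.fun_mul hm2), h1 _ (Or.inl rfl), h1 _ (Or.inr rfl), h2,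
      ← ENNReal.ofReal_mul hstay, ← ENNReal.ofReal_mul hstay, ← ENNReal.ofReal_mul hp0.le,
      ← ENNReal.ofReal_add (by positivity) (by positivity),
      ← ENNReal.ofReal_add (by positivity) (by positivity)]
    refine le_trans ?_ ENNReal.ofReal_add_le
    rw [← ENNReal.ofReal_one]
    refine ENNReal.ofReal_le_ofReal ?_
    have q1 := le_sqrt_mul_sqrt (S.half_le_k (S.a x)) (T.half_le_k (S.a x))
    have q2 := le_sqrt_mul_sqrt (S.half_le_k (S.b x)) (T.half_le_k (S.b x))
    have q3 : 2 - g x / 4 ≤ √(S.k (S.a x)) * √(T.k (S.a x)) + √(S.k (S.b x)) * √(T.k (S.b x)) := by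
      have := S.k_add_k x; have := (hkT x).1
      simp only [hg]; linarith
    nlinarith [mul_le_mul_of_nonneg_left q3 hstay, mul_le_mul_of_nonneg_left hIA hp0.le]
  have hbase : T.base = S.base := base_congr hp ha hb
  have haff := one_le_affinity_add (B := S.base) S.measurable_rootStat S.measurable_rootTrans
    T.measurable_rootStat T.measurable_rootTrans S.stat_eq S.trans_eq T.stat_eq
    (fun x => by rw [← hbase]; exact T.trans_eq x) S.invariant T.invariant
    (h₀ := ENNReal.ofReal A) he (by
      rw [hlI, ← ENNReal.ofReal_add hI0 hA0, ← ENNReal.ofReal_one]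
      exact ENNReal.ofReal_le_ofReal (by linarith)) hstep (hstat S) (hstat T) n
  refine one_le_test_error (measurable_rootDensity S.measurable_rootStat S.measurable_rootTrans n)
    (measurable_rootDensity T.measurable_rootStat T.measurable_rootTrans n)
    (trajLaw_eq_withDensity S.measurable_rootStat S.measurable_rootTrans S.stat_eq S.trans_eq n)
    (trajLaw_eq_withDensity T.measurable_rootStat T.measurable_rootTrans T.stat_eq
      (fun x => by rw [← hbase]; exact T.trans_eq x) n) ?_ hE
  have hq : ENNReal.ofReal A + n * ENNReal.ofReal (3 / 2 * K + S.p * A) ≤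
      ENNReal.ofReal (1 / 4) := by
    rw [← ENNReal.ofReal_natCast, ← ENNReal.ofReal_mul (by positivity),
      ← ENNReal.ofReal_add hA0 (by positivity)]
    exact ENNReal.ofReal_le_ofReal hn
  have h34 : (3 / 4 : ℝ≥0∞) = ENNReal.ofReal (3 / 4) := by
    rw [ENNReal.ofReal_div_of_pos (by norm_num)]; simp
  have h5 : (3 / 4 : ℝ≥0∞) + ENNReal.ofReal (1 / 4) = 1 := by
    rw [h34, ← ENNReal.ofReal_add (by norm_num) (by norm_num)]; norm_num
  have h6 := haff.trans (add_le_add le_rfl hq)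
  rw [← h5] at h6
  exact (ENNReal.add_le_add_iff_right (by finiteness)).1 h6

end TwoPoint

/-! ## Integrals of functions of the leading digits -/

/-- Bounded measurable functions that do not depend on the two leading digits. -/
structure Coarse (G : unitInterval → ℝ) : Prop where
  measurable : Measurable G
  bounded : ∃ C, ∀ x, |G x| ≤ C
  flip : ∀ i < 2, ∀ x, G (flipDigit i x) = G x

namespace Coarse

variable {G G' : unitInterval → ℝ}

theorem const (c : ℝ) : Coarse fun _ => c :=
  ⟨measurable_const, ⟨|c|, fun _ => le_rfl⟩, fun _ _ _ => rfl⟩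

theorem add (h : Coarse G) (h' : Coarse G') : Coarse fun x => G x + G' x := by
  obtain ⟨C, hC⟩ := h.bounded
  obtain ⟨C', hC'⟩ := h'.bounded
  refine ⟨h.measurable.add h'.measurable, ⟨C + C', fun x => ?_⟩, fun i hi x => ?_⟩
  · exact (abs_add_le _ _).trans (add_le_add (hC x) (hC' x))
  · simp only [h.flip i hi, h'.flip i hi]

theorem mul (h : Coarse G) (h' : Coarse G') : Coarse fun x => G x * G' x := by
  obtain ⟨C, hC⟩ := h.bounded
  obtain ⟨C', hC'⟩ := h'.bounded
  refine ⟨h.measurable.mul h'.measurable, ⟨C * C', fun x => ?_⟩, fun i hi x => ?_⟩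
  · rw [abs_mul]
    exact mul_le_mul (hC x) (hC' x) (abs_nonneg _) ((abs_nonneg _).trans (hC x))
  · simp only [h.flip i hi, h'.flip i hi]

theorem sgn_block {m : ℕ} (v : (Fin m → Bool) → Bool) : Coarse fun x => sgn (v (block m x)) :=
  ⟨measurable_comp_block fun ε => sgn (v ε), ⟨1, fun _ => (abs_sgn _).le⟩,
    fun i hi x => by rw [block_flipDigit hi]⟩

theorem integrable (h : Coarse G) : Integrable G := by
  obtain ⟨C, hC⟩ := h.bounded
  exact integrable_of_abs_le h.measurable C hC

theorem integrable_sgn_mul (h : Coarse G) {t : unitInterval → ℝ} (ht : Measurable t)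
    (ht1 : ∀ x, |t x| = 1) : Integrable fun x => t x * G x := by
  obtain ⟨C, hC⟩ := h.bounded
  exact integrable_of_abs_le (ht.mul h.measurable) C fun x => by
    rw [abs_mul, ht1, one_mul]; exact hC x

end Coarse

theorem sgn_digit_flipDigit_self (i : ℕ) (x : unitInterval) :
    sgn (digit i (flipDigit i x)) = -sgn (digit i x) := by
  rw [digit_flipDigit, if_pos rfl, sgn_not]

theorem sgn_digit_flipDigit_of_ne {i j : ℕ} (h : j ≠ i) (x : unitInterval) :
    sgn (digit j (flipDigit i x)) = sgn (digit j x) := by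
  rw [digit_flipDigit, if_neg h]

/-- Flipping the first digit kills the terms odd in s, flipping the second those odd in u. Expanding
in 1, s, u, su evaluates the integrals below against the stationary densities. -/
theorem integral_leading_digits {G₀ G₁ G₂ G₃ : unitInterval → ℝ} (h₀ : Coarse G₀) (h₁ : Coarse G₁)
    (h₂ : Coarse G₂) (h₃ : Coarse G₃) :
    ∫ x, (G₀ x + sgn (digit 0 x) * G₁ x + sgn (digit 1 x) * G₂ x +
      sgn (digit 0 x) * sgn (digit 1 x) * G₃ x) = ∫ x, G₀ x := by
  have m₁ := h₁.measurable
  have m₂ := h₂.measurable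
  have m₃ := h₃.measurable
  have i₁ : Integrable fun x => sgn (digit 0 x) * G₁ x :=
    h₁.integrable_sgn_mul (by fun_prop) fun x => abs_sgn _
  have i₂ : Integrable fun x => sgn (digit 1 x) * G₂ x :=
    h₂.integrable_sgn_mul (by fun_prop) fun x => abs_sgn _
  have i₃ : Integrable fun x => sgn (digit 0 x) * sgn (digit 1 x) * G₃ x :=
    h₃.integrable_sgn_mul (by fun_prop) fun x => by rw [abs_mul, abs_sgn, abs_sgn, one_mul]
  have j₂ : Integrable fun x => G₀ x + sgn (digit 0 x) * G₁ x := h₀.integrable.add i₁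
  have j₃ : Integrable fun x => G₀ x + sgn (digit 0 x) * G₁ x + sgn (digit 1 x) * G₂ x :=
    j₂.add i₂
  rw [integral_add j₃ i₃, integral_add j₂ i₂, integral_add h₀.integrable i₁]
  have e₁ : ∫ x, sgn (digit 0 x) * G₁ x = 0 :=
    integral_eq_zero_of_flipDigit 0 (by fun_prop) fun x => by
      rw [sgn_digit_flipDigit_self, h₁.flip 0 (by norm_num)]; ring
  have e₂ : ∫ x, sgn (digit 1 x) * G₂ x = 0 :=
    integral_eq_zero_of_flipDigit 1 (by fun_prop) fun x => by
      rw [sgn_digit_flipDigit_self, h₂.flip 1 (by norm_num)]; ring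
  have e₃ : ∫ x, sgn (digit 0 x) * sgn (digit 1 x) * G₃ x = 0 :=
    integral_eq_zero_of_flipDigit 0 (by fun_prop) fun x => by
      rw [sgn_digit_flipDigit_self, sgn_digit_flipDigit_of_ne (by norm_num),
        h₃.flip 0 (by norm_num)]
      ring
  rw [e₁, e₂, e₃]; ring

theorem integral_swapDigits {F : unitInterval → ℝ} (hF : Measurable F) :
    ∫ x, F (swapDigits x) = ∫ x, F x := by
  have h : (volume : Measure unitInterval).map swapDigits = volume := by
    refine Measure.ext_of_lintegral _ fun F hF => ?_
    rw [lintegral_map hF measurable_swapDigits, lintegral_swapDigits hF]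
  conv_rhs => rw [← h]
  rw [integral_map measurable_swapDigits.aemeasurable (by rw [h]; exact hF.aestronglyMeasurable)]

/-! ## The two families of chains -/

section Families

variable {d : ℕ} {p η : ℝ}

/-- The chain that keeps all digits but the leading one, whose sign is drawn with a bias that
depends on the block. -/
def biasedChain (hp : 0 < p) (hp1 : p ≤ 1) (hη : 0 ≤ η) (hη4 : η ≤ 1 / 4)
    (v : (Fin d → Bool) → Bool) : TwoPoint where
  p := p
  a := id
  b := flipDigit 0
  k x := 1 + sgn (digit 0 x) * (η * sgn (v (block d x)))
  m x := 1 + sgn (digit 0 x) * (η * sgn (v (block d x)))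
  p_pos := hp
  p_le_one := hp1
  measurable_a := measurable_id
  measurable_b := measurable_flipDigit 0
  measurable_k := by
    have := (Coarse.sgn_block v).measurable
    fun_prop
  measurable_m := by
    have := (Coarse.sgn_block v).measurable
    fun_prop
  half_le_k x := by
    cases digit 0 x <;> cases v (block d x) <;> simp [sgn] <;> linarith
  half_le_m x := by
    cases digit 0 x <;> cases v (block d x) <;> simp [sgn] <;> linarith
  m_le x := by
    cases digit 0 x <;> cases v (block d x) <;> simp [sgn] <;> linarith
  k_add_k x := by
    simp only [id, sgn_digit_flipDigit_self, block_flipDigit (show 0 < 2 by norm_num)]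
    ring
  integral_m := by
    have := integral_leading_digits (Coarse.const 1) ((Coarse.const η).mul (Coarse.sgn_block v))
      (Coarse.const 0) (Coarse.const 0)
    simpa using this
  stationary F hF := by
    rintro ⟨C, hC⟩
    have hv := (Coarse.sgn_block v).measurable
    set m : unitInterval → ℝ := fun x => 1 + sgn (digit 0 x) * (η * sgn (v (block d x))) with hm
    have hmm : Measurable m := by fun_prop
    -- On each pair of flipped points the weights are the conditional law of the stationary density,
    -- so the move resamples the leading digit given the rest.
    have hflip : ∀ x, m x = 2 - m (flipDigit 0 x) := fun x => by
      simp only [hm, sgn_digit_flipDigit_self, block_flipDigit (show 0 < 2 by norm_num)]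
      ring
    have hmb : ∀ x, |m x| ≤ 2 := fun x => by
      rw [abs_le]
      simp only [hm]
      cases digit 0 x <;> cases v (block d x) <;> simp [sgn] <;> constructor <;> linarith
    have hC0 : 0 ≤ C := (abs_nonneg _).trans (hC 0)
    have hb1 : ∀ x, |m x * F x| ≤ 2 * C := fun x => by
      rw [abs_mul]; exact mul_le_mul (hmb x) (hC x) (abs_nonneg _) (by norm_num)
    have i1 : Integrable fun x => m x * F x * m x / 2 :=
      (integrable_of_abs_le (by fun_prop) (2 * C * 2) fun x => by
        rw [abs_mul]; exact mul_le_mul (hb1 x) (hmb x) (abs_nonneg _) (by positivity)).div_const 2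
    have i2 : Integrable fun x => m x * F x * (2 - m x) / 2 :=
      (integrable_of_abs_le (by fun_prop) (2 * C * 4) fun x => by
        rw [abs_mul]
        refine mul_le_mul (hb1 x) ?_ (abs_nonneg _) (by positivity)
        have := abs_le.1 (hmb x)
        rw [abs_le]; constructor <;> linarith).div_const 2
    have i3 : Integrable fun x =>
        m (flipDigit 0 x) * F (flipDigit 0 x) * (2 - m (flipDigit 0 x)) / 2 :=
      (measurePreserving_flipDigit 0).integrable_comp_of_integrable i2
    calc ∫ x, (m (id x) * F (id x) + m (flipDigit 0 x) * F (flipDigit 0 x)) / 2 * m x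
        = ∫ x, (m x * F x * m x / 2 +
            m (flipDigit 0 x) * F (flipDigit 0 x) * (2 - m (flipDigit 0 x)) / 2) := by
          refine integral_congr_ae (ae_of_all _ fun x => ?_)
          simp only [id]
          rw [← hflip x]; ring
      _ = (∫ x, m x * F x * m x / 2) + ∫ x, m x * F x * (2 - m x) / 2 := by
          rw [integral_add i1 i3, integral_flipDigit 0
            (F := fun x => m x * F x * (2 - m x) / 2) (by fun_prop)]
      _ = ∫ x, F x * m x := by
          rw [← integral_add i1 i2]
          refine integral_congr_ae (ae_of_all _ fun x => ?_)
          simp only; ring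

/-- The chain that exchanges the two leading digits; their stationary distribution has a bias that
depends on the block. -/
def swapChain (hp : 0 < p) (hp1 : p ≤ 1) (hη : 0 ≤ η) (hη4 : η ≤ 1 / 4)
    (v : (Fin d → Bool) → Bool) : TwoPoint where
  p := p
  a := swapDigits
  b := swapDigits
  k _ := 1
  m x := 1 + (sgn (digit 0 x) + sgn (digit 1 x)) * (η * sgn (v (block d x)))
  p_pos := hp
  p_le_one := hp1
  measurable_a := measurable_swapDigits
  measurable_b := measurable_swapDigits
  measurable_k := measurable_const
  measurable_m := by
    have := (Coarse.sgn_block v).measurable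
    fun_prop
  half_le_k x := by norm_num
  half_le_m x := by
    cases digit 0 x <;> cases digit 1 x <;> cases v (block d x) <;> simp [sgn] <;> linarith
  m_le x := by
    cases digit 0 x <;> cases digit 1 x <;> cases v (block d x) <;> simp [sgn] <;> linarith
  k_add_k x := by norm_num
  integral_m := by
    have := integral_leading_digits (Coarse.const 1) ((Coarse.const η).mul (Coarse.sgn_block v))
      ((Coarse.const η).mul (Coarse.sgn_block v)) (Coarse.const 0)
    simpa [add_mul, ← add_assoc] using this
  stationary F hF _ := by
    have hv := (Coarse.sgn_block v).measurable
    -- The density is symmetric in the two leading digits, hence preserved by the swap.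
    rw [← integral_swapDigits (F := fun x => F x *
      (1 + (sgn (digit 0 x) + sgn (digit 1 x)) * (η * sgn (v (block d x))))) (by fun_prop)]
    refine integral_congr_ae (ae_of_all _ fun x => ?_)
    simp only [digit_swapDigits_zero, digit_swapDigits_one, block_swapDigits]
    ring

end Families

/-! ## Projections onto the space -/

section Projection

variable {lam : ℕ → ℝ} {hs : Summable lam}

/-- An element of the space whose residual is orthogonal to the space is the projection onto the
closure, since orthogonality passes to the closure. -/
theorem projL2_ae_eq {μ : Measure unitInterval} [IsProbabilityMeasure μ] {V : unitInterval → ℝ}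
    (hV : Measurable V) {C : ℝ} (hC : ∀ x, |V x| ≤ C) (h : WalshSpace lam hs)
    (horth : ∀ g : WalshSpace lam hs, ∫ x, (V x - h x) * g x ∂μ = 0) :
    projL2 (WalshSpace lam hs) μ V =ᵐ[μ] h := by
  have hVm : MemLp V 2 μ := MemLp.of_bound hV.aestronglyMeasurable C (ae_of_all _ hC)
  obtain ⟨C', hC'⟩ := h.abs_apply_le
  have hhm : MemLp h 2 μ :=
    MemLp.of_bound h.measurable_apply.aestronglyMeasurable C' (ae_of_all _ hC')
  rw [projL2, dif_pos hVm]
  have hmem : hhm.toLp h ∈ (rkhsL2 (WalshSpace lam hs) μ).topologicalClosure :=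
    Submodule.le_topologicalClosure _ ⟨h, hhm.coeFn_toLp⟩
  have horth' : hVm.toLp V - hhm.toLp h ∈ (rkhsL2 (WalshSpace lam hs) μ).topologicalClosureᗮ := by
    rw [Submodule.orthogonal_closure, Submodule.mem_orthogonal]
    rintro w ⟨g, hg⟩
    rw [L2.inner_def, ← horth g]
    refine integral_congr_ae ?_
    filter_upwards [hg, Lp.coeFn_sub (hVm.toLp V) (hhm.toLp h), hVm.coeFn_toLp,
      hhm.coeFn_toLp] with x h1 h2 h3 h4
    rw [h1, h2, Pi.sub_apply, h3, h4]
    simp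
  rw [Submodule.eq_starProjection_of_mem_orthogonal hmem horth']
  exact hhm.coeFn_toLp

end Projection

/-! ## Reduction of the minimax risk to testing -/

theorem integral_sq_sgn_block_sub {m : ℕ} (v w : (Fin m → Bool) → Bool) :
    ∫ x, (sgn (v (block m x)) - sgn (w (block m x))) ^ 2 =
      4 * (({ε | v ε ≠ w ε} : Finset (Fin m → Bool)).card : ℝ) / 2 ^ m := by
  rw [integral_comp_block fun ε => (sgn (v ε) - sgn (w ε)) ^ 2]
  have h : ∀ ε, (sgn (v ε) - sgn (w ε)) ^ 2 = if v ε ≠ w ε then 4 else 0 := fun ε => by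
    cases v ε <;> cases w ε <;> norm_num [sgn]
  simp only [h, ← Finset.sum_filter, Finset.sum_const, nsmul_eq_mul]
  ring

theorem integral_sq_sgn_block_sub_update {m : ℕ} (v : (Fin m → Bool) → Bool) (j : Fin m → Bool) :
    ∫ x, (sgn (v (block m x)) - sgn (Function.update v j (!v j) (block m x))) ^ 2 =
      4 / 2 ^ m := by
  rw [integral_sq_sgn_block_sub]
  have : ({ε | v ε ≠ Function.update v j (!v j) ε} : Finset (Fin m → Bool)) = {j} := by
    ext ε
    by_cases h : ε = j
    · subst h; simp
    · simp [h]
  rw [this]; simp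

theorem eLpNorm_two_sq {X : Type*} [MeasurableSpace X] {μ : Measure X} [IsFiniteMeasure μ]
    {f : X → ℝ} (hf : Measurable f) (C : ℝ) (hC : ∀ x, |f x| ≤ C) :
    eLpNorm f 2 μ ^ 2 = ENNReal.ofReal (∫ x, f x ^ 2 ∂μ) := by
  have h0 : 0 ≤ ∫ x, f x ^ 2 ∂μ := integral_nonneg fun x => sq_nonneg _
  rw [MemLp.eLpNorm_eq_integral_rpow_norm (by norm_num) (by norm_num)
    (MemLp.of_bound hf.aestronglyMeasurable C (ae_of_all _ hC)),
    ← ENNReal.ofReal_pow (by positivity)]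
  congr 1
  simp only [ENNReal.toReal_ofNat, Real.rpow_ofNat, Real.norm_eq_abs, sq_abs]
  rw [← Real.rpow_natCast, ← Real.rpow_mul h0]
  norm_num

/-- The density is at least 1/2. Errors measured in the stationary norms of different hypotheses
thus become comparable in one Lebesgue norm. -/
theorem TwoPoint.integral_le_two_mul_integral_stat (S : TwoPoint) {F : unitInterval → ℝ}
    (hF : Measurable F) (C : ℝ) (hC : ∀ x, |F x| ≤ C) (h0 : ∀ x, 0 ≤ F x) :
    ∫ x, F x ≤ 2 * ∫ x, F x ∂S.stat := by
  rw [S.integral_stat, ← integral_const_mul]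
  refine integral_mono (integrable_of_abs_le hF C hC) ((S.integrable_mul_m hF C hC).const_mul 2)
    fun x => ?_
  have := S.half_le_m x
  have := h0 x
  simp only
  nlinarith

/-- Affine sign functions are as far apart as their signs. -/
theorem sq_mul_hamming_le {m : ℕ} (v w : (Fin m → Bool) → Bool) {E κ : ℝ} (hE : 0 ≤ E)
    (hκ : 0 ≤ κ) :
    E ^ 2 * (4 * (({ε | v ε ≠ w ε} : Finset (Fin m → Bool)).card : ℝ) / 2 ^ m) ≤
      ∫ x, (E * (sgn (v (block m x)) - sgn (w (block m x))) +
        κ * ((∫ y, sgn (v (block m y))) - ∫ y, sgn (w (block m y)))) ^ 2 := by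
  have hd : Measurable fun x => sgn (v (block m x)) - sgn (w (block m x)) :=
    measurable_comp_block fun ε => sgn (v ε) - sgn (w ε)
  have hb : ∀ x, |sgn (v (block m x)) - sgn (w (block m x))| ≤ 2 := fun x =>
    (abs_sub _ _).trans (by rw [abs_sgn, abs_sgn]; norm_num)
  have hi : ∀ u : (Fin m → Bool) → Bool, Integrable fun x => sgn (u (block m x)) := fun u =>
    (Coarse.sgn_block u).integrable
  rw [← integral_sq_sgn_block_sub, ← integral_sub (hi v) (hi w)]
  set X : unitInterval → ℝ := fun x => sgn (v (block m x)) - sgn (w (block m x))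
  set c := ∫ x, X x
  have i₁ : Integrable fun x => E ^ 2 * X x ^ 2 :=
    (integrable_of_abs_le (hd.pow_const 2) (2 ^ 2) fun x => by
      rw [abs_pow]; gcongr; exact hb x).const_mul _
  have i₂ : Integrable fun x => 2 * E * κ * c * X x := (integrable_of_abs_le hd 2 hb).const_mul _
  have i₃ : Integrable fun x => E ^ 2 * X x ^ 2 + 2 * E * κ * c * X x := i₁.add i₂
  have : ∫ x, (E * X x + κ * c) ^ 2 =
      ∫ x, (E ^ 2 * X x ^ 2 + 2 * E * κ * c * X x + (κ * c) ^ 2) :=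
    integral_congr_ae (ae_of_all _ fun x => by simp only; ring)
  rw [this, integral_add i₃ (integrable_const _), integral_add i₁ i₂, integral_const_mul,
    integral_const_mul]
  -- Since c is the mean of X, the cross term integrates to 2Eκc²: the constant cannot cancel the
  -- separation of the signs.
  have : 0 ≤ 2 * E * κ * c * c := by
    rw [mul_assoc]; exact mul_nonneg (by positivity) (mul_self_nonneg c)
  have : 0 ≤ (κ * c) ^ 2 := sq_nonneg _
  simp only [integral_const, probReal_univ, one_smul]
  linarith

section Minimax

variable {lam : ℕ → ℝ} {hs : Summable lam} {m : ℕ}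

/-- An estimate with squared error below t for both v and w forces ∫ (h v - h w)² < 8t ≤ E²/4 in
Lebesgue measure, so v and w differ on fewer than 1/16 of the cells. This is the separation that
Assouad's lemma asks for. -/
theorem minimax_lower_bound (S : ((Fin m → Bool) → Bool) → TwoPoint)
    (hp : ∀ v w, (S v).p = (S w).p) (ha : ∀ v w, (S v).a = (S w).a)
    (hb : ∀ v w, (S v).b = (S w).b) {A K : ℝ} (hA0 : 0 ≤ A)
    (hA : ∀ v j, ∫ x, ((S v).m x - (S (Function.update v j (!v j))).m x) ^ 2 ≤ 4 * A)
    (hK : ∀ v j, ∫ x, (((S v).k ((S v).a x) - (S (Function.update v j (!v j))).k ((S v).a x)) ^ 2 +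
      ((S v).k ((S v).b x) - (S (Function.update v j (!v j))).k ((S v).b x)) ^ 2) ≤ 8 * K)
    (n : ℕ) (hn : ∀ v, A + n * (3 / 2 * K + (S v).p * A) ≤ 1 / 4)
    (h : ((Fin m → Bool) → Bool) → WalshSpace lam hs) {α E κ : ℝ} (hE : 0 ≤ E) (hκ : 0 ≤ κ)
    (hh : ∀ v x, h v x =
      α * sgn (digit 0 x) + E * sgn (v (block m x)) + κ * ∫ y, sgn (v (block m y)))
    {r : unitInterval → ℝ} {γ b R σ ρ τ ν t : ℝ}
    (hproj : ∀ v, (S v).toChain.projValue (WalshSpace lam hs) r γ =ᵐ[(S v).stat] h v)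
    (hvalid : ∀ v, (S v).toChain.IsValid (WalshSpace lam hs) r γ b R σ ρ τ ν)
    (ht : 32 * t ≤ E ^ 2) :
    ENNReal.ofReal (1 / 16) ≤
      ⨅ θ : (Fin (n + 1) → unitInterval) → WalshSpace lam hs,
        ⨆ (M : Chain) (_ : M.IsValid (WalshSpace lam hs) r γ b R σ ρ τ ν),
          trajLaw M.trans M.stat (n + 1)
            {ω | ENNReal.ofReal t ≤
              eLpNorm (fun x => θ ω x - M.projValue (WalshSpace lam hs) r γ x) 2 M.stat ^ 2} := by
  refine le_iInf fun θ => ?_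
  suffices hA' : ∀ ω v w, ω ∉ {ω | ENNReal.ofReal t ≤ eLpNorm (fun x => θ ω x -
      (S v).toChain.projValue (WalshSpace lam hs) r γ x) 2 (S v).stat ^ 2} →
      ω ∉ {ω | ENNReal.ofReal t ≤ eLpNorm (fun x => θ ω x -
      (S w).toChain.projValue (WalshSpace lam hs) r γ x) 2 (S w).stat ^ 2} →
      16 * (({ε | v ε ≠ w ε} : Finset (Fin m → Bool)).card : ℝ) ≤
        (Fintype.card (Fin m → Bool) : ℝ) by
    obtain ⟨v, hv⟩ := exists_le_measure_of_test_error
      (fun v => trajLaw (S v).trans (S v).stat (n + 1))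
      (fun v j B hB => by
        convert TwoPoint.test_error (hp _ v) (ha _ v) (hb _ v) hA0 (hA v j) (hK v j) n (hn v) hB)
      _ hA'
    exact hv.trans (le_iSup₂_of_le (S v).toChain (hvalid v) le_rfl)
  intro ω v w hv hw
  have key : ∀ v, ω ∉ {ω | ENNReal.ofReal t ≤ eLpNorm (fun x => θ ω x -
      (S v).toChain.projValue (WalshSpace lam hs) r γ x) 2 (S v).stat ^ 2} →
      (Measurable fun x => θ ω x - h v x) ∧ (∃ C, ∀ x, |θ ω x - h v x| ≤ C) ∧
      ∫ x, (θ ω x - h v x) ^ 2 < 2 * t := by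
    intro v hv
    obtain ⟨C₁, hC₁⟩ := (θ ω).abs_apply_le
    obtain ⟨C₂, hC₂⟩ := (h v).abs_apply_le
    have hm : Measurable fun x => θ ω x - h v x :=
      (θ ω).measurable_apply.sub (h v).measurable_apply
    have hC : ∀ x, |θ ω x - h v x| ≤ C₁ + C₂ := fun x =>
      (abs_sub _ _).trans (add_le_add (hC₁ x) (hC₂ x))
    refine ⟨hm, ⟨_, hC⟩, ?_⟩
    have hcongr : eLpNorm (fun x => θ ω x -
        (S v).toChain.projValue (WalshSpace lam hs) r γ x) 2 (S v).stat =
        eLpNorm (fun x => θ ω x - h v x) 2 (S v).stat := by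
      refine eLpNorm_congr_ae ?_
      filter_upwards [hproj v] with x hx
      rw [hx]
    rw [Set.mem_ofPred_eq, hcongr, eLpNorm_two_sq hm _ hC, not_le, ENNReal.ofReal_lt_ofReal_iff'] at hv
    have := (S v).integral_le_two_mul_integral_stat (F := fun x => (θ ω x - h v x) ^ 2)
      (hm.pow_const 2) ((C₁ + C₂) ^ 2) (fun x => by rw [abs_pow]; gcongr; exact hC x)
      fun x => sq_nonneg _
    linarith [hv.1]
  obtain ⟨mv, ⟨Cv, hCv⟩, iv⟩ := key v hv
  obtain ⟨mw, ⟨Cw, hCw⟩, iw⟩ := key w hw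
  have jv : Integrable fun x => 2 * (θ ω x - h v x) ^ 2 :=
    (integrable_of_abs_le (mv.pow_const 2) (Cv ^ 2)
      fun x => by rw [abs_pow]; gcongr; exact hCv x).const_mul 2
  have jw : Integrable fun x => 2 * (θ ω x - h w x) ^ 2 :=
    (integrable_of_abs_le (mw.pow_const 2) (Cw ^ 2)
      fun x => by rw [abs_pow]; gcongr; exact hCw x).const_mul 2
  have h1 := sq_mul_hamming_le v w hE hκ
  have h2 : ∫ x, (E * (sgn (v (block m x)) - sgn (w (block m x))) +
        κ * ((∫ y, sgn (v (block m y))) - ∫ y, sgn (w (block m y)))) ^ 2 ≤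
      ∫ x, (2 * (θ ω x - h v x) ^ 2 + 2 * (θ ω x - h w x) ^ 2) := by
    refine integral_mono_of_nonneg (ae_of_all _ fun x => sq_nonneg _) (jv.add jw)
      (ae_of_all _ fun x => ?_)
    have : E * (sgn (v (block m x)) - sgn (w (block m x))) +
        κ * ((∫ y, sgn (v (block m y))) - ∫ y, sgn (w (block m y))) =
        (θ ω x - h w x) - (θ ω x - h v x) := by rw [hh, hh]; ring
    simp only [this]
    nlinarith [sq_nonneg ((θ ω x - h w x) + (θ ω x - h v x))]
  rw [integral_add jv jw, integral_const_mul, integral_const_mul] at h2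
  have h3 : (0 : ℝ) < 2 ^ m := by positivity
  have hcard : (Fintype.card (Fin m → Bool) : ℝ) = 2 ^ m := by simp
  rw [hcard]
  by_contra! hlt
  rw [mul_div_assoc'] at h1
  have h4 : E ^ 2 * (4 * (({ε | v ε ≠ w ε} : Finset (Fin m → Bool)).card : ℝ)) <
      E ^ 2 / 4 * 2 ^ m := by
    rw [← div_lt_iff₀ h3]; linarith
  nlinarith [sq_nonneg E]

end Minimax

/-! ### Membership of a two-point chain in the family -/

section Validity

variable {lam : ℕ → ℝ} {hs : Summable lam}

theorem TwoPoint.projValue_ae_eq_and_isValid (S : TwoPoint) {r V : unitInterval → ℝ}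
    {γ b R σ ρ ν C : ℝ} (hr : ∀ x, |r x| / b ≤ R) (hV : valueFunction r S.trans γ = V)
    (hVm : Measurable V) (hC : ∀ x, |V x| ≤ C) (h : WalshSpace lam hs) (hR : ‖h‖ ≤ R)
    (horth : ∀ g : WalshSpace lam hs, ∫ x, (V x - h x) * g x * S.m x = 0)
    (hρ : ∀ x, |V x - h x| ≤ ρ)
    (hvar : ∀ x, ∃ z, ∫ y, (V y - z) ^ 2 ∂S.trans x ≤ σ ^ 2)
    (hν : ∫ x, (S.m x - 1) ^ 2 ≤ ν) :
    S.toChain.projValue (WalshSpace lam hs) r γ =ᵐ[S.stat] h ∧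
      S.toChain.IsValid (WalshSpace lam hs) r γ b R σ ρ S.p⁻¹ ν := by
  have hproj : S.toChain.projValue (WalshSpace lam hs) r γ =ᵐ[S.stat] h := by
    change projL2 (WalshSpace lam hs) S.stat (valueFunction r S.trans γ) =ᵐ[S.stat] h
    rw [hV]
    exact projL2_ae_eq hVm hC h fun g => by rw [S.integral_stat]; exact horth g
  refine ⟨hproj, ⟨h, hproj, hR⟩, hr, ?_, ?_, S.mixingCondition, S.chiSqDiv_stat_le hν⟩
  · change ∫⁻ x, evariance (valueFunction r S.trans γ) (S.trans x) ∂S.stat ≤ _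
    rw [hV]
    calc ∫⁻ x, evariance V (S.trans x) ∂S.stat
        ≤ ∫⁻ _, ENNReal.ofReal (σ ^ 2) ∂S.stat := by
          refine lintegral_mono fun x => ?_
          obtain ⟨z, hz⟩ := hvar x
          exact evariance_le_of_integral_sq_le hVm C hC z _ hz
      _ = ENNReal.ofReal (σ ^ 2) := by simp
  · change eLpNorm (fun x => valueFunction r S.trans γ x -
      S.toChain.projValue (WalshSpace lam hs) r γ x) 2 S.stat ≤ _
    refine (eLpNorm_le_of_ae_bound (C := ρ) ?_).trans (by simp)
    filter_upwards [hproj] with x hx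
    rw [hx, hV]
    exact hρ x

end Validity

/-! ### Lower bounds from the two constructions -/

section Cases

variable {lam : ℕ → ℝ} {hs : Summable lam} {m : ℕ} {γ p η b R σ ρ Λ ν t : ℝ}

theorem abs_integral_sgn_block_le (v : (Fin m → Bool) → Bool) :
    |∫ x, sgn (v (block m x))| ≤ 1 :=
  abs_integral_le_of_abs_le fun _ => (abs_sgn _).le

theorem abs_signFunction_le (v : (Fin m → Bool) → Bool) (α E κ : ℝ) (x : unitInterval) :
    |α * sgn (digit 0 x) + E * sgn (v (block m x)) + κ * ∫ y, sgn (v (block m y))| ≤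
      |α| + |E| + |κ| := by
  refine (abs_add_le _ _).trans (add_le_add ((abs_add_le _ _).trans (add_le_add ?_ ?_)) ?_)
  · rw [abs_mul, abs_sgn, mul_one]
  · rw [abs_mul, abs_sgn, mul_one]
  · rw [abs_mul]
    exact mul_le_of_le_one_right (abs_nonneg _) (abs_integral_sgn_block_le v)

theorem integral_sq_mul_sgn_block_sub_update (η : ℝ) (v : (Fin m → Bool) → Bool)
    (j : Fin m → Bool) : ∫ x, (η * (sgn (v (block m x)) -
      sgn (Function.update v j (!v j) (block m x)))) ^ 2 = 4 * (η ^ 2 / 2 ^ m) := by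
  simp only [mul_pow]
  rw [integral_const_mul, integral_sq_sgn_block_sub_update]
  ring

/-- Without a jump the block is unchanged and only the leading sign is random, which contributes A²;
a jump costs at most 2A² + 8E². -/
theorem integral_sq_trans_biasedChain_le (hp : 0 < p) (hp1 : p ≤ 1) (hη : 0 ≤ η) (hη4 : η ≤ 1 / 4)
    (v : (Fin m → Bool) → Bool) (A E : ℝ) (x : unitInterval) :
    ∫ y, (A * sgn (digit 0 y) + E * (sgn (v (block m y)) - sgn (v (block m x)))) ^ 2
      ∂(biasedChain hp hp1 hη hη4 v).trans x ≤ (1 + p) * A ^ 2 + p * (8 * E ^ 2) := by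
  have hm : Measurable fun y =>
      (A * sgn (digit 0 y) + E * (sgn (v (block m y)) - sgn (v (block m x)))) ^ 2 := by
    have := (Coarse.sgn_block v).measurable
    fun_prop
  have hb : ∀ y, |(A * sgn (digit 0 y) +
      E * (sgn (v (block m y)) - sgn (v (block m x)))) ^ 2| ≤ 2 * A ^ 2 + 8 * E ^ 2 := fun y => by
    rw [abs_of_nonneg (sq_nonneg _)]
    have h1 : (sgn (v (block m y)) - sgn (v (block m x))) ^ 2 ≤ 4 := by
      cases v (block m y) <;> cases v (block m x) <;> norm_num [sgn]
    have h2 := mul_le_mul_of_nonneg_left h1 (sq_nonneg E)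
    have h3 := sgn_mul_self (digit 0 y)
    calc _ ≤ 2 * A ^ 2 * (sgn (digit 0 y) * sgn (digit 0 y)) +
          2 * (E ^ 2 * (sgn (v (block m y)) - sgn (v (block m x))) ^ 2) := by
          linarith [sq_nonneg (A * sgn (digit 0 y) -
            E * (sgn (v (block m y)) - sgn (v (block m x))))]
      _ ≤ _ := by rw [h3]; linarith
  have h3 := mul_le_mul_of_nonneg_left (abs_le.1 (abs_integral_le_of_abs_le
    (μ := (biasedChain hp hp1 hη hη4 v).stat) hb)).2 hp.le
  rw [TwoPoint.integral_trans _ x hm _ hb]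
  refine (add_le_add_right h3 _).trans (le_of_eq ?_)
  simp only [biasedChain, id, sgn_digit_flipDigit_self,
    block_flipDigit (show 0 < 2 by norm_num)]
  linear_combination (1 - p) * A ^ 2 * sgn_mul_self (digit 0 x)

/-- The value function is A s + E f + κc with c = ∫f. `hE'` and `hκ'` are the Bellman equation for
the coefficients of f and c: a step without a jump has mean (E + Aη)f + κc, a jump has mean (E + κ +
Aη)c. The value function lies in the space, so there is no misspecification. -/
theorem minimax_lower_bound_of_biasedChain (hγ0 : 0 ≤ γ) (hγ1 : γ < 1) (hp : 0 < p) (hp1 : p ≤ 1)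
    (hη : 0 ≤ η) (hη4 : η ≤ 1 / 4) (hΛ : 0 < Λ) (hlam : ∀ j ∈ blockIndices m, Λ ≤ lam j)
    (h1 : 0 < lam 1) {A E κ : ℝ} (hA : 0 ≤ A) (hE : 0 ≤ E) (hκ : 0 ≤ κ)
    (hE' : E = γ * (1 - p) * (E + A * η)) (hκ' : κ = γ * ((1 - p) * κ + p * (E + κ + A * η)))
    (hR0 : 0 ≤ R) (hR : A ^ 2 / lam 1 + (E + κ) ^ 2 / Λ ≤ R ^ 2) (hr : A / b ≤ R)
    (hσ : (1 + p) * A ^ 2 + p * (8 * E ^ 2) ≤ σ ^ 2) (hρ : 0 ≤ ρ) (hν : η ^ 2 ≤ ν) (n : ℕ)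
    (hn : η ^ 2 / 2 ^ m + n * (3 / 2 * (η ^ 2 / 2 ^ m) + p * (η ^ 2 / 2 ^ m)) ≤ 1 / 4)
    (ht : 32 * t ≤ E ^ 2) :
    ∃ r : WalshSpace lam hs, ENNReal.ofReal (1 / 16) ≤
      ⨅ θ : (Fin (n + 1) → unitInterval) → WalshSpace lam hs,
        ⨆ (M : Chain) (_ : M.IsValid (WalshSpace lam hs) r γ b R σ ρ p⁻¹ ν),
          trajLaw M.trans M.stat (n + 1)
            {ω | ENNReal.ofReal t ≤
              eLpNorm (fun x => θ ω x - M.projValue (WalshSpace lam hs) r γ x) 2 M.stat ^ 2} := by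
  choose h hh hnorm using fun v =>
    WalshSpace.exists_signFunction (hs := hs) hΛ hlam h1 v A E κ hE hκ
  obtain ⟨r, hr', -⟩ :=
    WalshSpace.exists_signFunction (hs := hs) hΛ hlam h1 (fun _ => true) A 0 0 le_rfl le_rfl
  have hrx : ∀ x, r x = A * sgn (digit 0 x) := fun x => by rw [hr']; ring
  refine ⟨r, ?_⟩
  have habs : ∀ x, |r x| = A := fun x => by
    rw [hrx, abs_mul, abs_sgn, mul_one, abs_of_nonneg hA]
  have hhb : ∀ v x, |h v x| ≤ |A| + |E| + |κ| := fun v x => by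
    rw [hh]; exact abs_signFunction_le v A E κ x
  have hstay : ∀ v x, ∫ y, h v y ∂(biasedChain hp hp1 hη hη4 v).trans x =
      (1 - p) * ((E + A * η) * sgn (v (block m x)) + κ * ∫ y, sgn (v (block m y))) +
        p * ((E + κ + A * η) * ∫ y, sgn (v (block m y))) := by
    intro v x
    have h2 : ∫ y, h v y ∂(biasedChain hp hp1 hη hη4 v).stat =
        (E + κ + A * η) * ∫ y, sgn (v (block m y)) := by
      set c := ∫ y, sgn (v (block m y)) with hc
      rw [TwoPoint.integral_stat]
      have h3 := integral_leading_digits (((Coarse.const (E + A * η)).mul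
        (Coarse.sgn_block v)).add (Coarse.const (κ * c))) ((Coarse.const A).add
        (((Coarse.const (E * η)).add ((Coarse.const (κ * c * η)).mul (Coarse.sgn_block v)))))
        (Coarse.const 0) (Coarse.const 0)
      rw [integral_add ((Coarse.const (E + A * η)).mul (Coarse.sgn_block v)).integrable
        (Coarse.const (κ * c)).integrable, integral_const_mul, ← hc] at h3
      rw [show (E + κ + A * η) * c = (E + A * η) * c + κ * c by ring]
      simp only [integral_const, probReal_univ, one_smul] at h3
      rw [← h3]
      refine integral_congr_ae (ae_of_all _ fun y => ?_)
      simp only [hh, ← hc, biasedChain]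
      linear_combination (sgn (v (block m y)) * A * η) * sgn_mul_self (digit 0 y) +
        (sgn (digit 0 y) * E * η) * sgn_mul_self (v (block m y))
    rw [TwoPoint.integral_trans _ x (h v).measurable_apply _ (hhb v), h2]
    simp only [biasedChain, id, hh, sgn_digit_flipDigit_self,
      block_flipDigit (show 0 < 2 by norm_num)]
    linear_combination (1 - p) * (sgn (v (block m x)) * A * η) * sgn_mul_self (digit 0 x)
  have hV : ∀ v, valueFunction r (biasedChain hp hp1 hη hη4 v).trans γ = h v := fun v =>
    funext <| valueFunction_eq hγ0 hγ1 (h v).measurable_apply (fun x => (habs x).le) (hhb v)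
      fun x => by
        rw [hstay, hrx, hh]
        linear_combination (sgn (v (block m x))) * hE' + (∫ y, sgn (v (block m y))) * hκ'
  have hvar : ∀ v x, ∃ z, ∫ y, (h v y - z) ^ 2 ∂(biasedChain hp hp1 hη hη4 v).trans x ≤ σ ^ 2 := by
    intro v x
    -- The centre is the value without its s-term, which is unchanged unless the chain jumps.
    refine ⟨E * sgn (v (block m x)) + κ * ∫ y, sgn (v (block m y)), ?_⟩
    refine le_trans (le_of_eq_of_le ?_ (integral_sq_trans_biasedChain_le hp hp1 hη hη4 v A E x)) hσ
    refine integral_congr_ae (ae_of_all _ fun y => ?_)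
    simp only [hh]
    ring
  have hchi : ∀ v, ∫ x, ((biasedChain hp hp1 hη hη4 v).m x - 1) ^ 2 ≤ ν := fun v =>
    (abs_le.1 (abs_integral_le_of_abs_le fun x => by
      rw [abs_of_nonneg (sq_nonneg _)]
      refine le_trans (le_of_eq ?_) hν
      simp only [biasedChain]
      linear_combination η ^ 2 * (sgn (v (block m x)) * sgn (v (block m x))) *
        sgn_mul_self (digit 0 x) + η ^ 2 * sgn_mul_self (v (block m x)))).2
  have hboth := fun v => (biasedChain hp hp1 hη hη4 v).projValue_ae_eq_and_isValid (b := b) (R := R)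
    (ρ := ρ) (fun x => by rw [habs]; exact hr) (hV v) (h v).measurable_apply (hhb v) (h v)
    (abs_le_of_sq_le_sq' ((hnorm v).trans hR) hR0).2 (fun g => by simp)
    (fun x => by simpa using hρ) (hvar v) (hchi v)
  refine minimax_lower_bound (biasedChain hp hp1 hη hη4) (fun _ _ => rfl) (fun _ _ => rfl)
    (fun _ _ => rfl) (A := η ^ 2 / 2 ^ m) (K := η ^ 2 / 2 ^ m) (by positivity) (fun v j => ?_)
    (fun v j => ?_) n (fun v => hn) h hE hκ hh (fun v => (hboth v).1) (fun v => (hboth v).2) ht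
  · rw [← integral_sq_mul_sgn_block_sub_update η v j]
    refine le_of_eq (integral_congr_ae (ae_of_all _ fun x => ?_))
    simp only [biasedChain]
    linear_combination (η * (sgn (v (block m x)) -
      sgn (Function.update v j (!v j) (block m x)))) ^ 2 * sgn_mul_self (digit 0 x)
  · rw [show 8 * (η ^ 2 / 2 ^ m) = 2 * (4 * (η ^ 2 / 2 ^ m)) by ring,
      ← integral_sq_mul_sgn_block_sub_update η v j,
      ← integral_const_mul]
    refine le_of_eq (integral_congr_ae (ae_of_all _ fun x => ?_))
    simp only [biasedChain, id, sgn_digit_flipDigit_self,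
      block_flipDigit (show 0 < 2 by norm_num)]
    linear_combination 2 * (η * (sgn (v (block m x)) -
      sgn (Function.update v j (!v j) (block m x)))) ^ 2 * sgn_mul_self (digit 0 x)

/-- The value function is A s + B u + κc. The swap turns s into u, so the u-coefficient of the
Bellman equation is `hB'`, and the reward (A - γ(1-p)B)s balances the s-coefficient. All dependence
on v beyond a constant enters through the projection. -/
theorem minimax_lower_bound_of_swapChain (hγ0 : 0 ≤ γ) (hγ1 : γ < 1) (hp : 0 < p) (hp1 : p ≤ 1)
    (hη : 0 ≤ η) (hη4 : η ≤ 1 / 4) (hΛ : 0 < Λ) (hlam : ∀ j ∈ blockIndices m, Λ ≤ lam j)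
    (h1 : 0 < lam 1) {A B E κ : ℝ} (hA : 0 ≤ A) (hB : 0 ≤ B) (hE : 0 ≤ E) (hκ : 0 ≤ κ)
    (hB' : B = γ * (1 - p) * A) (hE' : E * (1 - η ^ 2) = B * η)
    (hκ' : κ = γ * ((1 - p) * κ + p * (κ + (A + B) * η)))
    (hR0 : 0 ≤ R) (hR : (A - E * η) ^ 2 / lam 1 + (E + κ) ^ 2 / Λ ≤ R ^ 2) (hb : 0 ≤ b)
    (hr : A / b ≤ R) (hσ : p * (2 * (A + B)) ^ 2 ≤ σ ^ 2) (hρ : E * η + B + E ≤ ρ)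
    (hν : 4 * η ^ 2 ≤ ν) (n : ℕ)
    (hn : 2 * (η ^ 2 / 2 ^ m) + n * (p * (2 * (η ^ 2 / 2 ^ m))) ≤ 1 / 4)
    (ht : 32 * t ≤ E ^ 2) :
    ∃ r : WalshSpace lam hs, ENNReal.ofReal (1 / 16) ≤
      ⨅ θ : (Fin (n + 1) → unitInterval) → WalshSpace lam hs,
        ⨆ (M : Chain) (_ : M.IsValid (WalshSpace lam hs) r γ b R σ ρ p⁻¹ ν),
          trajLaw M.trans M.stat (n + 1)
            {ω | ENNReal.ofReal t ≤
              eLpNorm (fun x => θ ω x - M.projValue (WalshSpace lam hs) r γ x) 2 M.stat ^ 2} := by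
  choose h hh hnorm using fun v =>
    WalshSpace.exists_signFunction (hs := hs) hΛ hlam h1 v (A - E * η) E κ hE hκ
  obtain ⟨r, hr', -⟩ := WalshSpace.exists_signFunction (hs := hs) hΛ hlam h1 (fun _ => true)
    (A - γ * (1 - p) * B) 0 0 le_rfl le_rfl
  have hrx : ∀ x, r x = (A - γ * (1 - p) * B) * sgn (digit 0 x) := fun x => by rw [hr']; ring
  refine ⟨r, ?_⟩
  have hp0 : 0 ≤ 1 - p := by linarith
  have hq0 : 0 ≤ γ * (1 - p) := by positivity
  have hq1 : γ * (1 - p) ≤ 1 := mul_le_one₀ hγ1.le hp0 (by linarith)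
  have hBA : B ≤ A := by rw [hB']; exact mul_le_of_le_one_left hA hq1
  have habs : ∀ x, |r x| ≤ A := fun x => by
    rw [hrx, abs_mul, abs_sgn, mul_one, abs_le]
    have := mul_nonneg hq0 hB
    have := mul_le_of_le_one_left hB hq1
    constructor <;> linarith
  set V : ((Fin m → Bool) → Bool) → unitInterval → ℝ := fun v x =>
    A * sgn (digit 0 x) + B * sgn (digit 1 x) + κ * ∫ y, sgn (v (block m y)) with hVdef
  have hVm : ∀ v, Measurable (V v) := fun v => by fun_prop
  have hVb' : ∀ x, |A * sgn (digit 0 x) + B * sgn (digit 1 x)| ≤ A + B := fun x => by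
    refine (abs_add_le _ _).trans (le_of_eq ?_)
    rw [abs_mul, abs_mul, abs_sgn, abs_sgn, abs_of_nonneg hA, abs_of_nonneg hB]; ring
  have hVb : ∀ v x, |V v x| ≤ A + B + κ := fun v x => by
    refine (abs_add_le _ _).trans (add_le_add (hVb' x) ?_)
    rw [abs_mul, abs_of_nonneg hκ]
    exact mul_le_of_le_one_right hκ (abs_integral_sgn_block_le v)
  have hstay : ∀ v x, ∫ y, V v y ∂(swapChain hp hp1 hη hη4 v).trans x =
      (1 - p) * (A * sgn (digit 1 x) + B * sgn (digit 0 x) + κ * ∫ y, sgn (v (block m y))) +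
        p * ((κ + (A + B) * η) * ∫ y, sgn (v (block m y))) := by
    intro v x
    have h2 : ∫ y, V v y ∂(swapChain hp hp1 hη hη4 v).stat =
        (κ + (A + B) * η) * ∫ y, sgn (v (block m y)) := by
      simp only [hVdef]
      set c := ∫ y, sgn (v (block m y)) with hc
      rw [TwoPoint.integral_stat]
      have h3 := integral_leading_digits (((Coarse.const ((A + B) * η)).mul
        (Coarse.sgn_block v)).add (Coarse.const (κ * c))) ((Coarse.const A).add
        ((Coarse.const (κ * c * η)).mul (Coarse.sgn_block v)))
        ((Coarse.const B).add ((Coarse.const (κ * c * η)).mul (Coarse.sgn_block v)))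
        ((Coarse.const ((A + B) * η)).mul (Coarse.sgn_block v))
      rw [integral_add ((Coarse.const ((A + B) * η)).mul (Coarse.sgn_block v)).integrable
        (Coarse.const (κ * c)).integrable, integral_const_mul, ← hc] at h3
      rw [show (κ + (A + B) * η) * c = (A + B) * η * c + κ * c by ring]
      simp only [integral_const, probReal_univ, one_smul] at h3
      rw [← h3]
      refine integral_congr_ae (ae_of_all _ fun y => ?_)
      simp only [swapChain]
      linear_combination (sgn (v (block m y)) * A * η) * sgn_mul_self (digit 0 y) +
        (sgn (v (block m y)) * B * η) * sgn_mul_self (digit 1 y)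
    rw [TwoPoint.integral_trans _ x (hVm v) _ (hVb v), h2]
    simp only [swapChain, hVdef, digit_swapDigits_zero, digit_swapDigits_one]
    ring
  have hV : ∀ v, valueFunction r (swapChain hp hp1 hη hη4 v).trans γ = V v := fun v =>
    funext <| valueFunction_eq hγ0 hγ1 (hVm v) habs (hVb v) fun x => by
      rw [hstay, hrx]
      simp only [hVdef]
      linear_combination (∫ y, sgn (v (block m y))) * hκ' + sgn (digit 1 x) * hB'
  -- The residual is Eηs + Bu - Ef. Weighted by 1 + (s+u)ηf and averaged over the two leading digits
  -- it gives f(Eη² + Bη - E), zero by `hE'`; multiplied by s as well it gives Eη - Eη. An element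
  -- of the space is a multiple of s plus a coarse function, so nothing else is to be tested.
  have horth : ∀ v (g : WalshSpace lam hs),
      ∫ x, (V v x - h v x) * g x * (swapChain hp hp1 hη hη4 v).m x = 0 := by
    intro v g
    obtain ⟨c, k, hk, hkb, hkf, hg⟩ := g.exists_decomposition
    have hk' : Coarse k := ⟨hk, hkb, hkf⟩
    have h3 := integral_leading_digits (Coarse.const 0) (Coarse.const 0)
      (((Coarse.const (B - E * η)).mul hk').add
        ((Coarse.const (c * (E * η ^ 2 + B * η))).mul (Coarse.sgn_block v)))
      (((Coarse.const (E * η ^ 2 + B * η)).mul ((Coarse.sgn_block v).mul hk')).add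
        (Coarse.const (c * (B - E * η))))
    rw [integral_zero] at h3
    rw [← h3]
    refine integral_congr_ae (ae_of_all _ fun x => ?_)
    simp only [swapChain, hVdef, hh, hg]
    set f := sgn (v (block m x))
    set s := sgn (digit 0 x)
    set u := sgn (digit 1 x)
    linear_combination ((c * s + k x) * f * (E * η ^ 2) + c * (E * η ^ 2 + B * η) * u * f) *
      sgn_mul_self (digit 0 x) + (c * s + k x) * f * (B * η) * sgn_mul_self (digit 1 x) -
      (c * s + k x) * (E * η) * (s + u) * sgn_mul_self (v (block m x)) - (c * s + k x) * f * hE'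
  have hmis : ∀ v x, |V v x - h v x| ≤ ρ := fun v x => by
    rw [hh]
    simp only [hVdef]
    refine le_trans ?_ hρ
    have hEη : 0 ≤ E * η := by positivity
    rw [show A * sgn (digit 0 x) + B * sgn (digit 1 x) + κ * (∫ y, sgn (v (block m y))) -
      ((A - E * η) * sgn (digit 0 x) + E * sgn (v (block m x)) +
        κ * ∫ y, sgn (v (block m y))) = E * η * sgn (digit 0 x) + B * sgn (digit 1 x) +
      -(E * sgn (v (block m x))) by ring]
    refine (abs_add_le _ _).trans (add_le_add ((abs_add_le _ _).trans (add_le_add ?_ ?_)) ?_)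
    · rw [abs_mul, abs_sgn, mul_one, abs_of_nonneg hEη]
    · rw [abs_mul, abs_sgn, mul_one, abs_of_nonneg hB]
    · rw [abs_neg, abs_mul, abs_sgn, mul_one, abs_of_nonneg hE]
  have hvar : ∀ v x, ∃ z, ∫ y, (V v y - z) ^ 2 ∂(swapChain hp hp1 hη hη4 v).trans x ≤ σ ^ 2 := by
    intro v x
    -- The move is deterministic unless the chain jumps, so about this centre only the jump
    -- contributes.
    refine ⟨V v (swapDigits x), ?_⟩
    have hm : Measurable fun y => (V v y - V v (swapDigits x)) ^ 2 :=
      ((hVm v).sub_const _).pow_const 2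
    have hb : ∀ y, |(V v y - V v (swapDigits x)) ^ 2| ≤ (2 * (A + B)) ^ 2 := fun y => by
      rw [abs_pow]
      gcongr
      have h1 := abs_le.1 (hVb' y)
      have h2 := abs_le.1 (hVb' (swapDigits x))
      simp only [hVdef]
      rw [abs_le]
      constructor <;> linarith
    have h3 := mul_le_mul_of_nonneg_left (abs_le.1 (abs_integral_le_of_abs_le
      (μ := (swapChain hp hp1 hη hη4 v).stat) hb)).2 hp.le
    rw [TwoPoint.integral_trans _ x hm _ hb]
    refine (add_le_add_right h3 _).trans (le_trans (le_of_eq ?_) hσ)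
    simp only [swapChain]
    ring
  have hchi : ∀ v, ∫ x, ((swapChain hp hp1 hη hη4 v).m x - 1) ^ 2 ≤ ν := fun v =>
    (abs_le.1 (abs_integral_le_of_abs_le fun x => by
      rw [abs_of_nonneg (sq_nonneg _)]
      refine le_trans ?_ hν
      simp only [swapChain]
      have hf : (η * sgn (v (block m x))) ^ 2 = η ^ 2 := by
        linear_combination η ^ 2 * sgn_mul_self (v (block m x))
      have h2 : (sgn (digit 0 x) + sgn (digit 1 x)) ^ 2 ≤ 4 := by
        cases digit 0 x <;> cases digit 1 x <;> norm_num [sgn]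
      rw [add_sub_cancel_left, mul_pow, hf]
      exact mul_le_mul_of_nonneg_right h2 (sq_nonneg η))).2
  have hboth := fun v => (swapChain hp hp1 hη hη4 v).projValue_ae_eq_and_isValid (b := b) (R := R)
    (fun x => (div_le_div_of_nonneg_right (habs x) hb).trans hr) (hV v) (hVm v) (hVb v) (h v)
    (abs_le_of_sq_le_sq' ((hnorm v).trans hR) hR0).2 (horth v) (hmis v) (hvar v) (hchi v)
  -- K = 0, because the moves without a jump do not depend on v.
  refine minimax_lower_bound (swapChain hp hp1 hη hη4) (fun _ _ => rfl) (fun _ _ => rfl)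
    (fun _ _ => rfl) (A := 2 * (η ^ 2 / 2 ^ m)) (K := 0) (by positivity) (fun v j => ?_)
    (fun v j => by simp [swapChain]) n
    (fun v => by simpa [swapChain] using hn) h hE hκ hh (fun v => (hboth v).1)
    (fun v => (hboth v).2) ht
  have hf : Coarse fun x => 2 * (η * (sgn (v (block m x)) -
      sgn (Function.update v j (!v j) (block m x)))) ^ 2 := by
    simp only [pow_two]
    have : Coarse fun x => η * (sgn (v (block m x)) -
        sgn (Function.update v j (!v j) (block m x))) := by
      have := (Coarse.const η).mul ((Coarse.sgn_block v).add
        ((Coarse.const (-1)).mul (Coarse.sgn_block (Function.update v j (!v j)))))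
      simpa only [neg_one_mul, ← sub_eq_add_neg] using this
    exact (Coarse.const 2).mul (this.mul this)
  -- Here (s + u)² = 2 + 2su, and the su term integrates to zero.
  have h4 := integral_leading_digits hf (Coarse.const 0) (Coarse.const 0) hf
  rw [integral_const_mul, integral_sq_mul_sgn_block_sub_update] at h4
  refine le_of_eq (Eq.trans ?_ (h4.trans (by ring)))
  refine integral_congr_ae (ae_of_all _ fun x => ?_)
  simp only [swapChain]
  linear_combination (η * (sgn (v (block m x)) -
      sgn (Function.update v j (!v j) (block m x)))) ^ 2 *
    (sgn_mul_self (digit 0 x) + sgn_mul_self (digit 1 x))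

end Cases

/-! ### Choice of the parameters -/

section Tuning

variable {lam : ℕ → ℝ} {hs : Summable lam} {m : ℕ} {γ b R σ ρ τ δ ζ t : ℝ}

/-- With p = 1/τ ≤ 1 - γ and q = γ(1-p), jumping shortens the horizon by at most a factor 2. The
bound q ≥ γ² is the origin of γ⁴ in the final rate. -/
theorem jump_probability_bounds (hγ0 : 0 < γ) (hγ1 : γ < 1) (hτ : (1 - γ)⁻¹ ≤ τ) :
    0 < τ⁻¹ ∧ τ⁻¹ ≤ 1 ∧ τ⁻¹ ≤ 1 - γ ∧ γ ^ 2 ≤ γ * (1 - τ⁻¹) ∧ γ * (1 - τ⁻¹) ≤ 1 - τ⁻¹ ∧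
      1 - γ * (1 - τ⁻¹) ≤ 2 * (1 - γ) := by
  have hg : 0 < 1 - γ := by linarith
  have hτ0 : 0 < τ := (inv_pos.2 hg).trans_le hτ
  have hpg : τ⁻¹ ≤ 1 - γ := inv_le_of_inv_le₀ hg hτ
  have hp : 0 < τ⁻¹ := inv_pos.2 hτ0
  have h1 : γ * τ⁻¹ ≤ 1 * τ⁻¹ := mul_le_mul_of_nonneg_right hγ1.le hp.le
  have h2 : γ * γ ≤ γ * (1 - τ⁻¹) := mul_le_mul_of_nonneg_left (by linarith) hγ0.le
  have h3 : γ * (1 - τ⁻¹) ≤ 1 * (1 - τ⁻¹) := mul_le_mul_of_nonneg_right hγ1.le (by linarith)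
  refine ⟨hp, by linarith, hpg, by rw [pow_two]; exact h2, by rwa [one_mul] at h3, by linarith⟩

/-- The lower bound from the chains that differ in their transitions. -/
theorem minimax_lower_bound_of_variance (hγ0 : 0 < γ) (hγ1 : γ < 1) (hτ : (1 - γ)⁻¹ ≤ τ)
    (hσ : 0 < σ) (hρ : 0 ≤ ρ) (hR0 : 0 ≤ R) (hδ : 0 < δ) (hζ : 0 < ζ)
    (hσζ : (1 - γ)⁻¹ * σ ≤ ζ) (hζσ : ζ ≤ 2 * ((1 - γ)⁻¹ * σ))
    (hlam : ∀ j ∈ blockIndices m, δ ^ 2 ≤ lam j) (h1 : 0 < lam 1)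
    (hR : 4 * (σ + ρ) ^ 2 ≤ R ^ 2 * lam 1) (hb : (σ + ρ) / b ≤ R) (hb0 : 0 < b) (n : ℕ)
    (hdim : 4 * ζ ^ 2 * 2 ^ m ≤ (n + 1) * (R ^ 2 * δ ^ 2)) (hn : 4 * τ * 2 ^ m ≤ n + 1)
    (ht : 32 * 25600 * ((n + 1) * t) ≤ γ ^ 4 * (ζ ^ 2 * 2 ^ m)) :
    ∃ r : WalshSpace lam hs, ENNReal.ofReal (1 / 16) ≤
      ⨅ θ : (Fin (n + 1) → unitInterval) → WalshSpace lam hs,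
        ⨆ (M : Chain) (_ : M.IsValid (WalshSpace lam hs) r γ b R σ ρ τ
            (τ * R ^ 2 * δ ^ 2 / (400 * ζ ^ 2))),
          trajLaw M.trans M.stat (n + 1)
            {ω | ENNReal.ofReal t ≤
              eLpNorm (fun x => θ ω x - M.projValue (WalshSpace lam hs) r γ x) 2 M.stat ^ 2} := by
  have hg : 0 < 1 - γ := by linarith
  set L := (1 - γ)⁻¹ with hL
  have hLg : L * (1 - γ) = 1 := inv_mul_cancel₀ hg.ne'
  have hL1 : 1 ≤ L := (one_le_inv₀ hg).2 (by linarith)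
  have hτ0 : 0 < τ := by linarith
  obtain ⟨hp0, hp1, hpg, hqγ, hqp, hqg⟩ := jump_probability_bounds hγ0 hγ1 hτ
  obtain ⟨p, hp⟩ : ∃ p, p = τ⁻¹ := ⟨_, rfl⟩
  have hpτ : p * τ = 1 := by rw [hp]; exact inv_mul_cancel₀ hτ0.ne'
  obtain ⟨q, hq⟩ : ∃ q, q = γ * (1 - p) := ⟨_, rfl⟩
  rw [← hp] at hp0 hp1 hpg hqγ hqp hqg
  rw [← hq] at hqγ hqp hqg
  have hq0 : 0 ≤ q := (sq_nonneg γ).trans hqγ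
  have hq1 : 0 < 1 - q := by linarith
  set N : ℝ := (n : ℝ) + 1 with hN
  have hN0 : 0 < N := by positivity
  set D : ℝ := 2 ^ m with hD
  have hD1 : 1 ≤ D := one_le_pow₀ (by norm_num)
  have hD0 : 0 < D := by linarith
  -- A neighbouring hypothesis changes one of D cells, so each of the N observations costs about
  -- η²/D of affinity; this choice keeps the total bounded.
  obtain ⟨η, hη⟩ : ∃ η, η = √(D / N) / 20 := ⟨_, rfl⟩
  have hη0 : 0 ≤ η := by rw [hη]; positivity
  have hη2 : η ^ 2 = D / N / 400 := by rw [hη, div_pow, Real.sq_sqrt (by positivity)]; norm_num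
  have hDN : τ * (D / N) ≤ 1 / 4 := by
    rw [mul_div_assoc', div_le_iff₀ hN0]; linarith
  have hDN0 : 0 ≤ D / N := by positivity
  have hDN1 : D / N ≤ 1 / 4 := (le_mul_of_one_le_left hDN0 (by linarith)).trans hDN
  have hη4 : η ≤ 1 / 4 := abs_le_of_sq_le_sq' (by rw [hη2]; linarith) (by norm_num) |>.2
  -- The solution of E = q(E + Aη) with A = σ/2.
  obtain ⟨E, hE⟩ : ∃ E, E = q * (σ / 2 * η) / (1 - q) := ⟨_, rfl⟩
  have hE' : E * (1 - q) = q * (σ / 2 * η) := by rw [hE]; field_simp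
  have hE0 : 0 ≤ E := by rw [hE]; positivity
  obtain ⟨κ, hκ⟩ : ∃ κ, κ = γ * p * (E + σ / 2 * η) * L := ⟨_, rfl⟩
  have hκ' : κ * (1 - γ) = γ * p * (E + σ / 2 * η) := by
    rw [hκ, mul_assoc, hLg, mul_one]
  have hκ0 : 0 ≤ κ := by rw [hκ]; positivity
  -- Adding the two Bellman equations eliminates p: a jump preserves the stationary mean. This sum
  -- controls the RKHS norm.
  have hsum : E + κ = γ * (σ / 2 * η) * L := by
    have : (E + κ) * (1 - γ) = γ * (σ / 2 * η) := by
      rw [hq] at hE'; linear_combination hE' + hκ'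
    rw [← this, mul_assoc, mul_comm (1 - γ), hLg, mul_one]
  have hζN : ζ ^ 2 * (D / N) ≤ R ^ 2 * δ ^ 2 / 4 := by
    rw [mul_div_assoc', div_le_iff₀ hN0]; linarith
  have hδ2 : 0 < δ ^ 2 := by positivity
  have hσ2 : σ ^ 2 ≤ (σ + ρ) ^ 2 := by gcongr; linarith
  have hmain := minimax_lower_bound_of_biasedChain (hs := hs) (b := b) (R := R) (σ := σ) (ρ := ρ)
    (ν := τ * R ^ 2 * δ ^ 2 / (400 * ζ ^ 2)) (t := t) hγ0.le hγ1 hp0 hp1 hη0 hη4 hδ2 hlam h1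
    (A := σ / 2) (by positivity) hE0 hκ0 (by rw [← hq]; linear_combination hE')
    (by linear_combination hκ') hR0 ?_ ?_ ?_ hρ ?_ n ?_ ?_
  · rw [hp, inv_inv] at hmain; exact hmain
  · have e1 : (σ / 2) ^ 2 / lam 1 ≤ R ^ 2 / 2 := by
      rw [div_le_iff₀ h1]; linarith [sq_nonneg σ]
    have e2 : (E + κ) ^ 2 / (δ ^ 2) ≤ R ^ 2 / 2 := by
      rw [div_le_iff₀ hδ2, hsum]
      have e3 : γ * (σ / 2 * η) * L ≤ ζ * η := by
        calc γ * (σ / 2 * η) * L = γ * (1 / 2) * (L * σ * η) := by ring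
          _ ≤ 1 * (L * σ * η) := by gcongr; linarith
          _ ≤ ζ * η := by rw [one_mul]; gcongr
      calc (γ * (σ / 2 * η) * L) ^ 2 ≤ (ζ * η) ^ 2 := by gcongr
        _ = ζ ^ 2 * (D / N) / 400 := by rw [mul_pow, hη2]; ring
        _ ≤ R ^ 2 / 2 * δ ^ 2 := by linarith [mul_nonneg (sq_nonneg R) hδ2.le]
    linarith
  · exact le_trans (div_le_div_of_nonneg_right (by linarith) hb0.le) hb
  -- From 1 - q ≥ p, the jump variance pE² is at most a multiple of σ²η²τ, which is small because
  -- 4τD ≤ N.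
  · have e1 : E ≤ σ / 2 * η / p := by
      rw [hE]
      exact div_le_div₀ (by positivity) (mul_le_of_le_one_left (by positivity) (by linarith)) hp0
        (by linarith)
    have e2 : p * E ^ 2 ≤ σ ^ 2 / 16 := by
      calc p * E ^ 2 ≤ p * (σ / 2 * η / p) ^ 2 := by gcongr
        _ = σ ^ 2 / 4 * (τ * (D / N)) / 400 := by
          rw [div_pow, mul_pow, hη2, hp]; field_simp; norm_num
        _ ≤ σ ^ 2 / 4 * (1 / 4) / 400 := by gcongr
        _ ≤ σ ^ 2 / 16 := by linarith [sq_nonneg σ]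
    have e3 : p * σ ^ 2 ≤ 1 * σ ^ 2 := by gcongr
    linarith
  · rw [le_div_iff₀ (by positivity), hη2]
    have : R ^ 2 * δ ^ 2 ≤ τ * (R ^ 2 * δ ^ 2) := le_mul_of_one_le_left (by positivity) (by linarith)
    have : 0 ≤ R ^ 2 * δ ^ 2 := by positivity
    linarith
  · have e1 : η ^ 2 / D = 1 / N / 400 := by rw [hη2]; field_simp
    rw [e1]
    have e2 : 1 / N ≤ 1 := (div_le_one hN0).2 (by rw [hN]; linarith [n.cast_nonneg (α := ℝ)])
    have e3 : n * (1 / N) ≤ 1 := by rw [mul_one_div, div_le_one hN0, hN]; linarith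
    have e4 : p * (n * (1 / N)) ≤ 1 := mul_le_one₀ hp1 (by positivity) e3
    linarith
  -- Uses q ≥ γ², 1 - q ≤ 2(1-γ) and ζ ≤ 2σ/(1-γ). Squaring gives the constant 25600 = 64 · 400.
  · have e1 : γ ^ 2 * (ζ * η) / 8 ≤ E := by
      have e2 : γ ^ 2 * (σ / 2 * η) / (2 * (1 - γ)) ≤ E := by
        rw [hE]; gcongr
      refine le_trans ?_ e2
      rw [div_eq_mul_inv _ (2 * (1 - γ)), mul_inv, ← hL]
      have := mul_le_mul_of_nonneg_left hζσ (by positivity : 0 ≤ γ ^ 2 * η)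
      linarith
    have e2 : (γ ^ 2 * (ζ * η) / 8) ^ 2 ≤ E ^ 2 := by gcongr
    refine le_trans ?_ e2
    rw [div_pow, mul_pow, mul_pow, hη2]
    have e3 : t ≤ γ ^ 4 * (ζ ^ 2 * D) / (32 * 25600) / N := by
      rw [le_div_iff₀ hN0]; linarith
    refine (mul_le_mul_of_nonneg_left e3 (by norm_num)).trans (le_of_eq ?_)
    ring

/-- The lower bound from the chains that differ in their stationary distributions. -/
theorem minimax_lower_bound_of_misspecification (hγ0 : 0 < γ) (hγ1 : γ < 1)
    (hτ : (1 - γ)⁻¹ ≤ τ) (hρ : 0 ≤ ρ) (hρσ : ρ ≤ σ * √τ / 108)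
    (hR0 : 0 ≤ R) (hδ : 0 < δ) (hζ : 0 < ζ) (hσ : 0 < σ)
    (hρζ : √τ * ρ ≤ ζ) (hζρ : ζ ≤ 2 * (√τ * ρ))
    (hlam : ∀ j ∈ blockIndices m, δ ^ 2 ≤ lam j) (h1 : 0 < lam 1)
    (hR : 4 * (σ + ρ) ^ 2 ≤ R ^ 2 * lam 1) (hb : (σ + ρ) / b ≤ R) (hb0 : 0 < b) (n : ℕ)
    (hdim : 4 * ζ ^ 2 * 2 ^ m ≤ (n + 1) * (R ^ 2 * δ ^ 2)) (hn : 4 * τ * 2 ^ m ≤ n + 1)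
    (ht : 32 * 25600 * ((n + 1) * t) ≤ γ ^ 4 * (ζ ^ 2 * 2 ^ m)) :
    ∃ r : WalshSpace lam hs, ENNReal.ofReal (1 / 16) ≤
      ⨅ θ : (Fin (n + 1) → unitInterval) → WalshSpace lam hs,
        ⨆ (M : Chain) (_ : M.IsValid (WalshSpace lam hs) r γ b R σ ρ τ
            (τ * R ^ 2 * δ ^ 2 / (400 * ζ ^ 2))),
          trajLaw M.trans M.stat (n + 1)
            {ω | ENNReal.ofReal t ≤
              eLpNorm (fun x => θ ω x - M.projValue (WalshSpace lam hs) r γ x) 2 M.stat ^ 2} := by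
  have hg : 0 < 1 - γ := by linarith
  set L := (1 - γ)⁻¹ with hL
  have hLg : L * (1 - γ) = 1 := inv_mul_cancel₀ hg.ne'
  have hL1 : 1 ≤ L := (one_le_inv₀ hg).2 (by linarith)
  have hτ0 : 0 < τ := by linarith
  obtain ⟨hp0, hp1, hpg, hqγ, hqp, hqg⟩ := jump_probability_bounds hγ0 hγ1 hτ
  obtain ⟨p, hp⟩ : ∃ p, p = τ⁻¹ := ⟨_, rfl⟩
  have hpτ : p * τ = 1 := by rw [hp]; exact inv_mul_cancel₀ hτ0.ne'
  obtain ⟨q, hq⟩ : ∃ q, q = γ * (1 - p) := ⟨_, rfl⟩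
  rw [← hp] at hp0 hp1 hpg hqγ hqp hqg
  rw [← hq] at hqγ hqp hqg
  have hq0 : 0 ≤ q := (sq_nonneg γ).trans hqγ
  have hq1 : q ≤ 1 := by linarith
  set N : ℝ := (n : ℝ) + 1 with hN
  have hN0 : 0 < N := by positivity
  set D : ℝ := 2 ^ m with hD
  have hD1 : 1 ≤ D := one_le_pow₀ (by norm_num)
  have hD0 : 0 < D := by linarith
  -- Larger by √τ than for the other family: only jumps, of probability 1/τ per step, reveal v after
  -- the initial state.
  obtain ⟨η, hη⟩ : ∃ η, η = √(τ * (D / N)) / 20 := ⟨_, rfl⟩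
  have hη0 : 0 ≤ η := by rw [hη]; positivity
  have hη2 : η ^ 2 = τ * (D / N) / 400 := by
    rw [hη, div_pow, Real.sq_sqrt (by positivity)]; norm_num
  have hDN : τ * (D / N) ≤ 1 / 4 := by
    rw [mul_div_assoc', div_le_iff₀ hN0]; linarith
  have hη4 : η ≤ 1 / 4 := abs_le_of_sq_le_sq' (by rw [hη2]; linarith) (by norm_num) |>.2
  have hη2' : 1 / 2 ≤ 1 - η ^ 2 := by rw [hη2]; linarith
  -- With A = ρ/2, B uses at most half of the misspecification budget; the remaining residual terms
  -- E and Eη fit into the other half.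
  obtain ⟨B, hB⟩ : ∃ B, B = q * (ρ / 2) := ⟨_, rfl⟩
  have hB0 : 0 ≤ B := by rw [hB]; positivity
  have hBρ : B ≤ ρ / 2 := by rw [hB]; exact mul_le_of_le_one_left (by positivity) hq1
  obtain ⟨E, hE⟩ : ∃ E, E = B * η / (1 - η ^ 2) := ⟨_, rfl⟩
  have hE' : E * (1 - η ^ 2) = B * η := by
    rw [hE]; exact div_mul_cancel₀ _ (by linarith)
  have hE0 : 0 ≤ E := by
    rw [hE]; exact div_nonneg (by positivity) (by linarith)
  have hEη : E ≤ ρ * η := by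
    rw [hE, div_le_iff₀ (by linarith)]
    have e1 : B * η ≤ ρ / 2 * η := by gcongr
    have e2 : ρ * η * (1 / 2) ≤ ρ * η * (1 - η ^ 2) := by gcongr
    linarith
  have hEη4 : E ≤ ρ / 4 := hEη.trans (by linarith [mul_le_mul_of_nonneg_left hη4 hρ])
  have hEηη : E * η ≤ ρ / 16 := by
    have := mul_le_mul hEη4 hη4 hη0 (by positivity)
    linarith
  have hEη0 : 0 ≤ E * η := by positivity
  obtain ⟨κ, hκ⟩ : ∃ κ, κ = γ * p * ((ρ / 2 + B) * η) * L := ⟨_, rfl⟩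
  have hκ' : κ * (1 - γ) = γ * p * ((ρ / 2 + B) * η) := by
    rw [hκ, mul_assoc, hLg, mul_one]
  have hκ0 : 0 ≤ κ := by rw [hκ]; positivity
  have hκη : κ ≤ ρ * η := by
    refine le_of_mul_le_mul_right ?_ hg
    rw [hκ']
    calc γ * p * ((ρ / 2 + B) * η) ≤ 1 * (1 - γ) * (ρ * η) := by gcongr; linarith
      _ = ρ * η * (1 - γ) := by ring
  have hζN : ζ ^ 2 * (D / N) ≤ R ^ 2 * δ ^ 2 / 4 := by
    rw [mul_div_assoc', div_le_iff₀ hN0]; linarith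
  have hδ2 : 0 < δ ^ 2 := by positivity
  have hρ2 : ρ ^ 2 ≤ (σ + ρ) ^ 2 := by gcongr; linarith
  have hτρ : τ * ρ ^ 2 ≤ ζ ^ 2 := by
    rw [← Real.sq_sqrt hτ0.le, ← mul_pow]; gcongr
  have hζρ2 : ζ ^ 2 ≤ 4 * (τ * ρ ^ 2) := by
    calc ζ ^ 2 ≤ (2 * (√τ * ρ)) ^ 2 := by gcongr
      _ = 4 * (τ * ρ ^ 2) := by rw [mul_pow, mul_pow, Real.sq_sqrt hτ0.le]; norm_num
  have hmain := minimax_lower_bound_of_swapChain (hs := hs) (b := b) (R := R) (σ := σ) (ρ := ρ)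
    (ν := τ * R ^ 2 * δ ^ 2 / (400 * ζ ^ 2)) (t := t) hγ0.le hγ1 hp0 hp1 hη0 hη4 hδ2 hlam h1
    (A := ρ / 2) (by positivity) hB0 hE0 hκ0 (by rw [hB, hq]) hE'
    (by linear_combination hκ') hR0 ?_ hb0.le ?_ ?_ (by linarith) ?_ n ?_ ?_
  · rw [hp, inv_inv] at hmain; exact hmain
  · have e1 : (ρ / 2 - E * η) ^ 2 / lam 1 ≤ R ^ 2 / 2 := by
      rw [div_le_iff₀ h1]
      have : (ρ / 2 - E * η) ^ 2 ≤ ρ ^ 2 := by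
        have : 0 ≤ ρ / 2 - E * η := by linarith
        gcongr; linarith
      linarith [sq_nonneg ρ]
    have e2 : (E + κ) ^ 2 / (δ ^ 2) ≤ R ^ 2 / 2 := by
      rw [div_le_iff₀ hδ2]
      calc (E + κ) ^ 2 ≤ (ρ * η + ρ * η) ^ 2 := by gcongr
        _ = 4 * (τ * ρ ^ 2) * (D / N) / 400 := by
          rw [← two_mul, mul_pow, mul_pow, hη2]; ring
        _ ≤ 4 * ζ ^ 2 * (D / N) / 400 := by gcongr
        _ ≤ R ^ 2 / 2 * δ ^ 2 := by linarith [mul_nonneg (sq_nonneg R) hδ2.le]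
    linarith
  · exact le_trans (div_le_div_of_nonneg_right (by linarith) hb0.le) hb
  -- Only jumps create variance, and p = 1/τ, so ρ may be as large as a multiple of σ√τ.
  · calc p * (2 * (ρ / 2 + B)) ^ 2 ≤ p * (2 * (σ * √τ / 108)) ^ 2 := by gcongr; linarith
      _ = p * τ * σ ^ 2 * (4 / 108 ^ 2) := by
        rw [mul_pow, div_pow, mul_pow, Real.sq_sqrt hτ0.le]; ring
      _ ≤ σ ^ 2 := by rw [hpτ]; linarith [sq_nonneg σ]
  -- The χ² radius is met exactly at this η: 4η² = τD/(100N), and D/N ≤ R²δ²/(4ζ²).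
  · rw [le_div_iff₀ (by positivity), hη2]
    have := mul_le_mul_of_nonneg_left hζN hτ0.le
    linarith
  · have e1 : η ^ 2 / D = τ * (1 / N) / 400 := by rw [hη2]; field_simp
    rw [e1]
    have e2 : τ * (1 / N) ≤ τ * (D / N) := by gcongr
    have e3 : n * (1 / N) ≤ 1 := by rw [mul_one_div, div_le_one hN0, hN]; linarith
    have e4 : n * (p * (2 * (τ * (1 / N) / 400))) = p * τ * (n * (1 / N)) / 200 := by ring
    rw [e4, hpτ]
    linarith
  · have e1 : γ ^ 2 * (ρ * η) / 2 ≤ E := by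
      have e2 : B * η ≤ E := by
        rw [← hE']; exact mul_le_of_le_one_right hE0 (by linarith [sq_nonneg η])
      refine le_trans ?_ e2
      rw [hB]
      have := mul_le_mul_of_nonneg_right hqγ (by positivity : 0 ≤ ρ * η)
      linarith
    have e2 : (γ ^ 2 * (ρ * η) / 2) ^ 2 ≤ E ^ 2 := by gcongr
    refine le_trans ?_ e2
    rw [div_pow, mul_pow, mul_pow, hη2]
    have e3 : t ≤ γ ^ 4 * (ζ ^ 2 * D) / (32 * 25600) / N := by
      rw [le_div_iff₀ hN0]; linarith
    have e4 : 32 * t ≤ γ ^ 4 * (D / N) / 25600 * ζ ^ 2 :=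
      (mul_le_mul_of_nonneg_left e3 (by norm_num)).trans (le_of_eq (by ring))
    have e5 := mul_le_mul_of_nonneg_left hζρ2 (by positivity : 0 ≤ γ ^ 4 * (D / N) / 25600)
    have e6 : 0 ≤ γ ^ 4 * (D / N) * (τ * ρ ^ 2) := by positivity
    linarith

end Tuning

/-! ## The statistical dimension -/

section StatDim

variable {lam : ℕ → ℝ} {δ : ℝ}

theorem sq_le_of_lt_statDim (hanti : Antitone lam) (hs : Summable lam) (hδ : 0 < δ) {j : ℕ}
    (hj : j < statDim lam δ) : δ ^ 2 ≤ lam j := by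
  have hne : {d : ℕ | ∃ j, d = j + 1 ∧ δ ^ 2 ≤ lam j}.Nonempty := by
    by_contra h
    rw [Set.not_nonempty_iff_eq_empty] at h
    rw [statDim, h, csSup_empty] at hj
    simp at hj
  have hbdd : BddAbove {d : ℕ | ∃ j, d = j + 1 ∧ δ ^ 2 ≤ lam j} := by
    obtain ⟨N, hN⟩ := Filter.eventually_atTop.1
      (hs.tendsto_atTop_zero.eventually (gt_mem_nhds (by positivity : 0 < δ ^ 2)))
    refine ⟨N, ?_⟩
    rintro _ ⟨i, rfl, hi⟩
    by_contra! hlt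
    exact absurd (hN i (by omega)) (not_lt.2 hi)
  obtain ⟨i, hi, hle⟩ := Nat.sSup_mem hne hbdd
  rw [statDim, hi] at hj
  exact hle.trans (hanti (by omega))

/-- Each of the first d_n terms of the sum equals 1. The critical inequality thereby bounds the
dimension. -/
theorem statDim_le_tsum (hanti : Antitone lam) (h0 : ∀ j, 0 ≤ lam j) (hs : Summable lam)
    (hδ : 0 < δ) : (statDim lam δ : ℝ) ≤ ∑' j, min (lam j / δ ^ 2) 1 := by
  have hsum : Summable fun j => min (lam j / δ ^ 2) 1 :=
    Summable.of_nonneg_of_le (fun j => le_min (div_nonneg (h0 j) (by positivity)) zero_le_one)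
      (fun j => min_le_left _ _) (hs.div_const _)
  calc (statDim lam δ : ℝ) = ∑ j ∈ Finset.range (statDim lam δ), (1 : ℝ) := by simp
    _ = ∑ j ∈ Finset.range (statDim lam δ), min (lam j / δ ^ 2) 1 := by
      refine Finset.sum_congr rfl fun j hj => ?_
      rw [min_eq_right]
      rw [le_div_iff₀ (by positivity), one_mul]
      exact sq_le_of_lt_statDim hanti hs hδ (Finset.mem_range.1 hj)
    _ ≤ _ := hsum.sum_le_tsum _ fun j _ =>
      le_min (div_nonneg (h0 j) (by positivity)) zero_le_one

theorem tsum_min_pos (h0 : ∀ j, 0 ≤ lam j) (h1 : 0 < lam 1) (hs : Summable lam) (hδ : 0 < δ) :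
    0 < ∑' j, min (lam j / δ ^ 2) 1 :=
  (Summable.of_nonneg_of_le
    (fun j => le_min (div_nonneg (h0 j) (by positivity)) zero_le_one)
    (fun j => min_le_left _ _) (hs.div_const _)).tsum_pos
    (fun j => le_min (div_nonneg (h0 j) (by positivity)) zero_le_one) 1
    (lt_min (by positivity) one_pos)

/-- A dyadic truncation of the statistical dimension. -/
theorem exists_blockIndices_of_statDim (hanti : Antitone lam) (hs : Summable lam) (hδ : 0 < δ)
    (hd : 0 < statDim lam δ) : ∃ m : ℕ, (2 ^ m ≤ statDim lam δ ∧ statDim lam δ ≤ 2 * 2 ^ m) ∧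
      ∀ j ∈ blockIndices m, δ ^ 2 ≤ lam j := by
  -- For m ≥ 1 the block reaches index 2^m, as index 1 is skipped, and that index must stay below
  -- the dimension; hence the subtraction. In dimension 1 the logarithm of 0 is 0 and the block is
  -- the constant alone.
  refine ⟨Nat.log 2 (statDim lam δ - 1), ⟨?_, ?_⟩, fun j hj =>
    sq_le_of_lt_statDim hanti hs hδ ?_⟩
  · rcases Nat.eq_zero_or_pos (statDim lam δ - 1) with h | h
    · rw [h, Nat.log_zero_right, pow_zero]; exact hd
    · have := Nat.pow_log_le_self 2 h.ne'
      omega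
  · have := Nat.lt_pow_succ_log_self (b := 2) (by norm_num) (statDim lam δ - 1)
    rw [pow_succ] at this
    omega
  · rw [blockIndices, Finset.mem_insert, Finset.mem_Icc] at hj
    rcases hj with rfl | ⟨h2, hj⟩
    · exact hd
    · rcases Nat.eq_zero_or_pos (statDim lam δ - 1) with h | h
      · rw [h] at hj
        simp at hj
        omega
      · have := Nat.pow_log_le_self 2 h.ne'
        omega

end StatDim

end PolicyEval

end

/-! ### Assembly -/

theorem theorem2 :
    -- absolute constants: `c` in the sample size condition, `c₂` in the probability bound
    ∃ c > (0 : ℝ), ∃ c₂ > (0 : ℝ),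
    -- `c₁` depends only on the regularity constant and on a lower bound for the discount factor
    ∀ creg > (0 : ℝ), ∀ γ₀ > (0 : ℝ), ∃ c₁ > (0 : ℝ),
    ∀ (γ : ℝ), γ₀ ≤ γ → γ < 1 →
    -- the eigenvalues, `lam j = λ_{j+1}`
    ∀ (lam : ℕ → ℝ) (b : ℝ), Antitone lam → (∀ j, 0 ≤ lam j) → 0 < lam 1 → Summable lam →
    0 < b → ∑' j, lam j ≤ b ^ 2 / 4 →
    ∀ (n : ℕ) (R σ ρ τ δ : ℝ), 0 < σ →
    -- `δ` is the smallest positive solution of the critical inequality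
    IsLeast {t : ℝ | 0 < t ∧ CriticalInequality lam n R (noiseLevel γ σ ρ τ) t} δ →
    -- regularity of the eigenvalues
    creg * n * δ ^ 2 ≤ 2 * noiseLevel γ σ ρ τ ^ 2 / R ^ 2 * statDim lam δ →
    -- the sample size is large enough
    R ^ 2 * δ ^ 2 ≤ c * (noiseLevel γ σ ρ τ ^ 2 / τ) → δ ≤ c * b →
    -- constraints on the parameters
    max (2 / √(lam 1) * (σ + ρ)) (1 / (4 * b) * σ) ≤ R →
    1 / 50 * σ * (1 - γ)⁻¹ * √(statDim lam δ / n) ≤ ρ →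
    ρ ≤ 1 / 108 * σ * min (1 - γ)⁻¹ (√τ) →
    (1 - γ)⁻¹ ≤ τ →
    -- the RKHS and its eigensystem
    ∃ (H : Type) (_ : NormedAddCommGroup H) (_ : InnerProductSpace ℝ H) (_ : CompleteSpace H)
      (_ : RKHS ℝ H unitInterval ℝ) (φ : ℕ → unitInterval → ℝ),
      HasEigensystem H lam φ ∧ (∀ j x, |φ j x| ≤ 2) ∧ (∃ h : H, ∀ x, h x = 1) ∧
      -- the reward function
      ∃ r : H,
        ENNReal.ofReal c₂ ≤
          ⨅ θ : (Fin n → unitInterval) → H,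
            ⨆ (M : Chain) (_ : M.IsValid H r γ b R σ ρ τ
              (τ * R ^ 2 * δ ^ 2 / (400 * noiseLevel γ σ ρ τ ^ 2))),
              trajLaw M.trans M.stat n
                {ω | ENNReal.ofReal (c₁ * R ^ 2 * δ ^ 2) ≤
                  eLpNorm (fun x => θ ω x - M.projValue H r γ x) 2 M.stat ^ 2} := by
  -- In c₁, 32 is the separation required between targets, 25600 comes from the lower bound on E²,
  -- and 4 from creg · nR²δ² ≤ 2ζ²d_n ≤ 4ζ²2^m.
  refine ⟨1, one_pos, 1 / 16, by norm_num, fun creg hcreg γ₀ hγ₀ =>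
    ⟨creg * γ₀ ^ 4 / (32 * 25600 * 4), by positivity, ?_⟩⟩
  intro γ hγ hγ1 lam b hanti h0 h1 hs hb htr n R σ ρ τ δ hσ hδ hreg hn _ hR hρ1 hρ2 hτ
  obtain ⟨⟨hδ0, hcrit⟩, -⟩ := hδ
  have hγ0 : 0 < γ := hγ₀.trans_le hγ
  have hg : 0 < 1 - γ := by linarith
  have hL : 0 < (1 - γ)⁻¹ := inv_pos.2 hg
  have hτ0 : 0 < τ := hL.trans_le hτ
  have hρ : 0 ≤ ρ := le_trans (by positivity) hρ1
  obtain ⟨ζ, hζ⟩ : ∃ ζ, ζ = noiseLevel γ σ ρ τ := ⟨_, rfl⟩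
  rw [← hζ] at hcrit hreg hn ⊢
  rw [noiseLevel] at hζ
  have hσζ : (1 - γ)⁻¹ * σ ≤ ζ := by rw [hζ]; linarith [mul_nonneg (Real.sqrt_nonneg τ) hρ]
  have hρζ : √τ * ρ ≤ ζ := by rw [hζ]; linarith [mul_pos hL hσ]
  have hζ0 : 0 < ζ := (mul_pos hL hσ).trans_le hσζ
  have hl : 0 < √(lam 1) := Real.sqrt_pos.2 h1
  have hRl : 2 * (σ + ρ) ≤ R * √(lam 1) := by
    have := (le_max_left _ _).trans hR
    rwa [div_mul_eq_mul_div, div_le_iff₀ hl] at this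
  have hR0 : 0 < R := pos_of_mul_pos_left (lt_of_lt_of_le (by positivity) hRl) hl.le
  have hR2 : 4 * (σ + ρ) ^ 2 ≤ R ^ 2 * lam 1 := by
    calc 4 * (σ + ρ) ^ 2 = (2 * (σ + ρ)) ^ 2 := by ring
      _ ≤ (R * √(lam 1)) ^ 2 := by gcongr
      _ = R ^ 2 * lam 1 := by rw [mul_pow, Real.sq_sqrt h1.le]
  have hbl : √(lam 1) ≤ b := by
    rw [Real.sqrt_le_left hb.le]
    have := hs.le_tsum 1 fun j _ => h0 j
    linarith [sq_nonneg b]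
  have hRb : (σ + ρ) / b ≤ R := by
    rw [div_le_iff₀ hb]
    linarith [mul_le_mul_of_nonneg_left hbl hR0.le]
  have hS := tsum_min_pos h0 h1 hs hδ0
  have hdS := statDim_le_tsum hanti h0 hs hδ0
  rw [CriticalInequality] at hcrit
  have hn0 : n ≠ 0 := by
    rintro rfl
    simp only [Nat.cast_zero, Real.sqrt_zero, zero_mul, zero_div] at hcrit
    exact absurd (Real.sqrt_pos.2 hS) (not_lt.2 hcrit)
  obtain ⟨k, rfl⟩ := Nat.exists_eq_succ_of_ne_zero hn0
  have hN0 : (0 : ℝ) < (k.succ : ℕ) := by positivity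
  have hdim : 4 * ζ ^ 2 * statDim lam δ ≤ (k.succ : ℕ) * (R ^ 2 * δ ^ 2) := by
    have e1 : ∑' j, min (lam j / δ ^ 2) 1 ≤ (√(k.succ : ℕ) * R / (2 * ζ) * δ) ^ 2 := by
      rw [← Real.sqrt_le_left (by positivity)]; exact hcrit
    rw [mul_pow, div_pow, mul_pow, Real.sq_sqrt hN0.le, div_mul_eq_mul_div,
      le_div_iff₀ (by positivity)] at e1
    have e2 := mul_le_mul_of_nonneg_right hdS (by positivity : 0 ≤ (2 * ζ) ^ 2)
    linarith
  have hreg' : creg * ((k.succ : ℕ) * (R ^ 2 * δ ^ 2)) ≤ 2 * ζ ^ 2 * statDim lam δ := by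
    rw [div_mul_eq_mul_div, le_div_iff₀ (by positivity)] at hreg
    linarith
  have hd : 0 < statDim lam δ := by
    rw [← Nat.cast_pos (α := ℝ)]
    refine pos_of_mul_pos_right (a := 2 * ζ ^ 2) (lt_of_lt_of_le (by positivity) hreg')
      (by positivity)
  -- The dimension bound 4ζ²d_n ≤ nR²δ² combined with R²δ² ≤ ζ²/τ. It keeps the bias η below 1/4 in
  -- both families.
  have hnτ : 4 * τ * statDim lam δ ≤ (k.succ : ℕ) := by
    rw [one_mul, le_div_iff₀ hτ0] at hn
    have e1 := mul_le_mul_of_nonneg_left hn hN0.le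
    have e2 := mul_le_mul_of_nonneg_left hdim hτ0.le
    refine le_of_mul_le_mul_right (a := ζ ^ 2) ?_ (by positivity)
    linarith
  obtain ⟨m, ⟨hm1, hm2⟩, hblock⟩ := exists_blockIndices_of_statDim hanti hs hδ0 hd
  have hm1' : (2 : ℝ) ^ m ≤ statDim lam δ := by exact_mod_cast hm1
  have hm2' : (statDim lam δ : ℝ) ≤ 2 * 2 ^ m := by exact_mod_cast hm2
  rw [Nat.succ_eq_add_one, Nat.cast_add, Nat.cast_one] at hdim hnτ hreg'
  have hdim' : 4 * ζ ^ 2 * 2 ^ m ≤ (k + 1) * (R ^ 2 * δ ^ 2) :=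
    le_trans (by gcongr) hdim
  have hnτ' : 4 * τ * 2 ^ m ≤ k + 1 := le_trans (by gcongr) hnτ
  have ht : 32 * 25600 * ((k + 1) * (creg * γ₀ ^ 4 / (32 * 25600 * 4) * R ^ 2 * δ ^ 2)) ≤
      γ ^ 4 * (ζ ^ 2 * 2 ^ m) := by
    calc 32 * 25600 * ((k + 1) * (creg * γ₀ ^ 4 / (32 * 25600 * 4) * R ^ 2 * δ ^ 2))
        = γ₀ ^ 4 * (creg * ((k + 1) * (R ^ 2 * δ ^ 2))) / 4 := by ring
      _ ≤ γ₀ ^ 4 * (2 * ζ ^ 2 * (2 * 2 ^ m)) / 4 := by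
        gcongr ?_ * ?_ / 4
        exact hreg'.trans (by gcongr)
      _ = γ₀ ^ 4 * (ζ ^ 2 * 2 ^ m) := by ring
      _ ≤ γ ^ 4 * (ζ ^ 2 * 2 ^ m) := by gcongr
  refine ⟨WalshSpace lam hs, inferInstance, inferInstance, inferInstance, inferInstance, eigenfun,
    WalshSpace.hasEigensystem h0, fun j x => by rw [abs_eigenfun]; norm_num, ?_, ?_⟩
  · obtain ⟨h, hh, -⟩ := WalshSpace.exists_sum (hs := hs) {0}
      (by simpa using h1.trans_le (hanti zero_le_one)) fun _ => 1
    exact ⟨h, fun x => by simp [hh, eigenfun_zero]⟩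
  -- The dominant summand of the noise level decides which family is used.
  · rcases le_total (√τ * ρ) ((1 - γ)⁻¹ * σ) with hcase | hcase
    · exact minimax_lower_bound_of_variance hγ0 hγ1 hτ hσ hρ hR0.le hδ0 hζ0 hσζ (by linarith)
        hblock h1 hR2 hRb hb k hdim' hnτ' ht
    · refine minimax_lower_bound_of_misspecification hγ0 hγ1 hτ hρ ?_ hR0.le hδ0 hζ0 hσ hρζ
        (by linarith) hblock h1 hR2 hRb hb k hdim' hnτ' ht
      refine hρ2.trans ?_
      calc 1 / 108 * σ * min (1 - γ)⁻¹ (√τ) ≤ 1 / 108 * σ * √τ := by gcongr; exact min_le_right _ _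
        _ = σ * √τ / 108 := by ring
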